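/- Let $S^1=\mathbb R/\mathbb Z$, let $\mu(f)=\int_{S^1} f\,dx$, and let $A=\mu-\partial_x^2$, that is, $Av=\mu(v)-v_{xx}$, which is an isomorphism from $H^s(S^1)$ onto $H^{s-2}(S^1)$; all functions are real-valued. Consider the periodic Cauchy problem for the $\mu$HS equation $$u_t+uu_x+A^{-1}\partial_x\Big(2\mu(u)u+\tfrac12u_x^2\Big)=0,\qquad u(0,x)=u_o(x),\qquad x\in S^1. \qquad (*)$$ For an open interval $I\ni 0$, a solution of $(*)$ on $I$ is a curve $u\in C(I,H^s(S^1))\cap C^1(I,H^{s-1}(S^1))$ with $u(0)=u_o$ that satisfies the equation in $H^{s-1}(S^1)$ for every $t\in I$. **Theorem.** Let $s>3/2$. 1. (Local existence and continuous dependence.) For every $u_o\in H^s(S^1)$ there are $T>0$ and an open ball $B$ around $u_o$ in $H^s(S^1)$ such that for every $v_o\in B$ the problem $(*)$ with initial data $v_o$ has a solution $\Phi(v_o)$ on $(-T,T)$, and the map $v_o\mapsto\Phi(v_o)$ is continuous on $B$: if $w_o\to v_o$ in $H^s(S^1)$, then $\Phi(w_o)\to\Phi(v_o)$ in $H^s(S^1)$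 and $\partial_t\Phi(w_o)\to\partial_t\Phi(v_o)$ in $H^{s-1}(S^1)$, both uniformly on $(-T,T)$. 2. (Uniqueness.) Two solutions of $(*)$ with the same initial data on the same bounded open interval containing $0$ coincide. 3. (Persistence.) Let $a<0<b$ be finite and let $u$ be a solution of $(*)$ on $(a,b)$. If $\sup_{0\le t<b}\|u(t,\cdot)\|_{C^1}<\infty$, then $u$ extends to a solution on $(a,b')$ for some $b'>b$; if $\sup_{a<t\le 0}\|u(t,\cdot)\|_{C^1}<\infty$, then $u$ extends to a solution on $(a',b)$ for some $a'<a$. -/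

import Mathlib

open MeasureTheory Set Filter Topology
open scoped ContDiff

namespace MuHS

noncomputable section

/-- Real square-integrable functions (classes modulo null sets) on the circle `S¹ = ℝ/ℤ`,
with respect to its normalized Haar (that is, Lebesgue) measure. -/
abbrev L2 : Type := Lp ℝ 2 (AddCircle.haarAddCircle (T := (1 : ℝ)))

/-- The `n`-th Fourier coefficient `∫_{S¹} f(x) e^{-2πinx} dx` of a real function on the circle. -/
def coeff (f : L2) (n : ℤ) : ℂ :=
  fourierCoeff (T := (1 : ℝ)) (fun x => ((f x : ℝ) : ℂ)) n

/-- The symbol `1 + (2πn)²` of the operator `1 - ∂ₓ²`. -/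
def weight (n : ℤ) : ℝ := 1 + (2 * Real.pi * n) ^ 2

theorem weight_pos (n : ℤ) : 0 < weight n := by
  unfold weight; positivity

theorem one_le_weight (n : ℤ) : 1 ≤ weight n := by
  unfold weight; nlinarith [sq_nonneg (2 * Real.pi * (n : ℝ))]

theorem coeff_eq_repr (f : L2) (n : ℤ) :
    coeff f n = fourierBasis.repr
      (Complex.ofRealCLM.compLpL 2 (AddCircle.haarAddCircle (T := (1 : ℝ))) f) n := by
  rw [fourierBasis_repr]
  refine (congrFun (fourierCoeff_congr_ae ?_) n).symm
  exact Complex.ofRealCLM.coeFn_compLpL f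

theorem coeff_add (f g : L2) (n : ℤ) : coeff (f + g) n = coeff f n + coeff g n := by
  simp only [coeff_eq_repr, map_add, lp.coeFn_add, Pi.add_apply]

theorem coeff_smul (c : ℝ) (f : L2) (n : ℤ) : coeff (c • f) n = c • coeff f n := by
  have h : Complex.ofRealCLM.compLpL 2 (AddCircle.haarAddCircle (T := (1 : ℝ))) (c • f)
      = (c : ℂ) • Complex.ofRealCLM.compLpL 2 (AddCircle.haarAddCircle (T := (1 : ℝ))) f := by
    rw [map_smul]; exact (Complex.coe_smul c _).symm
  rw [coeff_eq_repr, h, map_smul, coeff_eq_repr]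
  simp only [lp.coeFn_smul, Pi.smul_apply]
  exact Complex.coe_smul c _

theorem eq_zero_of_coeff (f : L2) (h : ∀ n, coeff f n = 0) : f = 0 := by
  have h1 : Complex.ofRealCLM.compLpL 2 (AddCircle.haarAddCircle (T := (1 : ℝ))) f = 0 := by
    apply fourierBasis.repr.injective
    rw [map_zero]
    ext n
    rw [← coeff_eq_repr, h n]; rfl
  have h2 := Complex.ofRealCLM.coeFn_compLpL (p := 2) f
  rw [h1] at h2
  rw [Lp.eq_zero_iff_ae_eq_zero]
  filter_upwards [h2, Lp.coeFn_zero ℂ 2 (AddCircle.haarAddCircle (T := (1 : ℝ)))] with x hx hx0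
  rw [hx0] at hx
  simpa using hx.symm

/-- The weighted Fourier coefficients `(1 + (2πn)²)^{s/2} f̂(n)`, that is, the Fourier coefficients
of `(1 - ∂ₓ²)^{s/2} f`. -/
def weightedCoeff (s : ℝ) (f : L2) (n : ℤ) : ℂ := (weight n ^ (s / 2)) • coeff f n

/-- The real Sobolev space `H^s(S¹)` of order `s ≥ 0`: the functions `f ∈ L²(S¹)` with
`∑ₙ (1 + (2πn)²)^s |f̂(n)|² < ∞`. Its norm is the one of `H^s` (see `Hs.norm_sq`), not
that of `L²`. -/
def Hs (s : ℝ) : Type := {f : L2 // Memℓp (weightedCoeff s f) 2}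

/-- The same set as a linear subspace of `L²`. -/
def HsSubmodule (s : ℝ) : Submodule ℝ L2 where
  carrier := {f | Memℓp (weightedCoeff s f) 2}
  zero_mem' := by
    have : weightedCoeff s 0 = 0 := by
      funext n
      have := coeff_smul 0 0 n
      simp only [zero_smul] at this
      simp [weightedCoeff, this]
    simp only [Set.mem_ofPred_eq, this]
    exact zero_memℓp
  add_mem' := by
    intro f g hf hg
    have : weightedCoeff s (f + g) = weightedCoeff s f + weightedCoeff s g := by
      funext n; simp [weightedCoeff, coeff_add]
    simp only [Set.mem_ofPred_eq, this]
    exact Memℓp.add hf hg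
  smul_mem' := by
    intro c f hf
    have : weightedCoeff s (c • f) = c • weightedCoeff s f := by
      funext n; simp only [weightedCoeff, coeff_smul, Pi.smul_apply]; rw [smul_comm]
    simp only [Set.mem_ofPred_eq, this]
    exact Memℓp.const_smul hf c

instance (s : ℝ) : AddCommGroup (Hs s) := inferInstanceAs (AddCommGroup (HsSubmodule s))

instance (s : ℝ) : Module ℝ (Hs s) := inferInstanceAs (Module ℝ (HsSubmodule s))

/-- The element of `H^s` as an element of `L²`. -/
def Hs.toL2 {s : ℝ} (f : Hs s) : L2 := f.1

/-- The linear map `f ↦ ((1 + (2πn)²)^{s/2} f̂(n))ₙ` from `H^s` to `ℓ²`. -/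
def Hs.toSeq (s : ℝ) : Hs s →ₗ[ℝ] lp (fun _ : ℤ => ℂ) 2 where
  toFun f := ⟨weightedCoeff s f.toL2, f.2⟩
  map_add' f g := by
    ext n
    change weightedCoeff s (f.toL2 + g.toL2) n = weightedCoeff s f.toL2 n + weightedCoeff s g.toL2 n
    simp [weightedCoeff, coeff_add]
  map_smul' c f := by
    ext n
    change weightedCoeff s (c • f.toL2) n = c • weightedCoeff s f.toL2 n
    simp only [weightedCoeff, coeff_smul]; rw [smul_comm]

theorem Hs.toSeq_injective (s : ℝ) : Function.Injective (Hs.toSeq s) := by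
  rw [injective_iff_map_eq_zero]
  intro f hf
  apply Subtype.ext
  refine eq_zero_of_coeff f.1 fun n => ?_
  have h : weightedCoeff s f.1 n = 0 := congrFun (congrArg Subtype.val hf) n
  exact (smul_eq_zero.1 h).resolve_left (Real.rpow_pos_of_pos (weight_pos n) _).ne'

instance (s : ℝ) : NormedAddCommGroup (Hs s) :=
  NormedAddCommGroup.induced (Hs s) (lp (fun _ : ℤ => ℂ) 2) (Hs.toSeq s) (Hs.toSeq_injective s)

instance (s : ℝ) : NormedSpace ℝ (Hs s) :=
  NormedSpace.induced ℝ (Hs s) (lp (fun _ : ℤ => ℂ) 2) (Hs.toSeq s)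

/-- `‖f‖²_{H^s} = ∑ₙ (1 + (2πn)²)^s |f̂(n)|²`. -/
theorem Hs.norm_sq {s : ℝ} (f : Hs s) :
    ‖f‖ ^ 2 = ∑' n : ℤ, weight n ^ s * ‖coeff f.toL2 n‖ ^ 2 := by
  have h := lp.norm_rpow_eq_tsum (p := 2) (by norm_num) (Hs.toSeq s f)
  simp only [ENNReal.toReal_ofNat, Real.rpow_two] at h
  change ‖Hs.toSeq s f‖ ^ 2 = _
  rw [h]
  refine tsum_congr fun n => ?_
  change ‖weightedCoeff s f.toL2 n‖ ^ 2 = _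
  have hw := weight_pos n
  rw [weightedCoeff, norm_smul, mul_pow, Real.norm_of_nonneg (Real.rpow_nonneg hw.le _),
    ← Real.rpow_natCast, ← Real.rpow_mul hw.le]
  norm_num

/-- The inclusion of `H^s` into `H^r` for `r ≤ s`. -/
def Hs.incl {r s : ℝ} (h : r ≤ s) (f : Hs s) : Hs r :=
  ⟨f.toL2, by
    refine memℓp_gen ((Memℓp.summable (by norm_num) f.2).of_nonneg_of_le
      (fun n => by positivity) fun n => ?_)
    refine Real.rpow_le_rpow (norm_nonneg _) ?_ (by norm_num)
    simp only [weightedCoeff, norm_smul]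
    gcongr ?_ * _
    rw [Real.norm_of_nonneg (Real.rpow_nonneg (weight_pos n).le _),
      Real.norm_of_nonneg (Real.rpow_nonneg (weight_pos n).le _)]
    exact Real.rpow_le_rpow_of_exponent_le (one_le_weight n) (by linarith)⟩

/-- The mean `μ(f) = ∫_{S¹} f dx`. -/
def mean (f : AddCircle (1 : ℝ) → ℝ) : ℝ := ∫ x in (0 : ℝ)..1, f (x : AddCircle (1 : ℝ))

/-- Test functions on the circle, seen as `1`-periodic smooth functions on the line. -/
def IsTest (φ : ℝ → ℝ) : Prop := ContDiff ℝ ∞ φ ∧ Function.Periodic φ 1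

/-- `g = ∂ₓ f` in the sense of distributions on the circle: `∫ f φ' = - ∫ g φ`
for all test functions. -/
def IsWeakDeriv (f g : AddCircle (1 : ℝ) → ℝ) : Prop :=
  ∀ φ : ℝ → ℝ, IsTest φ →
    ∫ x in (0 : ℝ)..1, f (x : AddCircle (1 : ℝ)) * deriv φ x =
      -∫ x in (0 : ℝ)..1, g (x : AddCircle (1 : ℝ)) * φ x

/-- `p = A⁻¹ ∂ₓ g`, where `A p = μ(p) - pₓₓ`; that is, `A p = ∂ₓ g` in the sense of distributions
on the circle: `μ(p) ∫ φ - ∫ p φ'' = - ∫ g φ'` for all test functions. -/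
def IsInertiaInvDeriv (g p : AddCircle (1 : ℝ) → ℝ) : Prop :=
  ∀ φ : ℝ → ℝ, IsTest φ →
    mean p * (∫ x in (0 : ℝ)..1, φ x) -
        ∫ x in (0 : ℝ)..1, p (x : AddCircle (1 : ℝ)) * deriv (deriv φ) x =
      -∫ x in (0 : ℝ)..1, g (x : AddCircle (1 : ℝ)) * deriv φ x

/-- The equation `v + u uₓ + A⁻¹ ∂ₓ (2 μ(u) u + uₓ²/2) = 0` for `u ∈ H^s` and `v ∈ H^{s-1}`
(which stands for the time derivative of `u`). -/
def Equation {s : ℝ} (u : Hs s) (v : Hs (s - 1)) : Prop :=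
  ∃ (ux : Hs (s - 1)) (p : Hs s),
    IsWeakDeriv u.toL2 ux.toL2 ∧
    IsInertiaInvDeriv
      (fun x => 2 * mean u.toL2 * u.toL2 x + 1 / 2 * (ux.toL2 x) ^ 2) p.toL2 ∧
    ∀ᵐ x ∂(AddCircle.haarAddCircle (T := (1 : ℝ))),
      v.toL2 x + u.toL2 x * ux.toL2 x + p.toL2 x = 0

/-- The curve `u`, seen as a curve in `H^{s-1}`. -/
def lower {s : ℝ} (u : ℝ → Hs s) (t : ℝ) : Hs (s - 1) := (u t).incl (by linarith)

/-- `u ∈ C(I, H^s) ∩ C¹(I, H^{s-1})` solves, on the open interval `I` containing `0`, the initial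
value problem `u_t + u uₓ + A⁻¹ ∂ₓ (2 μ(u) u + uₓ²/2) = 0`, `u(0) = u₀`. -/
structure IsSolution {s : ℝ} (I : Set ℝ) (u₀ : Hs s) (u : ℝ → Hs s) : Prop where
  continuousOn : ContinuousOn u I
  differentiableAt : ∀ t ∈ I, DifferentiableAt ℝ (lower u) t
  continuousOn_deriv : ContinuousOn (deriv (lower u)) I
  equation : ∀ t ∈ I, Equation (u t) (deriv (lower u) t)
  initial : u 0 = u₀

/-- `‖f‖_{C¹} ≤ K`: the class `f` has a continuously differentiable representative `F` (written as
a function on the line) with `|F| + |F'| ≤ K` everywhere. -/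
def C1NormLE (f : L2) (K : ℝ) : Prop :=
  ∃ F : ℝ → ℝ, ContDiff ℝ 1 F ∧ (∀ᵐ x : ℝ, F x = f (x : AddCircle (1 : ℝ))) ∧
    ∀ x, |F x| + |deriv F x| ≤ K

end

end MuHS

/-!
The equation loses a derivative when it is read as an ordinary differential equation in `H^s`, but
not in Lagrangian variables. Let `η` be the flow of `u`, let `ρ = √(∂ₓ η)` and `σ = ∂ₜ ρ`. Then
`u_x ∘ η = 2σ/ρ`, and the equation becomes
`ρ_tt = (μ (v - μ) - ∫ σ²) ρ`, where `μ` is the (constant) mean of `u` and where the velocity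
`v = u ∘ η` is recovered from `v_x = 2ρσ` and `∫ v ρ² = μ`. For `s > 3/2` the space `H^{s-1}` is an
algebra, so that this is an ordinary differential equation with a polynomial vector field (`field`)
on the space of states `(μ, ρ, σ, η(0))`, to which the Picard–Lindelöf theorem applies.

*Local existence.* The way back is `u_x = (2σ/ρ) ∘ η⁻¹`. It has to be shown that `1/ρ` lies in
`H^{s-1}` (`exists_inv`), and that the composition with `η⁻¹` maps `H^{s-1}` to itself and depends
continuously on the state and on the function (`exists_pullFamily`), for every real `s > 3/2`; these
are the two technical points. They give `Adm.continuous_euler`, from which `local_existence` follows.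
That the Eulerian velocity of a Lagrangian solution solves the equation
(`IsFlow.hasDerivAt_euler`) is checked on test functions.

*Uniqueness.* Let `w` be half the difference of two solutions and `z` half their sum. In Fourier
variables, `|∂ₓ| w_t` is given by the kernel `sgn(n) (n² - nk + k²) ẑ(n-k) ŵ(k)`, up to a term that
is imaginary against `w`. As `n² - nk + k²` is symmetric, the time derivative of `‖|∂ₓ|^{1/2} w‖²`
only sees pairs `n`, `k` of opposite signs, for which `|n - k| = |n| + |k|`; all the derivatives can
then be put on `z`, and the energy is controlled by itself (`energy_estimate`). Gronwall's lemma
concludes.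

*Persistence.* A bound on `u_x` bounds `σ/ρ`, hence `ρ` from above and from below. The velocity `v`
is then bounded in the Wiener algebra of absolutely summable Fourier series, so that the equation for
`ρ` is linear with bounded coefficients in that algebra, and the tame product estimate turns this
into a bound in `H^{s-1}` (`exists_bound_field`). The Lagrangian solution can therefore be continued
(`IsLagrange.exists_extension`), and so can `u`, by uniqueness. Backward persistence follows from the
symmetry `u(t, x) ↦ -u(-t, x)`.
-/

namespace MuHS

noncomputable section

open ComplexConjugate

variable {θ : ℝ}

/-! ### Fourier coefficients of square-integrable functions -/

/-- The circle `ℝ/ℤ`. -/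
abbrev Circ : Type := AddCircle (1 : ℝ)

/-- The normalized Haar measure of the circle. -/
abbrev haar : Measure Circ := AddCircle.haarAddCircle (T := (1 : ℝ))


/-- A real square-integrable function, seen as a complex one. -/
def toComplex : L2 →L[ℝ] Lp ℂ 2 haar := Complex.ofRealCLM.compLpL 2 haar

theorem toComplex_ae (f : L2) : ∀ᵐ x ∂haar, toComplex f x = ((f x : ℝ) : ℂ) :=
  Complex.ofRealCLM.coeFn_compLpL f

theorem coeff_eq_repr' (f : L2) (n : ℤ) : coeff f n = fourierBasis.repr (toComplex f) n :=
  coeff_eq_repr f n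

theorem inner_toComplex (f g : L2) : inner ℂ (toComplex f) (toComplex g) = ((inner ℝ f g : ℝ) : ℂ) := by
  rw [L2.inner_def, L2.inner_def, ← integral_complex_ofReal]
  refine integral_congr_ae ?_
  filter_upwards [toComplex_ae f, toComplex_ae g] with x h1 h2
  rw [h1, h2]
  simp

/-- Parseval's identity for the inner product of two real functions. -/
theorem hasSum_coeff_mul (f g : L2) :
    HasSum (fun n => coeff g n * conj (coeff f n)) ((inner ℝ f g : ℝ) : ℂ) := by
  have h := lp.hasSum_inner (𝕜 := ℂ) (fourierBasis.repr (toComplex f))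
    (fourierBasis.repr (toComplex g))
  rw [LinearIsometryEquiv.inner_map_map, inner_toComplex] at h
  simpa only [← coeff_eq_repr', RCLike.inner_apply] using h

theorem hasSum_norm_coeff_sq (f : L2) : HasSum (fun n => ‖coeff f n‖ ^ 2) (‖f‖ ^ 2) := by
  have h := hasSum_coeff_mul f f
  rw [real_inner_self_eq_norm_sq] at h
  have h2 := Complex.hasSum_re h
  simp only [Complex.mul_conj, Complex.normSq_eq_norm_sq, Complex.ofReal_re] at h2
  exact h2

theorem norm_coeff_le (f : L2) (n : ℤ) : ‖coeff f n‖ ≤ ‖f‖ := by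
  have h := hasSum_norm_coeff_sq f
  exact (sq_le_sq₀ (norm_nonneg _) (norm_nonneg _)).1 (le_hasSum h n (fun m _ => sq_nonneg _))

/-- The `n`-th Fourier coefficient as a continuous linear functional on `L²`. -/
def coeffCLM (n : ℤ) : L2 →L[ℝ] ℂ :=
  LinearMap.mkContinuous
    { toFun := fun f => coeff f n
      map_add' := fun f g => coeff_add f g n
      map_smul' := fun c f => coeff_smul c f n } 1 fun f => by
    simpa using norm_coeff_le f n

@[simp] theorem coeffCLM_apply (n : ℤ) (f : L2) : coeffCLM n f = coeff f n := rfl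

theorem coeff_neg (f : L2) (n : ℤ) : coeff f (-n) = conj (coeff f n) := by
  unfold coeff fourierCoeff
  rw [← integral_conj]
  refine integral_congr_ae (ae_of_all _ fun x => ?_)
  simp only [smul_eq_mul, map_mul, Complex.conj_ofReal, neg_neg, fourier_neg, RingHomCompTriple.comp_apply, RingHom.id_apply]

theorem L2_ext {f g : L2} (h : ∀ n, coeff f n = coeff g n) : f = g := by
  rw [← sub_eq_zero]
  refine eq_zero_of_coeff _ fun n => ?_
  rw [← coeffCLM_apply, map_sub, coeffCLM_apply, coeffCLM_apply, h n, sub_self]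

/-- A square-summable sequence with the symmetry `c(-n) = conj c(n)` is the sequence of Fourier
coefficients of a real function. -/
theorem exists_coeff_eq (c : ℤ → ℂ) (hs : ∀ n, c (-n) = conj (c n)) (hc : Memℓp c 2) :
    ∃ f : L2, ∀ n, coeff f n = c n := by
  set F : Lp ℂ 2 haar := fourierBasis.repr.symm ⟨c, hc⟩ with hF
  have hFc : ∀ n, fourierCoeff F n = c n := fun n => by
    rw [← fourierBasis_repr, hF, LinearIsometryEquiv.apply_symm_apply]
  refine ⟨Complex.reCLM.compLpL 2 haar F, fun n => ?_⟩
  have hint : Integrable F haar := (Lp.memLp F).integrable (by norm_num)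
  have h1 : coeff (Complex.reCLM.compLpL 2 haar F) n
      = fourierCoeff (fun x => (1 / 2 : ℂ) * (F x + conj (F x))) n := by
    refine congrFun (fourierCoeff_congr_ae ?_) n
    filter_upwards [Complex.reCLM.coeFn_compLpL F] with x hx
    rw [hx, Complex.add_conj]
    simp
  have hconj : fourierCoeff (fun x => conj (F x)) n = conj (fourierCoeff F (-n)) := by
    unfold fourierCoeff
    rw [← integral_conj]
    refine integral_congr_ae (ae_of_all _ fun x => ?_)
    simp only [smul_eq_mul, map_mul, fourier_neg, RingHomCompTriple.comp_apply, RingHom.id_apply]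
  have hconjint : Integrable (fun x => conj (F x)) haar :=
    Complex.conjCLE.toContinuousLinearMap.integrable_comp hint
  rw [h1, fourierCoeff.const_mul]
  have h2 := congrFun (fourierCoeff.add hint hconjint) n
  have h3 : fourierCoeff (fun x => F x + conj (F x)) n
    = fourierCoeff F n + fourierCoeff (fun x => conj (F x)) n := h2
  rw [h3, hconj, hFc, hFc, hs, Complex.conj_conj]
  ring

/-! ### Sobolev spaces in terms of Fourier coefficients -/

/-- The Fourier coefficients of an element of `H^θ`. -/
def Hs.hat {θ : ℝ} (f : Hs θ) (n : ℤ) : ℂ := coeff f.toL2 n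

@[simp] theorem Hs.hat_add {θ : ℝ} (f g : Hs θ) (n : ℤ) : (f + g).hat n = f.hat n + g.hat n :=
  coeff_add _ _ _

@[simp] theorem Hs.hat_smul {θ : ℝ} (c : ℝ) (f : Hs θ) (n : ℤ) : (c • f).hat n = c * f.hat n :=
  (coeff_smul _ _ _).trans (Complex.real_smul)

@[simp] theorem Hs.hat_neg {θ : ℝ} (f : Hs θ) (n : ℤ) : (-f).hat n = - f.hat n := by
  have := Hs.hat_smul (-1) f n
  simpa using this

@[simp] theorem Hs.hat_sub {θ : ℝ} (f g : Hs θ) (n : ℤ) : (f - g).hat n = f.hat n - g.hat n := by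
  rw [sub_eq_add_neg, Hs.hat_add, Hs.hat_neg, sub_eq_add_neg]

@[simp] theorem Hs.hat_zero {θ : ℝ} (n : ℤ) : (0 : Hs θ).hat n = 0 := by
  have := Hs.hat_smul 0 (0 : Hs θ) n
  simpa using this

theorem Hs.hat_conj {θ : ℝ} (f : Hs θ) (n : ℤ) : f.hat (-n) = conj (f.hat n) := coeff_neg _ _

theorem Hs.ext_hat {θ : ℝ} {f g : Hs θ} (h : ∀ n, f.hat n = g.hat n) : f = g :=
  Subtype.ext (L2_ext h)

theorem norm_sq_weight_smul (θ : ℝ) (n : ℤ) (c : ℂ) :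
    ‖(weight n ^ (θ / 2)) • c‖ ^ 2 = weight n ^ θ * ‖c‖ ^ 2 := by
  have hw := weight_pos n
  rw [norm_smul, mul_pow, Real.norm_of_nonneg (Real.rpow_nonneg hw.le _), ← Real.rpow_natCast,
    ← Real.rpow_mul hw.le]
  norm_num

theorem Hs.summable {θ : ℝ} (f : Hs θ) : Summable fun n => weight n ^ θ * ‖f.hat n‖ ^ 2 := by
  have h := Memℓp.summable (by norm_num) f.2
  refine h.congr fun n => ?_
  rw [ENNReal.toReal_ofNat, Real.rpow_two]
  exact norm_sq_weight_smul θ n (f.hat n)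

theorem Hs.norm_sq_hat {θ : ℝ} (f : Hs θ) : ‖f‖ ^ 2 = ∑' n, weight n ^ θ * ‖f.hat n‖ ^ 2 :=
  Hs.norm_sq f

/-- The squared `H^θ` norm of a sequence of Fourier coefficients, possibly infinite. -/
def sobSq (θ : ℝ) (c : ℤ → ℂ) : ENNReal := ∑' n, ENNReal.ofReal (weight n ^ θ * ‖c n‖ ^ 2)

theorem Hs.sobSq_hat {θ : ℝ} (f : Hs θ) : sobSq θ f.hat = ENNReal.ofReal (‖f‖ ^ 2) := by
  rw [Hs.norm_sq_hat, ENNReal.ofReal_tsum_of_nonneg _ f.summable, sobSq]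
  intro n
  have := weight_pos n
  positivity

theorem memℓp_of_sobSq {θ : ℝ} {c : ℤ → ℂ} (h : sobSq θ c ≠ ⊤) :
    Memℓp (fun n => (weight n ^ (θ / 2)) • c n) 2 := by
  refine memℓp_gen ?_
  have h2 : Summable fun n => weight n ^ θ * ‖c n‖ ^ 2 := by
    have := ENNReal.summable_toReal h
    refine this.congr fun n => ?_
    rw [ENNReal.toReal_ofReal]
    have := weight_pos n
    positivity
  refine h2.congr fun n => ?_
  rw [ENNReal.toReal_ofNat, Real.rpow_two, norm_sq_weight_smul]

/-- A square-integrable function with finite `H^θ` norm, as an element of `H^θ`. -/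
def Hs.ofL2 {θ : ℝ} (f : L2) (h : sobSq θ (coeff f) ≠ ⊤) : Hs θ := ⟨f, memℓp_of_sobSq h⟩

theorem sobSq_mono {a b : ℝ} (h : a ≤ b) (c : ℤ → ℂ) : sobSq a c ≤ sobSq b c := by
  refine ENNReal.tsum_le_tsum fun n => ENNReal.ofReal_le_ofReal ?_
  gcongr
  exact one_le_weight n

theorem sobSq_zero (f : L2) : sobSq 0 (coeff f) = ENNReal.ofReal (‖f‖ ^ 2) := by
  rw [← (hasSum_norm_coeff_sq f).tsum_eq, ENNReal.ofReal_tsum_of_nonneg _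
    (hasSum_norm_coeff_sq f).summable, sobSq]
  · simp
  · intro n; positivity

theorem Hs.exists_of_hat {θ : ℝ} (hθ : 0 ≤ θ) (c : ℤ → ℂ) (hs : ∀ n, c (-n) = conj (c n))
    (hc : sobSq θ c ≠ ⊤) : ∃ f : Hs θ, ∀ n, f.hat n = c n := by
  have h0 : sobSq 0 c ≠ ⊤ := ne_top_of_le_ne_top hc (sobSq_mono hθ c)
  obtain ⟨f, hf⟩ := exists_coeff_eq c hs (by simpa using memℓp_of_sobSq h0)
  have hfc : coeff f = c := funext hf
  exact ⟨Hs.ofL2 f (by rwa [hfc]), hf⟩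

/-- The element of `H^θ` with given Fourier coefficients. -/
def Hs.ofHat {θ : ℝ} (hθ : 0 ≤ θ) (c : ℤ → ℂ) (hs : ∀ n, c (-n) = conj (c n))
    (hc : sobSq θ c ≠ ⊤) : Hs θ := (Hs.exists_of_hat hθ c hs hc).choose

theorem Hs.hat_ofHat {θ : ℝ} (hθ : 0 ≤ θ) (c : ℤ → ℂ) (hs : ∀ n, c (-n) = conj (c n))
    (hc : sobSq θ c ≠ ⊤) (n : ℤ) : (Hs.ofHat hθ c hs hc).hat n = c n :=
  (Hs.exists_of_hat hθ c hs hc).choose_spec n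

theorem sobSq_le_of_le {a b C : ℝ} {c d : ℤ → ℂ}
    (h : ∀ n, weight n ^ b * ‖d n‖ ^ 2 ≤ C * (weight n ^ a * ‖c n‖ ^ 2)) :
    sobSq b d ≤ ENNReal.ofReal C * sobSq a c := by
  rw [sobSq, sobSq, ← ENNReal.tsum_mul_left]
  refine ENNReal.tsum_le_tsum fun n => ?_
  rw [← ENNReal.ofReal_mul' (by have := weight_pos n; positivity)]
  exact ENNReal.ofReal_le_ofReal (h n)

theorem Hs.norm_le_of_sobSq {a : ℝ} {f : Hs a} {C : ℝ} (hC : 0 ≤ C)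
    (h : sobSq a f.hat ≤ ENNReal.ofReal (C ^ 2)) : ‖f‖ ≤ C := by
  rw [Hs.sobSq_hat, ENNReal.ofReal_le_ofReal_iff (by positivity)] at h
  exact (sq_le_sq₀ (norm_nonneg _) hC).1 h

/-- A symbol `m` is of order `a - b` if `|m(n)|² ≤ C² (1 + (2πn)²)^{a-b}` and `m(-n) = conj m(n)`:
the operator with symbol `m` then maps real functions in `H^a` to real functions in `H^b`. -/
structure IsSymbol (a b C : ℝ) (m : ℤ → ℂ) : Prop where
  nonneg : 0 ≤ C
  conj_symm : ∀ n, m (-n) = conj (m n)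
  bound : ∀ n, weight n ^ b * ‖m n‖ ^ 2 ≤ C ^ 2 * weight n ^ a

theorem IsSymbol.sobSq_le {a b C : ℝ} {m : ℤ → ℂ} (h : IsSymbol a b C m) (c : ℤ → ℂ) :
    sobSq b (fun n => m n * c n) ≤ ENNReal.ofReal (C ^ 2) * sobSq a c := by
  refine sobSq_le_of_le fun n => ?_
  rw [norm_mul, mul_pow]
  nlinarith [mul_le_mul_of_nonneg_right (h.bound n) (sq_nonneg ‖c n‖)]

theorem IsSymbol.sobSq_hat_le {a b C : ℝ} {m : ℤ → ℂ} (h : IsSymbol a b C m) (f : Hs a) :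
    sobSq b (fun n => m n * f.hat n) ≤ ENNReal.ofReal ((C * ‖f‖) ^ 2) :=
  (h.sobSq_le f.hat).trans (by rw [Hs.sobSq_hat, ← ENNReal.ofReal_mul (by positivity), mul_pow])

/-- The Fourier multiplier with symbol `m`, as a function from `H^a` to `H^b`. -/
def multFun {a b C : ℝ} (hb : 0 ≤ b) {m : ℤ → ℂ} (h : IsSymbol a b C m) (f : Hs a) : Hs b :=
  Hs.ofHat hb (fun n => m n * f.hat n) (fun n => by rw [h.conj_symm, Hs.hat_conj, map_mul])
    (ne_top_of_le_ne_top ENNReal.ofReal_ne_top (h.sobSq_hat_le f))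

theorem hat_multFun {a b C : ℝ} (hb : 0 ≤ b) {m : ℤ → ℂ} (h : IsSymbol a b C m) (f : Hs a)
    (n : ℤ) : (multFun hb h f).hat n = m n * f.hat n := Hs.hat_ofHat _ _ _ _ n

theorem norm_multFun_le {a b C : ℝ} (hb : 0 ≤ b) {m : ℤ → ℂ} (h : IsSymbol a b C m) (f : Hs a) :
    ‖multFun hb h f‖ ≤ C * ‖f‖ := by
  refine Hs.norm_le_of_sobSq (mul_nonneg h.nonneg (norm_nonneg _)) ?_
  rw [show (multFun hb h f).hat = fun n => m n * f.hat n from funext (hat_multFun hb h f)]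
  exact h.sobSq_hat_le f

/-- The Fourier multiplier with symbol `m`, as a continuous linear map from `H^a` to `H^b`. -/
def mult {a b C : ℝ} (hb : 0 ≤ b) {m : ℤ → ℂ} (h : IsSymbol a b C m) : Hs a →L[ℝ] Hs b :=
  LinearMap.mkContinuous
    { toFun := multFun hb h
      map_add' := fun f g => Hs.ext_hat fun n => by simp [hat_multFun, mul_add]
      map_smul' := fun c f => Hs.ext_hat fun n => by simp [hat_multFun]; ring } C
    (norm_multFun_le hb h)

@[simp] theorem hat_mult {a b C : ℝ} (hb : 0 ≤ b) {m : ℤ → ℂ} (h : IsSymbol a b C m) (f : Hs a)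
    (n : ℤ) : (mult hb h f).hat n = m n * f.hat n := hat_multFun hb h f n

theorem isSymbol_one {a b : ℝ} (h : b ≤ a) : IsSymbol a b 1 (fun _ => 1) where
  nonneg := zero_le_one
  conj_symm := by simp
  bound n := by
    simpa using Real.rpow_le_rpow_of_exponent_le (one_le_weight n) h

/-- The inclusion `H^a ⊆ H^b` as a continuous linear map. -/
def inclCLM {a b : ℝ} (hb : 0 ≤ b) (h : b ≤ a) : Hs a →L[ℝ] Hs b := mult hb (isSymbol_one h)

@[simp] theorem hat_inclCLM {a b : ℝ} (hb : 0 ≤ b) (h : b ≤ a) (f : Hs a) (n : ℤ) :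
    (inclCLM hb h f).hat n = f.hat n := (hat_mult hb (isSymbol_one h) f n).trans (one_mul _)

theorem Hs.toL2_mk {b : ℝ} (g : L2) (pf : Memℓp (weightedCoeff b g) 2) :
    Hs.toL2 (⟨g, pf⟩ : Hs b) = g := rfl

theorem Hs.toL2_incl {a b : ℝ} (h : b ≤ a) (f : Hs a) : (f.incl h).toL2 = f.toL2 := by
  obtain ⟨pf, h⟩ : ∃ pf, f.incl h = ⟨f.toL2, pf⟩ := ⟨_, rfl⟩
  rw [h, Hs.toL2_mk]

theorem Hs.hat_incl {a b : ℝ} (h : b ≤ a) (f : Hs a) (n : ℤ) : (f.incl h).hat n = f.hat n :=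
  congrArg (fun g => coeff g n) (f.toL2_incl h)

theorem incl_eq {a b : ℝ} (hb : 0 ≤ b) (h : b ≤ a) (f : Hs a) : f.incl h = inclCLM hb h f :=
  Hs.ext_hat fun n => (Hs.hat_incl h f n).trans (hat_inclCLM hb h f n).symm

theorem toL2_inclCLM {a b : ℝ} (hb : 0 ≤ b) (h : b ≤ a) (f : Hs a) :
    (inclCLM hb h f).toL2 = f.toL2 := L2_ext fun n => hat_inclCLM hb h f n

/-- The inclusion `H^a ⊆ L²` as a continuous linear map. -/
def toL2CLM {a : ℝ} (ha : 0 ≤ a) : Hs a →L[ℝ] L2 :=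
  LinearMap.mkContinuous
    { toFun := Hs.toL2
      map_add' := fun _ _ => rfl
      map_smul' := fun _ _ => rfl } 1 fun f => by
    have h := sobSq_mono ha f.hat
    rw [Hs.sobSq_hat, show f.hat = coeff f.toL2 from rfl, sobSq_zero,
      ENNReal.ofReal_le_ofReal_iff (by positivity)] at h
    rw [one_mul]
    exact (sq_le_sq₀ (norm_nonneg _) (norm_nonneg _)).1 h

@[simp] theorem toL2CLM_apply {a : ℝ} (ha : 0 ≤ a) (f : Hs a) : toL2CLM ha f = f.toL2 := rfl

theorem toL2_injective {a : ℝ} : Function.Injective (Hs.toL2 (s := a)) := fun _ _ h => Subtype.ext h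

theorem Hs.completeSpace {a : ℝ} (ha : 0 ≤ a) : CompleteSpace (Hs a) := by
  have hiso : Isometry (Hs.toSeq a) :=
    AddMonoidHomClass.isometry_of_norm _ fun f => rfl
  rw [completeSpace_iff_isComplete_range hiso.isUniformInducing]
  have hr : range (Hs.toSeq a) = {y | ∀ n : ℤ, y (-n) = conj (y n)} := by
    ext y
    constructor
    · rintro ⟨f, rfl⟩ n
      change weightedCoeff a f.toL2 (-n) = conj (weightedCoeff a f.toL2 n)
      simp [weightedCoeff, coeff_neg, weight]
    · intro hy
      have hw : ∀ n : ℤ, weight (-n) = weight n := fun n => by simp [weight]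
      have hinv : ∀ n : ℤ, weight n ^ (a / 2) * (weight n ^ (a / 2))⁻¹ = 1 := fun n =>
        mul_inv_cancel₀ (Real.rpow_pos_of_pos (weight_pos n) _).ne'
      obtain ⟨f, hf⟩ := Hs.exists_of_hat ha (fun n => ((weight n ^ (a / 2))⁻¹ : ℝ) • y n)
        (fun n => by simp [hy n, hw]) (by
          have h1 := (Memℓp.summable (by norm_num) (lp.memℓp y)).tsum_ofReal_ne_top
          refine ne_top_of_le_ne_top h1 (ENNReal.tsum_le_tsum fun n => ENNReal.ofReal_le_ofReal ?_)
          have hwp := weight_pos n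
          rw [norm_smul, mul_pow, Real.norm_of_nonneg (by positivity)]
          have : weight n ^ a = (weight n ^ (a / 2)) ^ 2 := by
            rw [← Real.rpow_natCast, ← Real.rpow_mul hwp.le]; norm_num
          rw [this, ← mul_assoc, ← mul_pow, hinv]
          simp)
      refine ⟨f, ?_⟩
      ext n
      change weight n ^ (a / 2) • f.hat n = y n
      rw [hf, smul_smul, hinv, one_smul]
  rw [hr]
  refine IsClosed.isComplete ?_
  rw [ofPred_forall]
  refine isClosed_iInter fun n => ?_
  have hc : ∀ n : ℤ, Continuous fun y : lp (fun _ : ℤ => ℂ) 2 => y n := fun n =>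
    (lp.evalCLM ℂ (fun _ : ℤ => ℂ) 2 n).continuous
  exact isClosed_eq (hc _) (Complex.continuous_conj.comp (hc _))

/-! ### Summability of Fourier coefficients and products -/

theorem ennreal_two_mul_le (x y : ENNReal) : x * y + x * y ≤ x ^ 2 + y ^ 2 := by
  rcases eq_or_ne x ⊤ with rfl | hx
  · simp
  rcases eq_or_ne y ⊤ with rfl | hy
  · simp
  lift x to NNReal using hx
  lift y to NNReal using hy
  have := two_mul_le_add_sq (x : ℝ) y
  have h2 : (x : ℝ) * y + x * y ≤ x ^ 2 + y ^ 2 := by linarith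
  exact_mod_cast h2

/-- The Cauchy–Schwarz inequality for sums in `[0, ∞]`. -/
theorem ennreal_tsum_mul_sq_le {ι : Type*} (x y : ι → ENNReal) :
    (∑' i, x i * y i) ^ 2 ≤ (∑' i, x i ^ 2) * ∑' i, y i ^ 2 := by
  have h1 : (∑' i, x i * y i) ^ 2 = ∑' i, ∑' j, (x i * y j) * (x j * y i) := by
    rw [sq, ← ENNReal.tsum_mul_right]
    refine tsum_congr fun i => ?_
    rw [← ENNReal.tsum_mul_left]
    exact tsum_congr fun j => by ring
  have h2 : (∑' i, x i ^ 2) * (∑' i, y i ^ 2) = ∑' i, ∑' j, (x i * y j) ^ 2 := by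
    rw [← ENNReal.tsum_mul_right]
    refine tsum_congr fun i => ?_
    rw [← ENNReal.tsum_mul_left]
    exact tsum_congr fun j => by ring
  have h3 : (∑' i, x i ^ 2) * (∑' i, y i ^ 2) = ∑' i, ∑' j, (x j * y i) ^ 2 := by
    rw [h2, ENNReal.tsum_comm]
  have h4 : 2 * (∑' i, x i * y i) ^ 2 ≤ 2 * ((∑' i, x i ^ 2) * ∑' i, y i ^ 2) := by
    rw [two_mul, two_mul]
    refine le_trans ?_ (add_le_add h2.ge h3.ge)
    rw [h1, ← ENNReal.tsum_add, ← ENNReal.tsum_add]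
    refine ENNReal.tsum_le_tsum fun i => ?_
    rw [← ENNReal.tsum_add, ← ENNReal.tsum_add]
    exact ENNReal.tsum_le_tsum fun j => ennreal_two_mul_le _ _
  exact (ENNReal.mul_le_mul_iff_right (by norm_num) (by norm_num)).1 h4

/-- A weighted Cauchy–Schwarz inequality for sums in `[0, ∞]`. -/
theorem ennreal_tsum_mul_sq_le' {ι : Type*} (a b : ι → ENNReal) :
    (∑' i, a i * b i) ^ 2 ≤ (∑' i, a i) * ∑' i, a i * b i ^ 2 := by
  have h1 : (∑' i, a i * b i) ^ 2 = ∑' i, ∑' j, (a i * a j) * (b i * b j) := by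
    rw [sq, ← ENNReal.tsum_mul_right]
    refine tsum_congr fun i => ?_
    rw [← ENNReal.tsum_mul_left]
    exact tsum_congr fun j => by ring
  have h2 : (∑' i, a i) * (∑' i, a i * b i ^ 2) = ∑' i, ∑' j, (a i * a j) * b j ^ 2 := by
    rw [← ENNReal.tsum_mul_right]
    refine tsum_congr fun i => ?_
    rw [← ENNReal.tsum_mul_left]
    exact tsum_congr fun j => by ring
  have h3 : (∑' i, a i) * (∑' i, a i * b i ^ 2) = ∑' i, ∑' j, (a i * a j) * b i ^ 2 := by
    rw [h2, ENNReal.tsum_comm]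
    exact tsum_congr fun i => tsum_congr fun j => by ring
  have h4 : 2 * (∑' i, a i * b i) ^ 2 ≤ 2 * ((∑' i, a i) * ∑' i, a i * b i ^ 2) := by
    rw [two_mul, two_mul]
    refine le_trans ?_ (add_le_add h3.ge h2.ge)
    rw [h1, ← ENNReal.tsum_add, ← ENNReal.tsum_add]
    refine ENNReal.tsum_le_tsum fun i => ?_
    rw [← ENNReal.tsum_add, ← ENNReal.tsum_add]
    refine ENNReal.tsum_le_tsum fun j => ?_
    calc a i * a j * (b i * b j) + a i * a j * (b i * b j)
        = a i * a j * (b i * b j + b i * b j) := by ring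
      _ ≤ a i * a j * (b i ^ 2 + b j ^ 2) := mul_le_mul_right (ennreal_two_mul_le _ _) _
      _ = _ := mul_add _ _ _
  exact (ENNReal.mul_le_mul_iff_right (by norm_num) (by norm_num)).1 h4

theorem tsum_sub_left (a : ℤ → ENNReal) (n : ℤ) : ∑' k, a (n - k) = ∑' k, a k :=
  (Equiv.subLeft n).tsum_eq a

theorem tsum_sub_right (a : ℤ → ENNReal) (n : ℤ) : ∑' k, a (k - n) = ∑' k, a k :=
  (Equiv.subRight n).tsum_eq a

/-- Young's inequality `‖a * b‖₂ ≤ ‖a‖₁ ‖b‖₂` for the convolution of sequences. -/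
theorem young (a b : ℤ → ENNReal) :
    ∑' n, (∑' k, a (n - k) * b k) ^ 2 ≤ (∑' n, a n) ^ 2 * ∑' n, b n ^ 2 := by
  calc ∑' n, (∑' k, a (n - k) * b k) ^ 2
      ≤ ∑' n, (∑' k, a k) * ∑' k, a (n - k) * b k ^ 2 := by
        refine ENNReal.tsum_le_tsum fun n => ?_
        refine (ennreal_tsum_mul_sq_le' (fun k => a (n - k)) b).trans ?_
        rw [tsum_sub_left]
    _ = (∑' k, a k) * ∑' k, (∑' n, a (n - k)) * b k ^ 2 := by
        rw [ENNReal.tsum_mul_left, ENNReal.tsum_comm]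
        congr 1
        exact tsum_congr fun k => ENNReal.tsum_mul_right
    _ = _ := by
        simp_rw [tsum_sub_right]
        rw [ENNReal.tsum_mul_left, ← mul_assoc, sq]

theorem summable_weight {r : ℝ} (hr : 1 / 2 < r) : Summable fun n => weight n ^ (-r) := by
  have h1 : Summable fun n : ℤ => |(n : ℝ)| ^ (-(2 * r)) :=
    Real.summable_abs_int_rpow (by linarith)
  have h2 : Summable fun n : ℤ => if n = 0 then (1 : ℝ) else 0 := (hasSum_ite_eq 0 1).summable
  refine (h1.add h2).of_nonneg_of_le (fun n => ?_) fun n => ?_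
  · have := weight_pos n; positivity
  · rcases eq_or_ne n 0 with rfl | hn
    · simp only [↓reduceIte]
      have : weight 0 ^ (-r) = 1 := by simp [weight]
      rw [this]
      have : (0 : ℝ) ≤ |((0 : ℤ) : ℝ)| ^ (-(2 * r)) := by positivity
      linarith
    · simp only [hn, ↓reduceIte, add_zero]
      have hn' : 0 < |(n : ℝ)| := by positivity
      rw [Real.rpow_neg (weight_pos n).le, Real.rpow_neg hn'.le, Real.rpow_mul hn'.le]
      gcongr
      rw [Real.rpow_two, sq_abs, weight, mul_pow]
      have : 1 ≤ (2 * Real.pi) ^ 2 := by nlinarith [Real.pi_gt_three]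
      nlinarith [sq_nonneg (n : ℝ)]

/-- The squared norm of the inclusion of the functions of order `r > 1/2` in the functions with
absolutely summable coefficients. -/
def embConst (r : ℝ) : ENNReal := ∑' n, ENNReal.ofReal (weight n ^ (-r))

theorem embConst_ne_top {r : ℝ} (hr : 1 / 2 < r) : embConst r ≠ ⊤ :=
  (summable_weight hr).tsum_ofReal_ne_top

/-- The sum of `(1 + (2πn)²)^{a/2} |c(n)|`. For `a = 0` this is the norm of the Wiener algebra. -/
def wSum (a : ℝ) (c : ℤ → ℂ) : ENNReal := ∑' n, ENNReal.ofReal (weight n ^ (a / 2) * ‖c n‖)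

theorem wSum_sq_le (a b : ℝ) (c : ℤ → ℂ) :
    wSum a c ^ 2 ≤ embConst (b - a) * sobSq b c := by
  have h := ennreal_tsum_mul_sq_le (fun n => ENNReal.ofReal (weight n ^ (-(b - a) / 2)))
    (fun n => ENNReal.ofReal (weight n ^ (b / 2) * ‖c n‖))
  have hw := weight_pos
  have e1 : ∀ n : ℤ, ENNReal.ofReal (weight n ^ (-(b - a) / 2)) *
      ENNReal.ofReal (weight n ^ (b / 2) * ‖c n‖) = ENNReal.ofReal (weight n ^ (a / 2) * ‖c n‖) := by
    intro n
    have := hw n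
    rw [← ENNReal.ofReal_mul (by positivity), ← mul_assoc, ← Real.rpow_add (hw n)]
    ring_nf
  have e2 : ∀ n : ℤ, ENNReal.ofReal (weight n ^ (-(b - a) / 2)) ^ 2
      = ENNReal.ofReal (weight n ^ (-(b - a))) := by
    intro n
    have := hw n
    rw [← ENNReal.ofReal_pow (by positivity), ← Real.rpow_natCast, ← Real.rpow_mul (hw n).le]
    norm_num
  have e3 : ∀ n : ℤ, ENNReal.ofReal (weight n ^ (b / 2) * ‖c n‖) ^ 2
      = ENNReal.ofReal (weight n ^ b * ‖c n‖ ^ 2) := by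
    intro n
    have := hw n
    rw [← ENNReal.ofReal_pow (by positivity), mul_pow, ← Real.rpow_natCast (weight n ^ (b / 2)),
      ← Real.rpow_mul (hw n).le]
    norm_num
  simp_rw [e1, e2, e3] at h
  exact h

theorem weight_rpow_le_add {a : ℝ} (ha : 0 ≤ a) (n k : ℤ) :
    weight n ^ (a / 2) ≤ 2 ^ a * (weight (n - k) ^ (a / 2) + weight k ^ (a / 2)) := by
  have h1 : weight n ≤ 4 * max (weight (n - k)) (weight k) := by
    have h : weight n ≤ 2 * (weight (n - k) + weight k) := by
      simp only [weight]
      push_cast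
      nlinarith [sq_nonneg (2 * Real.pi * (n - k : ℝ) - 2 * Real.pi * k)]
    linarith [le_max_left (weight (n - k)) (weight k), le_max_right (weight (n - k)) (weight k)]
  have hp1 := weight_pos (n - k)
  have hp2 := weight_pos k
  calc weight n ^ (a / 2) ≤ (4 * max (weight (n - k)) (weight k)) ^ (a / 2) :=
        Real.rpow_le_rpow (weight_pos n).le h1 (by linarith)
    _ = 2 ^ a * (max (weight (n - k)) (weight k)) ^ (a / 2) := by
        rw [Real.mul_rpow (by norm_num) (le_max_of_le_left hp1.le)]
        congr 1
        rw [show (4 : ℝ) = 2 ^ (2 : ℝ) by norm_num, ← Real.rpow_mul (by norm_num)]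
        ring_nf
    _ ≤ _ := by
        gcongr
        rcases max_choice (weight (n - k)) (weight k) with h | h <;> rw [h]
        · have : 0 ≤ weight k ^ (a / 2) := by positivity
          linarith
        · have : 0 ≤ weight (n - k) ^ (a / 2) := by positivity
          linarith

/-- The Fourier coefficients of a product are controlled by convolutions in which the weight
falls on one of the two factors. -/
theorem ofReal_weight_mul_conv_le {a : ℝ} (ha : 0 ≤ a) {f g h : ℤ → ℂ} (n : ℤ)
    (hh : ENNReal.ofReal ‖h n‖ ≤ ∑' k, ENNReal.ofReal ‖f (n - k)‖ * ENNReal.ofReal ‖g k‖) :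
    ENNReal.ofReal (weight n ^ a * ‖h n‖ ^ 2) ≤ ENNReal.ofReal (2 * 4 ^ a) *
      ((∑' k, ENNReal.ofReal (weight (n - k) ^ (a / 2) * ‖f (n - k)‖) * ENNReal.ofReal ‖g k‖) ^ 2
      + (∑' k, ENNReal.ofReal ‖f (n - k)‖ * ENNReal.ofReal (weight k ^ (a / 2) * ‖g k‖)) ^ 2) := by
  set X := ∑' k, ENNReal.ofReal (weight (n - k) ^ (a / 2) * ‖f (n - k)‖) * ENNReal.ofReal ‖g k‖
  set Y := ∑' k, ENNReal.ofReal ‖f (n - k)‖ * ENNReal.ofReal (weight k ^ (a / 2) * ‖g k‖)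
  have h1 : ENNReal.ofReal (weight n ^ (a / 2) * ‖h n‖) ≤ ENNReal.ofReal (2 ^ a) * (X + Y) := by
    have hw := weight_pos n
    rw [ENNReal.ofReal_mul (by positivity)]
    refine (mul_le_mul_right hh _).trans ?_
    rw [← ENNReal.tsum_mul_left, ← ENNReal.tsum_add, ← ENNReal.tsum_mul_left]
    refine ENNReal.tsum_le_tsum fun k => ?_
    have hp1 := weight_pos (n - k)
    have hp2 := weight_pos k
    rw [← ENNReal.ofReal_mul (by positivity), ← ENNReal.ofReal_mul (by positivity),
      ← ENNReal.ofReal_mul (by positivity), ← ENNReal.ofReal_mul (by positivity),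
      ← ENNReal.ofReal_add (by positivity) (by positivity), ← ENNReal.ofReal_mul (by positivity)]
    refine ENNReal.ofReal_le_ofReal ?_
    have := mul_le_mul_of_nonneg_right (weight_rpow_le_add ha n k)
      (mul_nonneg (norm_nonneg (f (n - k))) (norm_nonneg (g k)))
    linarith
  have h2 : ENNReal.ofReal (weight n ^ a * ‖h n‖ ^ 2)
      = ENNReal.ofReal (weight n ^ (a / 2) * ‖h n‖) ^ 2 := by
    have hw := weight_pos n
    rw [← ENNReal.ofReal_pow (by positivity), mul_pow, ← Real.rpow_natCast (weight n ^ (a / 2)),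
      ← Real.rpow_mul hw.le]
    norm_num
  rw [h2]
  calc ENNReal.ofReal (weight n ^ (a / 2) * ‖h n‖) ^ 2
      ≤ (ENNReal.ofReal (2 ^ a) * (X + Y)) ^ 2 := by gcongr
    _ = ENNReal.ofReal (4 ^ a) * (X + Y) ^ 2 := by
        rw [mul_pow, ← ENNReal.ofReal_pow (by positivity), ← Real.rpow_natCast,
          ← Real.rpow_mul (by norm_num), mul_comm a, Real.rpow_mul (by norm_num)]
        norm_num
    _ ≤ ENNReal.ofReal (4 ^ a) * (2 * (X ^ 2 + Y ^ 2)) := by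
        gcongr
        calc (X + Y) ^ 2 = X ^ 2 + Y ^ 2 + (X * Y + X * Y) := by ring
          _ ≤ X ^ 2 + Y ^ 2 + (X ^ 2 + Y ^ 2) := add_le_add_right (ennreal_two_mul_le X Y) _
          _ = _ := by ring
    _ = _ := by
        rw [ENNReal.ofReal_mul (by norm_num), ENNReal.ofReal_ofNat]
        ring

theorem sobSq_eq_tsum_sq (a : ℝ) (c : ℤ → ℂ) :
    sobSq a c = ∑' n, ENNReal.ofReal (weight n ^ (a / 2) * ‖c n‖) ^ 2 := by
  refine tsum_congr fun n => ?_
  have hw := weight_pos n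
  rw [← ENNReal.ofReal_pow (by positivity), mul_pow, ← Real.rpow_natCast (weight n ^ (a / 2)),
    ← Real.rpow_mul hw.le]
  norm_num

theorem wSum_zero (c : ℤ → ℂ) : wSum 0 c = ∑' n, ENNReal.ofReal ‖c n‖ := by simp [wSum]

theorem sobSq_zero_eq (c : ℤ → ℂ) : sobSq 0 c = ∑' n, ENNReal.ofReal ‖c n‖ ^ 2 := by
  simp only [sobSq_eq_tsum_sq, zero_div, Real.rpow_zero, one_mul]

theorem tsum_conv_comm (x y : ℤ → ENNReal) (n : ℤ) :
    ∑' k, x (n - k) * y k = ∑' k, y (n - k) * x k := by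
  rw [← (Equiv.subLeft n).tsum_eq]
  exact tsum_congr fun k => by simp [mul_comm]

/-- The tame product estimate in `H^a`, in terms of the norms of `H^a` and of the Wiener
algebra. -/
theorem sobSq_conv_le {a : ℝ} (ha : 0 ≤ a) {f g h : ℤ → ℂ}
    (hh : ∀ n, ENNReal.ofReal ‖h n‖ ≤ ∑' k, ENNReal.ofReal ‖f (n - k)‖ * ENNReal.ofReal ‖g k‖) :
    sobSq a h ≤ ENNReal.ofReal (2 * 4 ^ a) *
      (wSum 0 g ^ 2 * sobSq a f + wSum 0 f ^ 2 * sobSq a g) := by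
  refine (ENNReal.tsum_le_tsum fun n => ofReal_weight_mul_conv_le ha n (hh n)).trans ?_
  rw [ENNReal.tsum_mul_left, ENNReal.tsum_add]
  gcongr
  · rw [wSum_zero, sobSq_eq_tsum_sq]
    refine le_trans (le_of_eq ?_) (young _ _)
    exact tsum_congr fun n => by
      rw [tsum_conv_comm (fun k => ENNReal.ofReal (weight k ^ (a / 2) * ‖f k‖))
        (fun k => ENNReal.ofReal ‖g k‖)]
  · rw [wSum_zero, sobSq_eq_tsum_sq]
    exact young _ _

/-- The product estimate `H^a · H^b ⊆ H^a` for `b > a + 1/2`. -/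
theorem sobSq_conv_le' {a : ℝ} (b : ℝ) (ha : 0 ≤ a) {f g h : ℤ → ℂ}
    (hh : ∀ n, ENNReal.ofReal ‖h n‖ ≤ ∑' k, ENNReal.ofReal ‖f (n - k)‖ * ENNReal.ofReal ‖g k‖) :
    sobSq a h ≤ ENNReal.ofReal (2 * 4 ^ a) * (2 * embConst (b - a)) * (sobSq a f * sobSq b g) := by
  have h0 : wSum 0 g ≤ wSum a g := by
    refine ENNReal.tsum_le_tsum fun n => ENNReal.ofReal_le_ofReal ?_
    gcongr
    exact one_le_weight n
  have h1 := wSum_sq_le a b g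
  have h2 : sobSq 0 f ≤ sobSq a f := sobSq_mono ha f
  refine (ENNReal.tsum_le_tsum fun n => ofReal_weight_mul_conv_le ha n (hh n)).trans ?_
  rw [ENNReal.tsum_mul_left, ENNReal.tsum_add, mul_assoc]
  gcongr
  have hX : ∑' n, (∑' k, ENNReal.ofReal (weight (n - k) ^ (a / 2) * ‖f (n - k)‖)
      * ENNReal.ofReal ‖g k‖) ^ 2 ≤ wSum a g ^ 2 * sobSq a f := by
    have : ∑' n, (∑' k, ENNReal.ofReal (weight (n - k) ^ (a / 2) * ‖f (n - k)‖)
      * ENNReal.ofReal ‖g k‖) ^ 2 ≤ wSum 0 g ^ 2 * sobSq a f := by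
      rw [wSum_zero, sobSq_eq_tsum_sq]
      refine le_trans (le_of_eq ?_) (young _ _)
      exact tsum_congr fun n => by
        rw [tsum_conv_comm (fun k => ENNReal.ofReal (weight k ^ (a / 2) * ‖f k‖))
          (fun k => ENNReal.ofReal ‖g k‖)]
    exact this.trans (by gcongr)
  have hY : ∑' n, (∑' k, ENNReal.ofReal ‖f (n - k)‖
      * ENNReal.ofReal (weight k ^ (a / 2) * ‖g k‖)) ^ 2 ≤ wSum a g ^ 2 * sobSq a f := by
    have : ∑' n, (∑' k, ENNReal.ofReal ‖f (n - k)‖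
      * ENNReal.ofReal (weight k ^ (a / 2) * ‖g k‖)) ^ 2 ≤ wSum a g ^ 2 * sobSq 0 f := by
      rw [sobSq_zero_eq]
      refine le_trans (le_of_eq ?_) (young _ _)
      exact tsum_congr fun n => by
        rw [tsum_conv_comm (fun k => ENNReal.ofReal ‖f k‖)
          (fun k => ENNReal.ofReal (weight k ^ (a / 2) * ‖g k‖))]
    exact this.trans (by gcongr)
  calc _ ≤ wSum a g ^ 2 * sobSq a f + wSum a g ^ 2 * sobSq a f := add_le_add hX hY
    _ = 2 * (wSum a g ^ 2 * sobSq a f) := by ring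
    _ ≤ 2 * ((embConst (b - a) * sobSq b g) * sobSq a f) := by gcongr
    _ = _ := by ring

theorem wSum_conv_le {f g h : ℤ → ℂ}
    (hh : ∀ n, ENNReal.ofReal ‖h n‖ ≤ ∑' k, ENNReal.ofReal ‖f (n - k)‖ * ENNReal.ofReal ‖g k‖) :
    wSum 0 h ≤ wSum 0 f * wSum 0 g := by
  rw [wSum_zero, wSum_zero, wSum_zero]
  refine (ENNReal.tsum_le_tsum hh).trans (le_of_eq ?_)
  rw [ENNReal.tsum_comm]
  simp_rw [ENNReal.tsum_mul_right]
  rw [← ENNReal.tsum_mul_left]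
  exact tsum_congr fun k => by rw [tsum_sub_right (fun n => ENNReal.ofReal ‖f n‖)]

/-! ### Continuous representatives and multiplication -/


theorem Hs.wSum_ne_top [h : Fact (1 / 2 < θ)] (f : Hs θ) : wSum 0 f.hat ≠ ⊤ := by
  have h1 := wSum_sq_le 0 θ f.hat
  rw [sub_zero, Hs.sobSq_hat] at h1
  have h2 := ne_top_of_le_ne_top
    (ENNReal.mul_ne_top (embConst_ne_top h.out) ENNReal.ofReal_ne_top) h1
  intro h3
  simp [h3] at h2

/-- The norm of `f` in the Wiener algebra of absolutely convergent Fourier series. -/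
def Hs.wiener (f : Hs θ) : ℝ := ∑' n, ‖f.hat n‖

theorem Hs.summable_norm_hat [Fact (1 / 2 < θ)] (f : Hs θ) : Summable fun n => ‖f.hat n‖ := by
  have h := f.wSum_ne_top
  rw [wSum_zero] at h
  exact (ENNReal.summable_toReal h).congr fun n => ENNReal.toReal_ofReal (norm_nonneg _)

theorem Hs.wSum_eq [Fact (1 / 2 < θ)] (f : Hs θ) : wSum 0 f.hat = ENNReal.ofReal f.wiener := by
  rw [wSum_zero, Hs.wiener, ENNReal.ofReal_tsum_of_nonneg (fun _ => norm_nonneg _)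
    f.summable_norm_hat]

theorem Hs.wiener_nonneg (f : Hs θ) : 0 ≤ f.wiener := tsum_nonneg fun _ => norm_nonneg _

theorem Hs.wiener_le [h : Fact (1 / 2 < θ)] (f : Hs θ) :
    f.wiener ≤ √(embConst θ).toReal * ‖f‖ := by
  have h1 := wSum_sq_le 0 θ f.hat
  rw [sub_zero, Hs.sobSq_hat, Hs.wSum_eq, ← ENNReal.ofReal_toReal (embConst_ne_top h.out),
    ← ENNReal.ofReal_pow f.wiener_nonneg, ← ENNReal.ofReal_mul ENNReal.toReal_nonneg,
    ENNReal.ofReal_le_ofReal_iff (by positivity)] at h1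
  rw [← Real.sqrt_sq f.wiener_nonneg, ← Real.sqrt_sq (norm_nonneg f),
    ← Real.sqrt_mul ENNReal.toReal_nonneg]
  exact Real.sqrt_le_sqrt h1

theorem summable_hat_smul_fourier [Fact (1 / 2 < θ)] (f : Hs θ) :
    Summable fun n => f.hat n • (fourier n : C(Circ, ℂ)) := by
  refine Summable.of_norm (f.summable_norm_hat.congr fun n => ?_)
  rw [norm_smul, fourier_norm, mul_one]

/-- The continuous representative of `f ∈ H^θ`, `θ > 1/2`: the sum of its Fourier series. -/
def toC [Fact (1 / 2 < θ)] : Hs θ →L[ℝ] C(Circ, ℝ) :=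
  LinearMap.mkContinuous
    { toFun := fun f => Complex.reCLM.compLeftContinuous ℝ Circ
        (∑' n, f.hat n • (fourier n : C(Circ, ℂ)))
      map_add' := fun f g => by
        rw [← map_add, ← (summable_hat_smul_fourier f).tsum_add (summable_hat_smul_fourier g)]
        refine congrArg _ (tsum_congr fun n => ?_)
        rw [Hs.hat_add]
        exact add_smul (f.hat n) (g.hat n) (fourier n : C(Circ, ℂ))
      map_smul' := fun c f => by
        rw [RingHom.id_apply, ← map_smul, ← (summable_hat_smul_fourier f).tsum_const_smul c]
        simp only [Hs.hat_smul]
        congr 1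
        refine tsum_congr fun n => ?_
        ext x
        simp [mul_assoc] } (√(embConst θ).toReal) fun f => by
    refine le_trans ?_ f.wiener_le
    change ‖Complex.reCLM.compLeftContinuous ℝ Circ _‖ ≤ _
    rw [ContinuousMap.norm_le _ f.wiener_nonneg]
    intro x
    refine (Complex.abs_re_le_norm _).trans ?_
    refine (ContinuousMap.norm_coe_le_norm _ x).trans ?_
    have h : ∀ n, ‖f.hat n • (fourier n : C(Circ, ℂ))‖ = ‖f.hat n‖ := fun n => by
      rw [norm_smul, fourier_norm, mul_one]
    refine (norm_tsum_le_tsum_norm ?_).trans (le_of_eq (tsum_congr h))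
    simp_rw [h]
    exact f.summable_norm_hat

theorem toC_coe [Fact (1 / 2 < θ)] (f : Hs θ) (x : Circ) :
    HasSum (fun n => f.hat n * fourier n x) ((toC f x : ℝ) : ℂ) := by
  have hs := (summable_hat_smul_fourier f).hasSum
  have h1 : HasSum (fun n => f.hat n * fourier n x)
      ((∑' n, f.hat n • (fourier n : C(Circ, ℂ))) x) :=
    (ContinuousMap.evalCLM ℂ x).hasSum hs
  have h2 : conj ((∑' n, f.hat n • (fourier n : C(Circ, ℂ))) x)
      = (∑' n, f.hat n • (fourier n : C(Circ, ℂ))) x := by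
    refine HasSum.unique ?_ h1
    have h3 := (Equiv.neg ℤ).hasSum_iff.2 ((Complex.hasSum_conj').2 h1)
    refine h3.congr_fun ?_
    intro n
    simp [Hs.hat_conj]
  convert h1 using 1
  exact (Complex.conj_eq_iff_re.1 h2)

theorem norm_toC_le_wiener [Fact (1 / 2 < θ)] (f : Hs θ) : ‖toC f‖ ≤ f.wiener := by
  rw [ContinuousMap.norm_le _ f.wiener_nonneg]
  intro x
  rw [← Complex.norm_real, ← (toC_coe f x).tsum_eq]
  have h : ∀ n, ‖f.hat n * fourier n x‖ = ‖f.hat n‖ := fun n => by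
    rw [norm_mul, fourier_apply, Circle.norm_coe, mul_one]
  refine (norm_tsum_le_tsum_norm ?_).trans (le_of_eq (tsum_congr h))
  simp_rw [h]
  exact f.summable_norm_hat

/-- A continuous function as an element of `L²`. -/
def ofC : C(Circ, ℝ) →L[ℝ] L2 := ContinuousMap.toLp 2 haar ℝ

theorem ofC_ae (φ : C(Circ, ℝ)) : ofC φ =ᵐ[haar] φ := ContinuousMap.coeFn_toLp haar φ

theorem ofC_injective : Function.Injective ofC := ContinuousMap.toLp_injective haar

theorem coeff_ofC_toC [Fact (1 / 2 < θ)] (f : Hs θ) (n : ℤ) : coeff (ofC (toC f)) n = f.hat n := by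
  have h1 : coeff (ofC (toC f)) n
      = fourierCoeff (⇑(∑' n, f.hat n • (fourier n : C(Circ, ℂ)))) n := by
    refine congrFun (fourierCoeff_congr_ae ?_) n
    filter_upwards [ofC_ae (toC f)] with x hx
    rw [hx, ← (toC_coe f x).tsum_eq]
    exact ((ContinuousMap.evalCLM ℂ x).hasSum (summable_hat_smul_fourier f).hasSum).tsum_eq
  rw [h1, ← fourierCoeff_toLp, ← fourierBasis_repr,
    (ContinuousMap.toLp 2 haar ℂ).map_tsum (summable_hat_smul_fourier f)]
  have h2 : (fun m => (ContinuousMap.toLp 2 haar ℂ) (f.hat m • (fourier m : C(Circ, ℂ))))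
      = fun m => f.hat m • fourierBasis m := by
    funext m
    rw [map_smul, coe_fourierBasis]
  have hmem : Memℓp f.hat 2 := by
    have := memℓp_of_sobSq (θ := 0) (c := f.hat)
      (by rw [show f.hat = coeff f.toL2 from rfl, sobSq_zero]; exact ENNReal.ofReal_ne_top)
    simpa using this
  have h3 := (fourierBasis (T := (1 : ℝ))).hasSum_repr_symm ⟨f.hat, hmem⟩
  rw [h2, h3.tsum_eq, LinearIsometryEquiv.apply_symm_apply]

@[simp] theorem ofC_toC [Fact (1 / 2 < θ)] (f : Hs θ) : ofC (toC f) = f.toL2 :=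
  L2_ext (coeff_ofC_toC f)

theorem toC_ae [Fact (1 / 2 < θ)] (f : Hs θ) : f.toL2 =ᵐ[haar] toC f := by
  rw [← ofC_toC]; exact ofC_ae _

theorem toC_injective [Fact (1 / 2 < θ)] : Function.Injective (toC (θ := θ)) := fun f g h =>
  toL2_injective (by rw [← ofC_toC, h, ofC_toC])

theorem toC_inclCLM {a b : ℝ} [Fact (1 / 2 < a)] [Fact (1 / 2 < b)] (hb : 0 ≤ b) (h : b ≤ a)
    (f : Hs a) : toC (inclCLM hb h f) = toC f :=
  ofC_injective (by rw [ofC_toC, ofC_toC, toL2_inclCLM])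

/-- Multiplication of square-integrable functions by continuous functions. -/
def mulL2 : C(Circ, ℝ) →L[ℝ] L2 →L[ℝ] L2 :=
  ((ContinuousLinearMap.mul ℝ ℝ).holderL haar ⊤ 2 2).comp (ContinuousMap.toLp ⊤ haar ℝ)

theorem mulL2_ae (φ : C(Circ, ℝ)) (f : L2) : mulL2 φ f =ᵐ[haar] fun x => φ x * f x := by
  have h := (ContinuousLinearMap.mul ℝ ℝ).coeFn_holder (r := 2)
    (ContinuousMap.toLp ⊤ haar ℝ φ) f
  filter_upwards [h, ContinuousMap.coeFn_toLp (p := ⊤) haar (𝕜 := ℝ) φ] with x h1 h2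
  rw [← h2]
  exact h1

theorem mulL2_ofC (φ ψ : C(Circ, ℝ)) : mulL2 φ (ofC ψ) = ofC (φ * ψ) := by
  refine Lp.ext ?_
  filter_upwards [mulL2_ae φ (ofC ψ), ofC_ae ψ, ofC_ae (φ * ψ)] with x h1 h2 h3
  rw [h1, h2, h3, ContinuousMap.mul_apply]

/-- The Fourier coefficients of a product are given by a convolution. -/
theorem hasSum_coeff_mulL2 [Fact (1 / 2 < θ)] (f : Hs θ) (g : L2) (n : ℤ) :
    HasSum (fun k => f.hat (n - k) * coeff g k) (coeff (mulL2 (toC f) g) n) := by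
  have hg : Integrable (fun x => ((g x : ℝ) : ℂ)) haar :=
    ((Lp.memLp g).integrable (by norm_num)).ofReal
  have hF : ∀ k, Integrable
      (fun x => fourier (-n) x • (f.hat k • (fourier k x • ((g x : ℝ) : ℂ)))) haar :=
    fun k => ((hg.fourier_smul k).smul (f.hat k)).fourier_smul (-n)
  have hnorm : ∀ k, ∫ x, ‖fourier (-n) x • (f.hat k • (fourier k x • ((g x : ℝ) : ℂ)))‖ ∂haar
      = ‖f.hat k‖ * ∫ x, ‖((g x : ℝ) : ℂ)‖ ∂haar := by
    intro k
    rw [← integral_const_mul]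
    refine integral_congr_ae (ae_of_all _ fun x => ?_)
    simp only [norm_smul, fourier_apply, Circle.norm_coe, one_mul]
  have h := hasSum_integral_of_summable_integral_norm hF (by
    simp_rw [hnorm]
    exact f.summable_norm_hat.mul_right _)
  have e1 : ∫ x, ∑' k, fourier (-n) x • (f.hat k • (fourier k x • ((g x : ℝ) : ℂ))) ∂haar
      = coeff (mulL2 (toC f) g) n := by
    refine integral_congr_ae ?_
    filter_upwards [mulL2_ae (toC f) g] with x hx
    rw [hx, Complex.ofReal_mul, ← (toC_coe f x).tsum_eq, tsum_const_smul'', smul_eq_mul,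
      smul_eq_mul, ← tsum_mul_right]
    simp only [smul_eq_mul, mul_assoc]
  have e2 : ∀ k, ∫ x, fourier (-n) x • (f.hat k • (fourier k x • ((g x : ℝ) : ℂ))) ∂haar
      = f.hat k * coeff g (n - k) := by
    intro k
    rw [coeff, fourierCoeff, ← integral_const_mul]
    refine integral_congr_ae (ae_of_all _ fun x => ?_)
    simp only [smul_eq_mul]
    rw [show -(n - k) = -n + k by ring, fourier_add]
    ring
  rw [e1] at h
  simp_rw [e2] at h
  have h2 := (Equiv.subLeft n).hasSum_iff.2 h
  refine h2.congr_fun ?_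
  intro k
  simp

theorem ofReal_norm_coeff_mulL2_le [Fact (1 / 2 < θ)] (f : Hs θ) (g : L2) (n : ℤ) :
    ENNReal.ofReal ‖coeff (mulL2 (toC f) g) n‖
      ≤ ∑' k, ENNReal.ofReal ‖f.hat (n - k)‖ * ENNReal.ofReal ‖coeff g k‖ := by
  rw [← (hasSum_coeff_mulL2 f g n).tsum_eq]
  simp_rw [← ENNReal.ofReal_mul (norm_nonneg _), ← norm_mul, ofReal_norm]
  exact enorm_tsum_le_tsum_enorm

/-- A bounded multiplication operator between Sobolev spaces, from a bound on products. -/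
def mkMul {a b : ℝ} [Fact (1 / 2 < b)] (C : ℝ) (hC : 0 ≤ C)
    (h : ∀ (f : Hs b) (g : Hs a),
      sobSq a (coeff (mulL2 (toC f) g.toL2)) ≤ ENNReal.ofReal ((C * ‖f‖ * ‖g‖) ^ 2)) :
    Hs b →L[ℝ] Hs a →L[ℝ] Hs a :=
  LinearMap.mkContinuous₂
    (LinearMap.mk₂ ℝ (fun f g => Hs.ofL2 (mulL2 (toC f) g.toL2)
        (ne_top_of_le_ne_top ENNReal.ofReal_ne_top (h f g)))
      (fun f g k => toL2_injective (by
        change mulL2 (toC (f + g)) k.toL2 = mulL2 (toC f) k.toL2 + mulL2 (toC g) k.toL2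
        rw [map_add, map_add, add_apply]))
      (fun c f k => toL2_injective (by
        change mulL2 (toC (c • f)) k.toL2 = c • mulL2 (toC f) k.toL2
        rw [map_smul, map_smul, smul_apply]))
      (fun f g k => toL2_injective (by
        change mulL2 (toC f) (g.toL2 + k.toL2) = mulL2 (toC f) g.toL2 + mulL2 (toC f) k.toL2
        rw [map_add]))
      (fun c f k => toL2_injective (by
        change mulL2 (toC f) (c • k.toL2) = c • mulL2 (toC f) k.toL2
        rw [map_smul])))
    C fun f g => Hs.norm_le_of_sobSq (by positivity) (h f g)

theorem half_lt_nonneg (h : Fact (1 / 2 < θ)) : 0 ≤ θ := by linarith [h.out]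

theorem sobSq_mulL2_le [hθ : Fact (1 / 2 < θ)] (f g : Hs θ) :
    sobSq θ (coeff (mulL2 (toC f) g.toL2)) ≤
      ENNReal.ofReal (2 * 4 ^ θ * (f.wiener * ‖g‖ + ‖f‖ * g.wiener) ^ 2) := by
  refine (sobSq_conv_le (half_lt_nonneg hθ) (ofReal_norm_coeff_mulL2_le f g.toL2)).trans ?_
  have h1 := f.wiener_nonneg
  have h2 := g.wiener_nonneg
  rw [show coeff g.toL2 = g.hat from rfl, Hs.wSum_eq, Hs.wSum_eq, Hs.sobSq_hat, Hs.sobSq_hat,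
    ← ENNReal.ofReal_pow h1, ← ENNReal.ofReal_pow h2, ← ENNReal.ofReal_mul (by positivity),
    ← ENNReal.ofReal_mul (by positivity), ← ENNReal.ofReal_add (by positivity) (by positivity),
    ← ENNReal.ofReal_mul (by positivity)]
  refine ENNReal.ofReal_le_ofReal ?_
  gcongr
  have := mul_nonneg (mul_nonneg h1 (norm_nonneg g)) (mul_nonneg h2 (norm_nonneg f))
  nlinarith

/-- The product of two functions in the algebra `H^θ`, `θ > 1/2`. -/
def mulH [hθ : Fact (1 / 2 < θ)] : Hs θ →L[ℝ] Hs θ →L[ℝ] Hs θ :=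
  mkMul (√(2 * 4 ^ θ) * (2 * √(embConst θ).toReal)) (by positivity) fun f g => by
    refine (sobSq_mulL2_le f g).trans (ENNReal.ofReal_le_ofReal ?_)
    have h1 := f.wiener_le
    have h2 := g.wiener_le
    have h3 := f.wiener_nonneg
    have h4 := g.wiener_nonneg
    calc 2 * 4 ^ θ * (f.wiener * ‖g‖ + ‖f‖ * g.wiener) ^ 2
        ≤ 2 * 4 ^ θ * ((√(embConst θ).toReal * ‖f‖) * ‖g‖
          + ‖f‖ * (√(embConst θ).toReal * ‖g‖)) ^ 2 := by gcongr
      _ = √(2 * 4 ^ θ) ^ 2 * ((2 * √(embConst θ).toReal) * ‖f‖ * ‖g‖) ^ 2 := by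
          rw [Real.sq_sqrt (by positivity)]; ring
      _ = _ := by ring

notation:70 f:70 " ⊙ " g:71 => mulH f g

theorem toL2_mulH [Fact (1 / 2 < θ)] (f g : Hs θ) : (f ⊙ g).toL2 = mulL2 (toC f) g.toL2 := rfl

@[simp] theorem toC_mulH [Fact (1 / 2 < θ)] (f g : Hs θ) : toC (f ⊙ g) = toC f * toC g :=
  ofC_injective (by rw [ofC_toC, toL2_mulH, ← ofC_toC, mulL2_ofC])

theorem norm_mulH_le [Fact (1 / 2 < θ)] (f g : Hs θ) :
    ‖f ⊙ g‖ ≤ √(2 * 4 ^ θ) * (f.wiener * ‖g‖ + ‖f‖ * g.wiener) := by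
  have h1 := f.wiener_nonneg
  have h2 := g.wiener_nonneg
  refine Hs.norm_le_of_sobSq (by positivity) ?_
  rw [mul_pow, Real.sq_sqrt (by positivity)]
  exact sobSq_mulL2_le f g

theorem wiener_mulH_le [Fact (1 / 2 < θ)] (f g : Hs θ) : (f ⊙ g).wiener ≤ f.wiener * g.wiener := by
  have h := wSum_conv_le (ofReal_norm_coeff_mulL2_le f g.toL2)
  rw [← toL2_mulH, show coeff g.toL2 = g.hat from rfl,
    show coeff (f ⊙ g).toL2 = (f ⊙ g).hat from rfl, Hs.wSum_eq, Hs.wSum_eq, Hs.wSum_eq,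
    ← ENNReal.ofReal_mul f.wiener_nonneg,
    ENNReal.ofReal_le_ofReal_iff (mul_nonneg f.wiener_nonneg g.wiener_nonneg)] at h
  exact h

theorem hasSum_hat_mulH [Fact (1 / 2 < θ)] (f g : Hs θ) (n : ℤ) :
    HasSum (fun k => f.hat (n - k) * g.hat k) ((f ⊙ g).hat n) := hasSum_coeff_mulL2 f g.toL2 n

/-- The product of `g ∈ H^b` and `f ∈ H^a`, which lies in `H^a` if `b > a + 1/2`. -/
def prodH {a b : ℝ} [hb : Fact (1 / 2 < b)] (ha : 0 ≤ a) (hab : 1 / 2 < b - a) :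
    Hs b →L[ℝ] Hs a →L[ℝ] Hs a :=
  mkMul (√(2 * 4 ^ a * (2 * (embConst (b - a)).toReal))) (by positivity) fun g f => by
    have h := sobSq_conv_le' (f := f.hat) (g := g.hat) (h := coeff (mulL2 (toC g) f.toL2)) b ha
      (fun n => by
        rw [tsum_conv_comm (fun k => ENNReal.ofReal ‖f.hat k‖) (fun k => ENNReal.ofReal ‖g.hat k‖)]
        exact ofReal_norm_coeff_mulL2_le g f.toL2 n)
    refine h.trans (le_of_eq ?_)
    rw [Hs.sobSq_hat, Hs.sobSq_hat, ← ENNReal.ofReal_toReal (embConst_ne_top hab),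
      ← ENNReal.ofReal_ofNat 2, ← ENNReal.ofReal_mul (by positivity),
      ← ENNReal.ofReal_mul (by positivity), ← ENNReal.ofReal_mul (by positivity),
      ← ENNReal.ofReal_mul (by positivity), ENNReal.toReal_ofReal ENNReal.toReal_nonneg,
      mul_pow, mul_pow, Real.sq_sqrt (by positivity)]
    ring_nf

theorem toL2_prodH {a b : ℝ} [hb : Fact (1 / 2 < b)] (ha : 0 ≤ a) (hab : 1 / 2 < b - a)
    (g : Hs b) (f : Hs a) : (prodH ha hab g f).toL2 = mulL2 (toC g) f.toL2 := rfl

/-! ### Derivatives and primitives -/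

/-- The symbol `2πin` of `∂ₓ`. -/
def dSym (n : ℤ) : ℂ := 2 * Real.pi * n * Complex.I

theorem norm_dSym_sq (n : ℤ) : ‖dSym n‖ ^ 2 = (2 * Real.pi * n) ^ 2 := by
  simp [dSym, mul_pow]

theorem dSym_ne_zero {n : ℤ} (hn : n ≠ 0) : dSym n ≠ 0 := by
  simp [dSym, hn, Real.pi_ne_zero]

@[simp] theorem dSym_zero : dSym 0 = 0 := by simp [dSym]

theorem dSym_neg (n : ℤ) : dSym (-n) = conj (dSym n) := by
  apply Complex.ext <;> simp [dSym]

theorem isSymbol_deriv {a b : ℝ} (h : b + 1 ≤ a) : IsSymbol a b 1 dSym where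
  nonneg := zero_le_one
  conj_symm := dSym_neg
  bound n := by
    have hw := weight_pos n
    rw [norm_dSym_sq, one_pow, one_mul]
    calc weight n ^ b * (2 * Real.pi * n) ^ 2 ≤ weight n ^ b * weight n := by
          gcongr; unfold weight; linarith
      _ = weight n ^ (b + 1) := by rw [Real.rpow_add hw, Real.rpow_one]
      _ ≤ weight n ^ a := Real.rpow_le_rpow_of_exponent_le (one_le_weight n) h

theorem weight_le_two_mul {n : ℤ} (hn : n ≠ 0) : weight n ≤ 2 * (2 * Real.pi * n) ^ 2 := by
  have h1 : (1 : ℝ) ≤ (n : ℝ) ^ 2 := by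
    have : 1 ≤ n ^ 2 := by
      have := Int.one_le_abs hn
      rw [← sq_abs]; nlinarith
    exact_mod_cast this
  unfold weight
  have : 1 ≤ (2 * Real.pi) ^ 2 := by nlinarith [Real.pi_gt_three]
  nlinarith

theorem isSymbol_prim {a b : ℝ} (h : b ≤ a + 1) : IsSymbol a b 2 (fun n => (dSym n)⁻¹) where
  nonneg := zero_le_two
  conj_symm n := by rw [dSym_neg, map_inv₀]
  bound n := by
    have hw := weight_pos n
    rcases eq_or_ne n 0 with rfl | hn
    · simp; positivity
    rw [norm_inv, inv_pow, norm_dSym_sq]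
    have hpos : 0 < (2 * Real.pi * n) ^ 2 := by have := Real.pi_pos; positivity
    rw [← div_eq_mul_inv, div_le_iff₀ hpos]
    calc weight n ^ b ≤ weight n ^ (a + 1) := Real.rpow_le_rpow_of_exponent_le (one_le_weight n) h
      _ = weight n ^ a * weight n := by rw [Real.rpow_add hw, Real.rpow_one]
      _ ≤ weight n ^ a * (2 * (2 * Real.pi * n) ^ 2) := by gcongr; exact weight_le_two_mul hn
      _ ≤ 2 ^ 2 * weight n ^ a * (2 * Real.pi * n) ^ 2 := by
          have : 0 ≤ weight n ^ a * (2 * Real.pi * n) ^ 2 := by positivity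
          linarith

/-- The derivative `∂ₓ` from `H^a` to `H^b`, `b ≤ a - 1`. -/
def derivH {a b : ℝ} (hb : 0 ≤ b) (h : b + 1 ≤ a) : Hs a →L[ℝ] Hs b := mult hb (isSymbol_deriv h)

/-- The primitive with mean zero of a function minus its mean, from `H^a` to `H^b`, `b ≤ a + 1`. -/
def primH {a b : ℝ} (hb : 0 ≤ b) (h : b ≤ a + 1) : Hs a →L[ℝ] Hs b := mult hb (isSymbol_prim h)

@[simp] theorem hat_derivH {a b : ℝ} (hb : 0 ≤ b) (h : b + 1 ≤ a) (f : Hs a) (n : ℤ) :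
    (derivH hb h f).hat n = dSym n * f.hat n := hat_mult _ _ _ _

@[simp] theorem hat_primH {a b : ℝ} (hb : 0 ≤ b) (h : b ≤ a + 1) (f : Hs a) (n : ℤ) :
    (primH hb h f).hat n = (dSym n)⁻¹ * f.hat n := hat_mult _ _ _ _

/-- A real number as a constant function in `H^θ`. -/
def constH (hθ : 0 ≤ θ) : ℝ →L[ℝ] Hs θ :=
  (ContinuousLinearMap.id ℝ ℝ).smulRight (Hs.ofHat hθ (fun n => if n = 0 then 1 else 0)
    (fun n => by simp only [neg_eq_zero]; split_ifs <;> simp) (by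
      rw [sobSq, tsum_eq_single 0 (fun n hn => by simp [hn])]
      exact ENNReal.ofReal_ne_top))

@[simp] theorem hat_constH (hθ : 0 ≤ θ) (c : ℝ) (n : ℤ) :
    (constH hθ c).hat n = if n = 0 then (c : ℂ) else 0 := by
  rw [constH, ContinuousLinearMap.smulRight_apply, Hs.hat_smul, Hs.hat_ofHat]
  simp

@[simp] theorem toC_constH [Fact (1 / 2 < θ)] (hθ : 0 ≤ θ) (c : ℝ) (x : Circ) :
    toC (constH hθ c) x = c := by
  have h := toC_coe (constH hθ c) x
  have h2 : HasSum (fun n => (constH hθ c).hat n * fourier n x) (c : ℂ) := by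
    convert hasSum_ite_eq (0 : ℤ) (c : ℂ) using 2 with n
    rw [hat_constH]
    split_ifs with hn
    · subst hn; simp
    · simp
  exact_mod_cast h.unique h2

/-! ### Means, integrals and weak derivatives -/

/-- The mean of a function on the circle. -/
def avg : L2 →L[ℝ] ℝ := Complex.reCLM.comp (coeffCLM 0)

theorem coeff_zero (f : L2) : coeff f 0 = (avg f : ℂ) := by
  have h := coeff_neg f 0
  rw [neg_zero] at h
  exact (Complex.conj_eq_iff_re.1 h.symm).symm

theorem Hs.hat_zero_eq (f : Hs θ) : f.hat 0 = (avg f.toL2 : ℂ) := coeff_zero _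

theorem integral_circ (F : Circ → ℝ) : ∫ x, F x ∂haar = ∫ x in (0 : ℝ)..1, F (x : Circ) := by
  have h := AddCircle.intervalIntegral_preimage (1 : ℝ) 0 F
  rw [zero_add] at h
  rw [h, haar, AddCircle.integral_haarAddCircle, inv_one, one_smul]

theorem avg_eq (f : L2) : avg f = ∫ x, f x ∂haar := by
  have h : coeff f 0 = ((∫ x, f x ∂haar : ℝ) : ℂ) := by
    rw [coeff, fourierCoeff, ← integral_complex_ofReal]
    simp
  rw [coeff_zero] at h
  exact_mod_cast h

theorem mean_eq (f : L2) : mean f = avg f := by rw [avg_eq, integral_circ, mean]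

theorem inner_eq (f g : L2) : inner ℝ f g = ∫ x, f x * g x ∂haar := by
  rw [L2.inner_def]
  exact integral_congr_ae (ae_of_all _ fun x => by simp [mul_comm])

theorem inner_ofC (f : L2) (φ : C(Circ, ℝ)) : inner ℝ f (ofC φ) = ∫ x, f x * φ x ∂haar := by
  rw [inner_eq]
  refine integral_congr_ae ?_
  filter_upwards [ofC_ae φ] with x hx
  rw [hx]

theorem avg_ofC (φ : C(Circ, ℝ)) : avg (ofC φ) = ∫ x, φ x ∂haar := by
  rw [avg_eq]; exact integral_congr_ae (ofC_ae φ)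

theorem avg_toL2 [Fact (1 / 2 < θ)] (f : Hs θ) : avg f.toL2 = ∫ x, toC f x ∂haar := by
  rw [← ofC_toC, avg_ofC]

/-- `g` is the weak derivative of `f`, in terms of Fourier coefficients. -/
def WD (f g : L2) : Prop := ∀ n, coeff g n = dSym n * coeff f n

/-- `ψ` is the classical derivative of `φ`. -/
def IsC1 (φ ψ : C(Circ, ℝ)) : Prop :=
  ∀ x : ℝ, HasDerivAt (fun y : ℝ => φ (y : Circ)) (ψ (x : Circ)) x

/-- Integration by parts. -/
theorem WD.inner {f g p q : L2} (h1 : WD f g) (h2 : WD p q) : inner ℝ f q = -inner ℝ g p := by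
  have e1 := hasSum_coeff_mul f q
  have e2 := (hasSum_coeff_mul g p).neg
  have : (fun n => coeff q n * conj (coeff f n)) = fun n => -(coeff p n * conj (coeff g n)) := by
    funext n
    rw [h1 n, h2 n, map_mul, ← dSym_neg, show dSym (-n) = -dSym n by simp [dSym]]
    ring
  rw [this] at e1
  have := e1.unique e2
  exact_mod_cast this

/-- The function `cos (2πnx)` on the circle. -/
def cosC (n : ℤ) : C(Circ, ℝ) := ⟨fun x => (fourier n x).re, by fun_prop⟩

/-- The function `sin (2πnx)` on the circle. -/
def sinC (n : ℤ) : C(Circ, ℝ) := ⟨fun x => (fourier n x).im, by fun_prop⟩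

theorem fourier_coe_eq (n : ℤ) (x : ℝ) :
    fourier n (x : Circ) = Complex.exp ((2 * Real.pi * n * x : ℝ) * Complex.I) := by
  rw [fourier_coe_apply]
  congr 1
  push_cast
  ring

theorem cosC_coe (n : ℤ) (x : ℝ) : cosC n (x : Circ) = Real.cos (2 * Real.pi * n * x) := by
  change (fourier n (x : Circ)).re = _
  rw [fourier_coe_eq, Complex.exp_ofReal_mul_I_re]

theorem sinC_coe (n : ℤ) (x : ℝ) : sinC n (x : Circ) = Real.sin (2 * Real.pi * n * x) := by
  change (fourier n (x : Circ)).im = _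
  rw [fourier_coe_eq, Complex.exp_ofReal_mul_I_im]

theorem coeff_eq_inner (f : L2) (n : ℤ) :
    coeff f n = (inner ℝ f (ofC (cosC n)) : ℝ) - (inner ℝ f (ofC (sinC n)) : ℝ) * Complex.I := by
  have hb : ∀ φ : C(Circ, ℝ), Integrable (fun x => ((f x * φ x : ℝ) : ℂ)) haar := fun φ => by
    refine Integrable.ofReal ?_
    have := ((Lp.memLp (mulL2 φ f)).integrable (by norm_num) : Integrable _ haar)
    refine this.congr ?_
    filter_upwards [mulL2_ae φ f] with x hx
    rw [hx]; exact mul_comm _ _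
  rw [inner_ofC, inner_ofC, ← integral_complex_ofReal, ← integral_complex_ofReal,
    ← integral_mul_const, ← integral_sub (hb _) ((hb _).mul_const _)]
  refine integral_congr_ae (ae_of_all _ fun x => ?_)
  simp only [smul_eq_mul, fourier_neg]
  change conj (fourier n x) * _ = ((f x * (fourier n x).re : ℝ) : ℂ)
    - ((f x * (fourier n x).im : ℝ) : ℂ) * Complex.I
  apply Complex.ext <;> simp <;> ring

theorem isC1_cosC (n : ℤ) : IsC1 (cosC n) (-(2 * Real.pi * n) • sinC n) := fun x => by
  simp only [cosC_coe]
  have h := ((hasDerivAt_id x).const_mul (2 * Real.pi * n)).cos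
  refine h.congr_deriv ?_
  simp [sinC_coe]; ring

theorem isC1_sinC (n : ℤ) : IsC1 (sinC n) ((2 * Real.pi * n) • cosC n) := fun x => by
  simp only [sinC_coe]
  have h := ((hasDerivAt_id x).const_mul (2 * Real.pi * n)).sin
  refine h.congr_deriv ?_
  simp [cosC_coe]; ring

theorem WD_of_trig {f g : L2}
    (h1 : ∀ n : ℤ, inner ℝ g (ofC (cosC n)) = (2 * Real.pi * n) * inner ℝ f (ofC (sinC n)))
    (h2 : ∀ n : ℤ, inner ℝ g (ofC (sinC n)) = -((2 * Real.pi * n) * inner ℝ f (ofC (cosC n)))) :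
    WD f g := fun n => by
  rw [coeff_eq_inner, coeff_eq_inner, h1, h2, dSym]
  apply Complex.ext <;> simp

theorem WD_of_test {f g : L2} (h : ∀ φ ψ, IsC1 φ ψ → inner ℝ f (ofC ψ) = -inner ℝ g (ofC φ)) :
    WD f g := by
  refine WD_of_trig (fun n => ?_) fun n => ?_
  · have := h _ _ (isC1_cosC n)
    rw [map_smul, inner_smul_right] at this
    linarith
  · have := h _ _ (isC1_sinC n)
    rw [map_smul, inner_smul_right] at this
    linarith

theorem IsC1.continuous_comp (φ : C(Circ, ℝ)) : Continuous fun y : ℝ => φ (y : Circ) :=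
  φ.continuous.comp (AddCircle.continuous_mk' 1)

theorem IsC1.mul {φ ψ φ' ψ' : C(Circ, ℝ)} (h : IsC1 φ φ') (h' : IsC1 ψ ψ') :
    IsC1 (φ * ψ) (φ' * ψ + φ * ψ') := fun x => (h x).mul (h' x)

/-- The integral of a derivative over the circle vanishes. -/
theorem IsC1.integral_eq_zero {φ ψ : C(Circ, ℝ)} (h : IsC1 φ ψ) : ∫ x, ψ x ∂haar = 0 := by
  rw [integral_circ, intervalIntegral.integral_eq_sub_of_hasDerivAt (fun x _ => h x)
    ((IsC1.continuous_comp ψ).intervalIntegrable _ _)]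
  have : ((1 : ℝ) : Circ) = ((0 : ℝ) : Circ) := by
    rw [AddCircle.coe_period, QuotientAddGroup.mk_zero]
  rw [this, sub_self]

theorem integrable_C (φ : C(Circ, ℝ)) : Integrable φ haar :=
  φ.continuous.integrable_of_hasCompactSupport (HasCompactSupport.of_compactSpace _)

theorem IsC1.WD {φ ψ : C(Circ, ℝ)} (h : IsC1 φ ψ) : WD (ofC φ) (ofC ψ) := by
  refine WD_of_test fun p q hpq => ?_
  have h1 := (h.mul hpq).integral_eq_zero
  have e : ∀ a b : C(Circ, ℝ), inner ℝ (ofC a) (ofC b) = ∫ x, (a * b) x ∂haar := fun a b => by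
    rw [inner_ofC]
    refine integral_congr_ae ?_
    filter_upwards [ofC_ae a] with x hx
    rw [hx, ContinuousMap.mul_apply]
  rw [e, e]
  have h2 : ∫ x, (ψ * p + φ * q) x ∂haar = ∫ x, (ψ * p) x ∂haar + ∫ x, (φ * q) x ∂haar :=
    integral_add (integrable_C _) (integrable_C _)
  linarith

theorem WD.test {f g : L2} (h : MuHS.WD f g) {φ ψ : C(Circ, ℝ)} (hφ : IsC1 φ ψ) :
    Inner.inner ℝ f (ofC ψ) = -Inner.inner ℝ g (ofC φ) := h.inner hφ.WD

/-- Weak derivatives are stable under limits in `L²`. -/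
theorem WD.of_tendsto {ι : Type*} {l : Filter ι} [l.NeBot] {f g : ι → L2} {f₀ g₀ : L2}
    (h : ∀ i, MuHS.WD (f i) (g i)) (hf : Tendsto f l (𝓝 f₀)) (hg : Tendsto g l (𝓝 g₀)) :
    MuHS.WD f₀ g₀ := fun n => by
  have h1 := ((coeffCLM n).continuous.tendsto _).comp hg
  have h2 := (((coeffCLM n).continuous.tendsto _).comp hf).const_mul (dSym n)
  refine tendsto_nhds_unique h1 (h2.congr fun i => ?_)
  exact (h i n).symm

theorem WD_derivH {a b : ℝ} (hb : 0 ≤ b) (h : b + 1 ≤ a) (f : Hs a) :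
    WD f.toL2 (derivH hb h f).toL2 := hat_derivH hb h f

/-- A function with weak derivative in `H^b` is its mean plus the primitive of the derivative. -/
theorem WD.eq_prim {a b : ℝ} (ha : 0 ≤ a) (h : a ≤ b + 1) {f : L2} {g : Hs b}
    (hfg : MuHS.WD f g.toL2) : (constH ha (avg f) + primH ha h g).toL2 = f := by
  refine L2_ext fun n => ?_
  change (constH ha (avg f) + primH ha h g).hat n = _
  rw [Hs.hat_add, hat_constH, hat_primH]
  rcases eq_or_ne n 0 with rfl | hn
  · simp [coeff_zero]
  · rw [if_neg hn, zero_add, show g.hat n = _ from hfg n, ← mul_assoc,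
      inv_mul_cancel₀ (dSym_ne_zero hn), one_mul]

/-- Functions in `H^a`, `a > 3/2`, are continuously differentiable. -/
theorem isC1_toC {a b : ℝ} [Fact (1 / 2 < a)] [Fact (1 / 2 < b)] (hb : 0 ≤ b) (h : b + 1 ≤ a)
    (f : Hs a) : IsC1 (toC f) (toC (derivH hb h f)) := fun x => by
  have hd : ∀ (n : ℤ) (y : ℝ), HasDerivAt (fun y : ℝ => f.hat n * fourier n (y : Circ))
      ((derivH hb h f).hat n * fourier n (y : Circ)) y := fun n y => by
    have := (hasDerivAt_fourier (1 : ℝ) n y).const_mul (f.hat n)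
    refine this.congr_deriv ?_
    rw [hat_derivH, dSym]
    push_cast
    ring
  have h1 : HasDerivAt (fun y : ℝ => ∑' n, f.hat n * fourier n (y : Circ))
      (∑' n, (derivH hb h f).hat n * fourier n (x : Circ)) x :=
    hasDerivAt_tsum (derivH hb h f).summable_norm_hat hd
      (fun n y => by rw [norm_mul, fourier_apply, Circle.norm_coe, mul_one])
      (toC_coe f (((0 : ℝ) : Circ))).summable x
  rw [(toC_coe _ _).tsum_eq] at h1
  have h2 : (fun y : ℝ => ∑' n, f.hat n * fourier n (y : Circ))
      = fun y : ℝ => ((toC f (y : Circ) : ℝ) : ℂ) := funext fun y => (toC_coe f _).tsum_eq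
  rw [h2] at h1
  have h4 : HasFDerivAt (fun z : ℂ => z.re) Complex.reCLM
      ((toC f (x : Circ) : ℝ) : ℂ) := Complex.reCLM.hasFDerivAt
  have h3 := h4.comp_hasDerivAt x h1
  exact h3

/-! ### Fractional regularity through smooth approximation -/

/-- The truncation of a sequence of Fourier coefficients to frequencies `|n| < 2^k`. -/
def truncSeq (k : ℕ) (c : ℤ → ℂ) (n : ℤ) : ℂ := if n.natAbs < 2 ^ k then c n else 0

theorem rpow_pow_comm (k : ℕ) (r : ℝ) : ((4 : ℝ) ^ r) ^ k = ((4 : ℝ) ^ k) ^ r := by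
  rw [← Real.rpow_natCast, ← Real.rpow_mul (by norm_num), mul_comm, Real.rpow_mul (by norm_num),
    Real.rpow_natCast]

theorem four_pow_le_weight {n : ℤ} {k : ℕ} (h : 2 ^ k ≤ n.natAbs) : (4 : ℝ) ^ k ≤ weight n := by
  have h1 : (2 : ℝ) ^ k ≤ |(n : ℝ)| := by
    rw [← Int.cast_abs, ← Nat.cast_natAbs]; exact_mod_cast h
  have h2 : (4 : ℝ) ^ k ≤ (n : ℝ) ^ 2 := by
    rw [← sq_abs, show (4 : ℝ) = 2 ^ 2 by norm_num, ← pow_mul, mul_comm, pow_mul]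
    gcongr
  unfold weight
  have : 1 ≤ (2 * Real.pi) ^ 2 := by nlinarith [Real.pi_gt_three]
  nlinarith [sq_nonneg (n : ℝ)]

/-- The constant `1 + (2π)²`, for which `1 + (2πn)² ≤ (1 + (2π)²) r²` if `|n| ≤ r`, `1 ≤ r`. -/
def wConst : ℝ := 1 + (2 * Real.pi) ^ 2

theorem wConst_pos : 0 < wConst := by unfold wConst; positivity

theorem weight_le_four_pow {n : ℤ} {k : ℕ} (h : n.natAbs ≤ 2 ^ k) :
    weight n ≤ wConst * (4 : ℝ) ^ k := by
  have h1 : |(n : ℝ)| ≤ (2 : ℝ) ^ k := by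
    rw [← Int.cast_abs, ← Nat.cast_natAbs]; exact_mod_cast h
  have h2 : (n : ℝ) ^ 2 ≤ (4 : ℝ) ^ k := by
    rw [← sq_abs, show (4 : ℝ) = 2 ^ 2 by norm_num, ← pow_mul, mul_comm, pow_mul]
    gcongr
  have h3 : (1 : ℝ) ≤ 4 ^ k := one_le_pow₀ (by norm_num)
  unfold weight wConst
  nlinarith [sq_nonneg (2 * Real.pi)]

/-- A sequence is of order `θ < 1` if it is approximated at the rate `2^{-kθ}` in `ℓ²` by sequences
whose `H¹` norms grow like `2^{k(1-θ)}`. -/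
theorem sobSq_le_of_approx (h0 : 0 ≤ θ) (h1 : θ < 1) (d : ℤ → ℂ) (G : ℕ → ℤ → ℂ) :
    sobSq θ d ≤ ENNReal.ofReal (2 * (4 * wConst) ^ θ) *
      (∑' k : ℕ, ENNReal.ofReal ((4 ^ θ) ^ k) * sobSq 0 (fun n => d n - G k n)
        + ∑' k : ℕ, ENNReal.ofReal ((4 ^ (θ - 1)) ^ k) * sobSq 1 (G k)) := by
  have hW := wConst_pos
  have hW1 : 1 ≤ wConst := by unfold wConst; nlinarith [sq_nonneg (2 * Real.pi)]
  have key : ∀ n, ENNReal.ofReal (weight n ^ θ * ‖d n‖ ^ 2) ≤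
      ENNReal.ofReal (2 * (4 * wConst) ^ θ) *
      (∑' k : ℕ, ENNReal.ofReal ((4 ^ θ) ^ k) *
          ENNReal.ofReal (weight n ^ (0 : ℝ) * ‖d n - G k n‖ ^ 2)
        + ∑' k : ℕ, ENNReal.ofReal ((4 ^ (θ - 1)) ^ k) *
          ENNReal.ofReal (weight n ^ (1 : ℝ) * ‖G k n‖ ^ 2)) := by
    intro n
    have hw := weight_pos n
    obtain ⟨k, hk1, hk2⟩ : ∃ k : ℕ, (4 : ℝ) ^ k ≤ weight n ∧ weight n ≤ 4 * wConst * 4 ^ k := by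
      rcases eq_or_ne n 0 with rfl | hn
      · refine ⟨0, by simp [weight], ?_⟩
        simp only [weight, Int.cast_zero, mul_zero, pow_zero, mul_one]
        linarith
      · refine ⟨Nat.log 2 n.natAbs, four_pow_le_weight
          (Nat.pow_log_le_self 2 (Int.natAbs_ne_zero.2 hn)), ?_⟩
        have := weight_le_four_pow (Nat.lt_pow_succ_log_self (b := 2) (by norm_num) n.natAbs).le
        rw [pow_succ] at this
        linarith
    have e1 := ENNReal.le_tsum (f := fun k : ℕ => ENNReal.ofReal ((4 ^ θ) ^ k) *
          ENNReal.ofReal (weight n ^ (0 : ℝ) * ‖d n - G k n‖ ^ 2)) k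
    have e2 := ENNReal.le_tsum (f := fun k : ℕ => ENNReal.ofReal ((4 ^ (θ - 1)) ^ k) *
          ENNReal.ofReal (weight n ^ (1 : ℝ) * ‖G k n‖ ^ 2)) k
    refine le_trans ?_ (mul_le_mul_right (add_le_add e1 e2) _)
    rw [← ENNReal.ofReal_mul (by positivity), ← ENNReal.ofReal_mul (by positivity),
      ← ENNReal.ofReal_add (by positivity) (by positivity), ← ENNReal.ofReal_mul (by positivity)]
    refine ENNReal.ofReal_le_ofReal ?_
    rw [rpow_pow_comm, rpow_pow_comm, Real.rpow_zero, one_mul, Real.rpow_one]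
    have h4 : (0 : ℝ) < 4 ^ k := by positivity
    have i1 : weight n ^ θ ≤ (4 * wConst) ^ θ * (4 ^ k) ^ θ := by
      rw [← Real.mul_rpow (by positivity) h4.le]
      exact Real.rpow_le_rpow hw.le hk2 h0
    have i2 : weight n ^ θ ≤ (4 * wConst) ^ θ * ((4 ^ k) ^ (θ - 1) * weight n) := by
      have j1 : weight n ^ (θ - 1) ≤ (4 ^ k) ^ (θ - 1) :=
        Real.rpow_le_rpow_of_nonpos h4 hk1 (by linarith)
      have j2 : weight n ^ θ = weight n ^ (θ - 1) * weight n := by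
        rw [← Real.rpow_add_one hw.ne']; ring_nf
      have j3 : 1 ≤ (4 * wConst) ^ θ := Real.one_le_rpow (by linarith) h0
      rw [j2]
      calc weight n ^ (θ - 1) * weight n ≤ (4 ^ k) ^ (θ - 1) * weight n := by gcongr
        _ ≤ _ := le_mul_of_one_le_left (by positivity) j3
    have i3 : ‖d n‖ ^ 2 ≤ 2 * (‖d n - G k n‖ ^ 2 + ‖G k n‖ ^ 2) := by
      have : ‖d n‖ ≤ ‖d n - G k n‖ + ‖G k n‖ := by
        simpa using norm_add_le (d n - G k n) (G k n)
      nlinarith [sq_nonneg (‖d n - G k n‖ - ‖G k n‖), norm_nonneg (d n)]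
    calc weight n ^ θ * ‖d n‖ ^ 2
        ≤ weight n ^ θ * (2 * (‖d n - G k n‖ ^ 2 + ‖G k n‖ ^ 2)) := by gcongr
      _ = 2 * (weight n ^ θ * ‖d n - G k n‖ ^ 2) + 2 * (weight n ^ θ * ‖G k n‖ ^ 2) := by ring
      _ ≤ 2 * (((4 * wConst) ^ θ * (4 ^ k) ^ θ) * ‖d n - G k n‖ ^ 2)
          + 2 * (((4 * wConst) ^ θ * ((4 ^ k) ^ (θ - 1) * weight n)) * ‖G k n‖ ^ 2) := by gcongr
      _ = _ := by ring
  refine (ENNReal.tsum_le_tsum key).trans ?_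
  rw [ENNReal.tsum_mul_left, ENNReal.tsum_add, ENNReal.tsum_comm]
  nth_rw 2 [ENNReal.tsum_comm]
  simp_rw [ENNReal.tsum_mul_left]
  exact le_rfl

/-- The rate of approximation of a function in `H^θ`, `θ > 0`, by its truncations. -/
theorem tsum_sobSq_sub_trunc_le (h0 : 0 < θ) (c : ℤ → ℂ) :
    ∑' k : ℕ, ENNReal.ofReal ((4 ^ θ) ^ k) * sobSq 0 (fun n => c n - truncSeq k c n)
      ≤ ENNReal.ofReal (4 ^ θ / (4 ^ θ - 1)) * sobSq θ c := by
  have hq : 1 < (4 : ℝ) ^ θ := Real.one_lt_rpow (by norm_num) h0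
  simp_rw [sobSq, ← ENNReal.tsum_mul_left]
  rw [ENNReal.tsum_comm]
  refine ENNReal.tsum_le_tsum fun n => ?_
  have hw := weight_pos n
  have hz : ∀ k : ℕ, n.natAbs < 2 ^ k → ENNReal.ofReal ((4 ^ θ) ^ k) *
      ENNReal.ofReal (weight n ^ (0 : ℝ) * ‖c n - truncSeq k c n‖ ^ 2) = 0 := fun k hk => by
    simp [truncSeq, hk]
  set L := Nat.log 2 n.natAbs
  rw [tsum_eq_sum (s := Finset.range (L + 1))]
  · rcases eq_or_ne n 0 with rfl | hn
    · rw [Finset.sum_eq_zero fun k _ => hz k (by simp)]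
      exact zero_le
    have hL := Nat.pow_log_le_self 2 (Int.natAbs_ne_zero.2 hn)
    calc ∑ k ∈ Finset.range (L + 1), ENNReal.ofReal ((4 ^ θ) ^ k) *
          ENNReal.ofReal (weight n ^ (0 : ℝ) * ‖c n - truncSeq k c n‖ ^ 2)
        ≤ ∑ k ∈ Finset.range (L + 1), ENNReal.ofReal ((4 ^ θ) ^ k * ‖c n‖ ^ 2) := by
          refine Finset.sum_le_sum fun k _ => ?_
          rw [← ENNReal.ofReal_mul (by positivity), Real.rpow_zero, one_mul]
          refine ENNReal.ofReal_le_ofReal ?_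
          gcongr
          unfold truncSeq
          split_ifs <;> simp
      _ = ENNReal.ofReal (∑ k ∈ Finset.range (L + 1), (4 ^ θ) ^ k * ‖c n‖ ^ 2) :=
          (ENNReal.ofReal_sum_of_nonneg fun k _ => by positivity).symm
      _ ≤ ENNReal.ofReal (4 ^ θ / (4 ^ θ - 1) * (weight n ^ θ * ‖c n‖ ^ 2)) := by
          refine ENNReal.ofReal_le_ofReal ?_
          rw [← Finset.sum_mul, geom_sum_eq hq.ne', ← mul_assoc]
          gcongr
          rw [div_mul_eq_mul_div, div_le_div_iff_of_pos_right (by linarith), pow_succ,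
            rpow_pow_comm, mul_comm]
          have : ((4 : ℝ) ^ L) ^ θ ≤ weight n ^ θ :=
            Real.rpow_le_rpow (by positivity) (four_pow_le_weight hL) h0.le
          nlinarith
      _ = _ := ENNReal.ofReal_mul (by
          have : 0 < (4 : ℝ) ^ θ - 1 := by linarith
          positivity)
  · intro k hk
    refine hz k ?_
    have : L + 1 ≤ k := by simpa using hk
    exact (Nat.lt_pow_succ_log_self (by norm_num) _).trans_le (Nat.pow_le_pow_right (by norm_num) this)

/-- The growth of the `H¹` norms of the truncations of a function in `H^θ`, `θ < 1`. -/
theorem tsum_sobSq_trunc_le (h1 : θ < 1) (c : ℤ → ℂ) :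
    ∑' k : ℕ, ENNReal.ofReal ((4 ^ (θ - 1)) ^ k) * sobSq 1 (truncSeq k c)
      ≤ ENNReal.ofReal (wConst ^ (1 - θ) / (1 - 4 ^ (θ - 1))) * sobSq θ c := by
  have hW := wConst_pos
  have hq : (4 : ℝ) ^ (θ - 1) < 1 := Real.rpow_lt_one_of_one_lt_of_neg (by norm_num) (by linarith)
  have hq0 : 0 < (4 : ℝ) ^ (θ - 1) := by positivity
  have hq1 : 0 < 1 - (4 : ℝ) ^ (θ - 1) := by linarith
  simp_rw [sobSq, ← ENNReal.tsum_mul_left]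
  rw [ENNReal.tsum_comm]
  refine ENNReal.tsum_le_tsum fun n => ?_
  have hw := weight_pos n
  set k₀ := Nat.size n.natAbs
  have hsupp : Function.support (fun k : ℕ => ENNReal.ofReal ((4 ^ (θ - 1)) ^ k) *
      ENNReal.ofReal (weight n ^ (1 : ℝ) * ‖truncSeq k c n‖ ^ 2)) ⊆ range (fun j => j + k₀) := by
    intro k hk
    by_contra hcon
    refine hk ?_
    have : ¬ k₀ ≤ k := fun h => hcon ⟨k - k₀, by simp [h]⟩
    have h2 : ¬ n.natAbs < 2 ^ k := fun h => this (Nat.size_le.2 h)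
    simp [truncSeq, h2]
  rw [← (add_left_injective k₀).tsum_eq hsupp]
  have hk₀ : weight n ≤ wConst * 4 ^ k₀ := weight_le_four_pow (Nat.lt_size_self _).le
  have hk1 : ((4 : ℝ) ^ k₀) ^ (θ - 1) ≤ wConst ^ (1 - θ) * weight n ^ (θ - 1) := by
    have : ((4 : ℝ) ^ k₀) ^ (θ - 1) ≤ (weight n / wConst) ^ (θ - 1) :=
      Real.rpow_le_rpow_of_nonpos (by positivity)
        (by rw [div_le_iff₀ hW]; linarith) (by linarith)
    refine this.trans (le_of_eq ?_)
    rw [Real.div_rpow hw.le hW.le, show 1 - θ = -(θ - 1) by ring, Real.rpow_neg hW.le]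
    ring
  calc ∑' j : ℕ, ENNReal.ofReal ((4 ^ (θ - 1)) ^ (j + k₀)) *
        ENNReal.ofReal (weight n ^ (1 : ℝ) * ‖truncSeq (j + k₀) c n‖ ^ 2)
      ≤ ∑' j : ℕ, ENNReal.ofReal ((wConst ^ (1 - θ) * (weight n ^ θ * ‖c n‖ ^ 2)) *
          (4 ^ (θ - 1)) ^ j) := by
        refine ENNReal.tsum_le_tsum fun j => ?_
        rw [← ENNReal.ofReal_mul (by positivity)]
        refine ENNReal.ofReal_le_ofReal ?_
        have e1 : ‖truncSeq (j + k₀) c n‖ ^ 2 ≤ ‖c n‖ ^ 2 := by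
          unfold truncSeq
          split_ifs <;> simp
        have e2 : weight n ^ θ = weight n ^ (θ - 1) * weight n := by
          rw [← Real.rpow_add_one hw.ne']; ring_nf
        rw [pow_add, rpow_pow_comm k₀, Real.rpow_one, e2]
        calc (4 ^ (θ - 1)) ^ j * (4 ^ k₀) ^ (θ - 1) * (weight n * ‖truncSeq (j + k₀) c n‖ ^ 2)
            ≤ (4 ^ (θ - 1)) ^ j * (wConst ^ (1 - θ) * weight n ^ (θ - 1)) *
              (weight n * ‖c n‖ ^ 2) := by gcongr
          _ = _ := by ring
    _ = ENNReal.ofReal ((wConst ^ (1 - θ) * (weight n ^ θ * ‖c n‖ ^ 2)) *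
          (1 - 4 ^ (θ - 1))⁻¹) := by
        rw [← tsum_geometric_of_lt_one hq0.le hq, ← tsum_mul_left, ENNReal.ofReal_tsum_of_nonneg]
        · intro j; positivity
        · exact (summable_geometric_of_lt_one hq0.le hq).mul_left _
    _ = _ := by
        rw [← ENNReal.ofReal_mul (by positivity)]
        congr 1
        ring

/-- The truncation to frequencies `|n| < 2^k` is infinitely smoothing, with a constant that depends
on `k`. -/
theorem isSymbol_trunc (a b : ℝ) (k : ℕ) :
    IsSymbol a b ((wConst * 4 ^ k) ^ |b - a|) (truncSeq k fun _ => 1) where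
  nonneg := by have := wConst_pos; positivity
  conj_symm n := by simp [truncSeq]
  bound n := by
    have hw := weight_pos n
    have hW := wConst_pos
    have hW1 : 1 ≤ wConst := by unfold wConst; nlinarith [sq_nonneg (2 * Real.pi)]
    have h4 : (1 : ℝ) ≤ 4 ^ k := one_le_pow₀ (by norm_num)
    unfold truncSeq
    split_ifs with h
    · rw [norm_one, one_pow, mul_one]
      have e1 : weight n ^ (b - a) ≤ (wConst * 4 ^ k) ^ |b - a| :=
        (Real.rpow_le_rpow_of_exponent_le (one_le_weight n) (le_abs_self _)).trans
          (Real.rpow_le_rpow hw.le (weight_le_four_pow h.le) (abs_nonneg _))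
      have e2 : 1 ≤ (wConst * 4 ^ k) ^ |b - a| :=
        Real.one_le_rpow (by nlinarith) (abs_nonneg _)
      calc weight n ^ b = weight n ^ (b - a) * weight n ^ a := by
            rw [← Real.rpow_add hw]; ring_nf
        _ ≤ (wConst * 4 ^ k) ^ |b - a| * weight n ^ a := by gcongr
        _ ≤ ((wConst * 4 ^ k) ^ |b - a|) ^ 2 * weight n ^ a := by gcongr; nlinarith
    · simp; positivity

/-- The truncation of a function to frequencies `|n| < 2^k`, with values in any `H^b`. -/
def trunc {a b : ℝ} (hb : 0 ≤ b) (k : ℕ) : Hs a →L[ℝ] Hs b := mult hb (isSymbol_trunc a b k)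

@[simp] theorem hat_trunc {a b : ℝ} (hb : 0 ≤ b) (k : ℕ) (f : Hs a) (n : ℤ) :
    (trunc (b := b) hb k f).hat n = truncSeq k f.hat n := by
  rw [trunc, hat_mult]
  simp [truncSeq]

theorem tendsto_trunc {a : ℝ} (ha : 0 ≤ a) (f : Hs a) :
    Tendsto (fun k => trunc (b := a) ha k f) atTop (𝓝 f) := by
  have h1 : Tendsto (fun k => ∑' n, weight n ^ a * ‖truncSeq k f.hat n - f.hat n‖ ^ 2) atTop
      (𝓝 (∑' _ : ℤ, (0 : ℝ))) := by
    refine tendsto_tsum_of_dominated_convergence f.summable (fun n => ?_)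
      (Eventually.of_forall fun k n => ?_)
    · refine tendsto_const_nhds.congr' ?_
      filter_upwards [eventually_ge_atTop (Nat.size n.natAbs)] with k hk
      simp [truncSeq, Nat.size_le.1 hk]
    · have := weight_pos n
      rw [Real.norm_of_nonneg (by positivity)]
      gcongr
      unfold truncSeq
      split_ifs <;> simp
  rw [tsum_zero] at h1
  rw [tendsto_iff_norm_sub_tendsto_zero]
  have h2 := h1.sqrt
  rw [Real.sqrt_zero] at h2
  refine h2.congr fun k => ?_
  rw [← Real.sqrt_sq (norm_nonneg (trunc ha k f - f)), Hs.norm_sq_hat]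
  congr 1
  exact tsum_congr fun n => by simp

/-! ### Inverses in the algebra `H^θ` -/

theorem mulL2_mulL2 (φ ψ : C(Circ, ℝ)) (f : L2) : mulL2 φ (mulL2 ψ f) = mulL2 (φ * ψ) f := by
  refine Lp.ext ?_
  filter_upwards [mulL2_ae φ (mulL2 ψ f), mulL2_ae ψ f, mulL2_ae (φ * ψ) f] with x h1 h2 h3
  rw [h1, h2, h3, ContinuousMap.mul_apply, mul_assoc]

theorem mulL2_one (f : L2) : mulL2 1 f = f := by
  refine Lp.ext ?_
  filter_upwards [mulL2_ae 1 f] with x h1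
  rw [h1, ContinuousMap.one_apply, one_mul]

theorem norm_mulL2_le (φ : C(Circ, ℝ)) (f : L2) : ‖mulL2 φ f‖ ≤ ‖φ‖ * ‖f‖ := by
  refine Lp.norm_le_mul_norm_of_ae_le_mul ?_
  filter_upwards [mulL2_ae φ f] with x hx
  rw [hx, norm_mul]
  gcongr
  exact φ.norm_coe_le_norm x

theorem WD.sobSq_one {f g : L2} (h : WD f g) :
    sobSq 1 (coeff f) = ENNReal.ofReal (‖f‖ ^ 2 + ‖g‖ ^ 2) := by
  rw [ENNReal.ofReal_add (by positivity) (by positivity), ← sobSq_zero, ← sobSq_zero, sobSq, sobSq,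
    sobSq, ← ENNReal.tsum_add]
  refine tsum_congr fun n => ?_
  rw [← ENNReal.ofReal_add (by simp) (by simp), h n]
  congr 1
  rw [norm_mul, mul_pow, norm_dSym_sq, Real.rpow_zero, Real.rpow_one, weight]
  ring

theorem ofReal_norm_sub_sq (f g : L2) :
    sobSq 0 (fun n => coeff f n - coeff g n) = ENNReal.ofReal (‖f - g‖ ^ 2) := by
  rw [← sobSq_zero]
  congr 1
  funext n
  rw [← coeffCLM_apply n (f - g), map_sub]
  rfl

/-- The pointwise inverse of a continuous function without zeros. -/
def invC (φ : C(Circ, ℝ)) (h : ∀ x, φ x ≠ 0) : C(Circ, ℝ) :=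
  ⟨fun x => (φ x)⁻¹, φ.continuous.inv₀ h⟩

theorem invC_mul (φ : C(Circ, ℝ)) (h : ∀ x, φ x ≠ 0) : invC φ h * φ = 1 := by
  ext x; exact inv_mul_cancel₀ (h x)

theorem IsC1.inv {φ ψ : C(Circ, ℝ)} (h : IsC1 φ ψ) (h0 : ∀ x, φ x ≠ 0) :
    IsC1 (invC φ h0) (-(invC φ h0 * invC φ h0 * ψ)) := fun x => by
  refine ((h x).inv (h0 x)).congr_deriv ?_
  simp only [ContinuousMap.neg_apply, ContinuousMap.mul_apply, invC, ContinuousMap.coe_mk]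
  have := h0 x
  field_simp

/-- If `f ∈ H^θ` has no zeros, its truncations are eventually bounded below uniformly. -/
theorem exists_trunc_inv [hθ : Fact (1 / 2 < θ)] (f : Hs θ) (h0 : ∀ x, toC f x ≠ 0) :
    ∃ M : ℝ, 0 ≤ M ∧ ‖invC (toC f) h0‖ ≤ M ∧ ∃ k₀ : ℕ, ∀ k ≥ k₀,
      ∃ h : ∀ x, toC (trunc (b := θ) (half_lt_nonneg hθ) k f) x ≠ 0,
      ‖invC (toC (trunc (b := θ) (half_lt_nonneg hθ) k f)) h‖ ≤ M := by
  set ψ := invC (toC f) h0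
  refine ⟨2 * (‖ψ‖ + 1), by positivity, by linarith [norm_nonneg ψ], ?_⟩
  have ht := (toC.continuous.tendsto f).comp (tendsto_trunc (half_lt_nonneg hθ) f)
  have hε : 0 < 1 / (2 * (‖ψ‖ + 1)) := by positivity
  obtain ⟨k₀, hk₀⟩ := (Metric.tendsto_atTop.1 ht) _ hε
  refine ⟨k₀, fun k hk => ?_⟩
  have hd : ∀ x, |toC (trunc (b := θ) (half_lt_nonneg hθ) k f) x - toC f x|
      ≤ 1 / (2 * (‖ψ‖ + 1)) := fun x =>
    (ContinuousMap.dist_apply_le_dist (f := toC (trunc (b := θ) (half_lt_nonneg hθ) k f))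
      (g := toC f) x).trans (hk₀ k hk).le
  have hlow : ∀ x, 1 / (‖ψ‖ + 1) ≤ |toC f x| := fun x => by
    have h1 : |toC f x|⁻¹ ≤ ‖ψ‖ := by
      rw [← abs_inv]; exact ψ.norm_coe_le_norm x
    have h2 : 0 < |toC f x| := abs_pos.2 (h0 x)
    rw [inv_le_iff_one_le_mul₀ h2] at h1
    rw [div_le_iff₀ (by positivity)]
    nlinarith
  have hlow2 : ∀ x, 1 / (2 * (‖ψ‖ + 1)) ≤ |toC (trunc (b := θ) (half_lt_nonneg hθ) k f) x| := by
    intro x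
    have h1 := abs_sub_abs_le_abs_sub (toC f x) (toC (trunc (b := θ) (half_lt_nonneg hθ) k f) x)
    rw [abs_sub_comm] at h1
    have h2 := hd x
    have h3 := hlow x
    have h4 : 1 / (‖ψ‖ + 1) = 2 * (1 / (2 * (‖ψ‖ + 1))) := by field_simp
    linarith
  refine ⟨fun x => abs_pos.1 (hε.trans_le (hlow2 x)), ?_⟩
  rw [ContinuousMap.norm_le _ (by positivity)]
  intro x
  change |(toC (trunc (b := θ) (half_lt_nonneg hθ) k f) x)⁻¹| ≤ _
  rw [abs_inv, inv_le_comm₀ (hε.trans_le (hlow2 x)) (by positivity)]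
  refine le_trans ?_ (hlow2 x)
  rw [one_div]

/-- Inverses in `H^θ` for `1/2 < θ < 1`, by approximation with the inverses of truncations. -/
theorem exists_inv_of_lt_one [hθ : Fact (1 / 2 < θ)] (h1 : θ < 1) (f : Hs θ)
    (h0 : ∀ x, toC f x ≠ 0) : ∃ h : Hs θ, h.toL2 = ofC (invC (toC f) h0) := by
  have hθ0 := half_lt_nonneg hθ
  obtain ⟨M, hM, hM1, k₀, hk₀⟩ := exists_trunc_inv f h0
  set ψ := invC (toC f) h0
  -- the approximants are the inverses of the truncations at frequency `2^{k + k₀}`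
  choose hne hMk using hk₀
  let φ : ∀ k : ℕ, C(Circ, ℝ) := fun k =>
    invC (toC (trunc (b := θ) hθ0 (k + k₀) f)) (hne (k + k₀) (by omega))
  have hφM : ∀ k, ‖φ k‖ ≤ M := fun k => hMk (k + k₀) (by omega)
  have hφ1 : ∀ k, φ k * toC (trunc (b := θ) hθ0 (k + k₀) f) = 1 := fun k => invC_mul _ _
  have hψ1 : ψ * toC f = 1 := invC_mul _ _
  have hψM : ‖ψ‖ ≤ M := hM1
  have hA : ∀ k, sobSq 0 (fun n => coeff (ofC ψ) n - coeff (ofC (φ k)) n) ≤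
      ENNReal.ofReal ((M ^ 2) ^ 2) *
        sobSq 0 (fun n => f.hat n - truncSeq (k + k₀) f.hat n) := by
    intro k
    have e0 : sobSq 0 (fun n => f.hat n - truncSeq (k + k₀) f.hat n)
        = ENNReal.ofReal (‖f.toL2 - (trunc (b := θ) hθ0 (k + k₀) f).toL2‖ ^ 2) := by
      rw [← ofReal_norm_sub_sq]
      congr 1
      funext n
      rw [← hat_trunc (b := θ) hθ0]
      rfl
    rw [e0, ofReal_norm_sub_sq, ← ENNReal.ofReal_mul (by positivity), ← mul_pow]
    refine ENNReal.ofReal_le_ofReal ?_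
    gcongr
    have e1 : ofC ψ - ofC (φ k)
        = -mulL2 (ψ * φ k) (f.toL2 - (trunc (b := θ) hθ0 (k + k₀) f).toL2) := by
      rw [← ofC_toC f, ← ofC_toC (trunc (b := θ) hθ0 (k + k₀) f), map_sub, mulL2_ofC, mulL2_ofC,
        ← map_sub, ← map_sub, ← map_neg]
      congr 1
      linear_combination φ k * hψ1 - ψ * hφ1 k
    rw [e1, norm_neg]
    refine (norm_mulL2_le _ _).trans ?_
    gcongr
    calc ‖ψ * φ k‖ ≤ ‖ψ‖ * ‖φ k‖ := norm_mul_le _ _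
      _ ≤ M * M := by gcongr; exact hφM k
      _ = M ^ 2 := by ring
  have hB : ∀ k, sobSq 1 (coeff (ofC (φ k))) ≤
      ENNReal.ofReal ((M ^ 2) ^ 2) * sobSq 1 (truncSeq (k + k₀) f.hat) := by
    intro k
    have : Fact ((1 : ℝ) / 2 < 2) := ⟨by norm_num⟩
    have : Fact ((1 : ℝ) / 2 < 1) := ⟨by norm_num⟩
    set S : Hs 2 := trunc (b := 2) zero_le_two (k + k₀) f with hS
    have hST : toC S = toC (trunc (b := θ) hθ0 (k + k₀) f) := by
      refine ofC_injective ?_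
      rw [ofC_toC, ofC_toC]
      exact L2_ext fun n => by
        change S.hat n = (trunc (b := θ) hθ0 (k + k₀) f).hat n
        rw [hS, hat_trunc, hat_trunc]
    have hS1 := isC1_toC (a := 2) (b := 1) zero_le_one (by norm_num) S
    have hφS : φ k * toC S = 1 := by rw [hST]; exact hφ1 k
    have hc : IsC1 (φ k) (-(φ k * φ k * toC (derivH (b := 1) zero_le_one (by norm_num) S))) := by
      have hne' : ∀ x, toC S x ≠ 0 := by rw [hST]; exact hne (k + k₀) (by omega)
      have := hS1.inv hne'
      have e : invC (toC S) hne' = φ k := by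
        ext x
        change (toC S x)⁻¹ = (toC (trunc (b := θ) hθ0 (k + k₀) f) x)⁻¹
        rw [hST]
      rwa [e] at this
    have e1 : sobSq 1 (truncSeq (k + k₀) f.hat)
        = ENNReal.ofReal (‖ofC (toC S)‖ ^ 2
          + ‖ofC (toC (derivH (b := 1) zero_le_one (by norm_num) S))‖ ^ 2) := by
      rw [← hS1.WD.sobSq_one, ofC_toC]
      congr 1
      funext n
      exact (hat_trunc (b := 2) zero_le_two (k + k₀) f n).symm
    rw [e1, hc.WD.sobSq_one, ← ENNReal.ofReal_mul (by positivity)]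
    refine ENNReal.ofReal_le_ofReal ?_
    have hMM : ‖φ k * φ k‖ ≤ M ^ 2 := by
      calc ‖φ k * φ k‖ ≤ ‖φ k‖ * ‖φ k‖ := norm_mul_le _ _
        _ ≤ M * M := by gcongr <;> exact hφM k
        _ = M ^ 2 := by ring
    have e2 : ofC (φ k) = mulL2 (φ k * φ k) (ofC (toC S)) := by
      rw [mulL2_ofC]
      congr 1
      linear_combination -φ k * hφS
    have i1 : ‖ofC (φ k)‖ ≤ M ^ 2 * ‖ofC (toC S)‖ := by
      rw [e2]
      exact (norm_mulL2_le _ _).trans (by gcongr)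
    have i2 : ‖ofC (-(φ k * φ k * toC (derivH (b := 1) zero_le_one (by norm_num) S)))‖
        ≤ M ^ 2 * ‖ofC (toC (derivH (b := 1) zero_le_one (by norm_num) S))‖ := by
      rw [map_neg, norm_neg, ← mulL2_ofC]
      exact (norm_mulL2_le _ _).trans (by gcongr)
    rw [mul_add, ← mul_pow, ← mul_pow]
    gcongr
  have hfin : sobSq θ (coeff (ofC ψ)) ≠ ⊤ := by
    refine ne_top_of_le_ne_top ?_
      (sobSq_le_of_approx hθ0 h1 (coeff (ofC ψ)) fun k => coeff (ofC (φ k)))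
    have hq : 1 ≤ (4 : ℝ) ^ θ := Real.one_le_rpow (by norm_num) hθ0
    have hfs : sobSq θ f.hat ≠ ⊤ := by rw [Hs.sobSq_hat]; exact ENNReal.ofReal_ne_top
    refine ENNReal.mul_ne_top ENNReal.ofReal_ne_top (ENNReal.add_ne_top.2 ⟨?_, ?_⟩)
    · have hle : ∑' k : ℕ, ENNReal.ofReal ((4 ^ θ) ^ k) *
          sobSq 0 (fun n => coeff (ofC ψ) n - coeff (ofC (φ k)) n) ≤
          ENNReal.ofReal ((M ^ 2) ^ 2) * ∑' k : ℕ, ENNReal.ofReal ((4 ^ θ) ^ k) *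
            sobSq 0 (fun n => f.hat n - truncSeq k f.hat n) := by
        rw [← ENNReal.tsum_mul_left]
        refine le_trans ?_ (ENNReal.tsum_comp_le_tsum_of_injective (add_left_injective k₀) _)
        refine ENNReal.tsum_le_tsum fun k => ?_
        calc _ ≤ ENNReal.ofReal ((4 ^ θ) ^ (k + k₀)) * (ENNReal.ofReal ((M ^ 2) ^ 2) *
                sobSq 0 (fun n => f.hat n - truncSeq (k + k₀) f.hat n)) := by
              gcongr
              · exact Nat.le_add_right _ _
              · exact hA k
          _ = _ := by ring
      refine ne_top_of_le_ne_top (ENNReal.mul_ne_top ENNReal.ofReal_ne_top ?_) hle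
      exact ne_top_of_le_ne_top (ENNReal.mul_ne_top ENNReal.ofReal_ne_top hfs)
        (tsum_sobSq_sub_trunc_le (by linarith [hθ.out]) f.hat)
    · have hle : ∑' k : ℕ, ENNReal.ofReal ((4 ^ (θ - 1)) ^ k) * sobSq 1 (coeff (ofC (φ k))) ≤
          ENNReal.ofReal ((M ^ 2) ^ 2 * ((4 ^ (θ - 1)) ^ k₀)⁻¹) *
            ∑' k : ℕ, ENNReal.ofReal ((4 ^ (θ - 1)) ^ k) * sobSq 1 (truncSeq k f.hat) := by
        rw [← ENNReal.tsum_mul_left]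
        refine le_trans ?_ (ENNReal.tsum_comp_le_tsum_of_injective (add_left_injective k₀) _)
        refine ENNReal.tsum_le_tsum fun k => ?_
        calc _ ≤ ENNReal.ofReal ((4 ^ (θ - 1)) ^ k) * (ENNReal.ofReal ((M ^ 2) ^ 2) *
                sobSq 1 (truncSeq (k + k₀) f.hat)) := by
              gcongr
              exact hB k
          _ = _ := by
              rw [← mul_assoc, ← mul_assoc, ← ENNReal.ofReal_mul (by positivity),
                ← ENNReal.ofReal_mul (by positivity)]
              congr 2
              rw [pow_add]
              have : (((4 : ℝ) ^ (θ - 1)) ^ k₀) ≠ 0 := by positivity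
              field_simp
      refine ne_top_of_le_ne_top (ENNReal.mul_ne_top ENNReal.ofReal_ne_top ?_) hle
      exact ne_top_of_le_ne_top (ENNReal.mul_ne_top ENNReal.ofReal_ne_top hfs)
        (tsum_sobSq_trunc_le h1 f.hat)
  exact ⟨Hs.ofL2 _ hfin, rfl⟩

/-- The weak derivative of the inverse of a function in `H^θ`, `θ ≥ 1`. -/
theorem WD_invC [hθ : Fact (1 / 2 < θ)] (h1 : 0 + 1 ≤ θ) (f : Hs θ) (h0 : ∀ x, toC f x ≠ 0) :
    WD (ofC (invC (toC f) h0))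
      (-mulL2 (invC (toC f) h0 * invC (toC f) h0) (derivH (b := 0) le_rfl h1 f).toL2) := by
  have hθ0 := half_lt_nonneg hθ
  have : Fact ((1 : ℝ) / 2 < 2) := ⟨by norm_num⟩
  have : Fact ((1 : ℝ) / 2 < 1) := ⟨by norm_num⟩
  obtain ⟨M, hM, hM1, k₀, hk₀⟩ := exists_trunc_inv f h0
  set ψ := invC (toC f) h0
  choose hne hMk using hk₀
  have ht0 := (tendsto_add_atTop_iff_nat k₀).2 (tendsto_trunc hθ0 f)
  have htC := (toC.continuous.tendsto f).comp ht0
  let φ : ∀ k : ℕ, C(Circ, ℝ) := fun k =>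
    invC (toC (trunc (b := θ) hθ0 (k + k₀) f)) (hne (k + k₀) (by omega))
  have hφM : ∀ k, ‖φ k‖ ≤ M := fun k => hMk (k + k₀) (by omega)
  have hφ1 : ∀ k, φ k * toC (trunc (b := θ) hθ0 (k + k₀) f) = 1 := fun k => invC_mul _ _
  have hψ1 : ψ * toC f = 1 := invC_mul _ _
  have htφ : Tendsto φ atTop (𝓝 ψ) := by
    rw [tendsto_iff_norm_sub_tendsto_zero] at htC ⊢
    have h2 := htC.const_mul (M * M)
    rw [mul_zero] at h2
    refine squeeze_zero (fun _ => norm_nonneg _) (fun k => ?_) h2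
    have e : φ k - ψ
        = -(φ k * ψ * (toC (trunc (b := θ) hθ0 (k + k₀) f) - toC f)) := by
      linear_combination ψ * hφ1 k - φ k * hψ1
    rw [e, norm_neg]
    refine (norm_mul_le _ _).trans ?_
    have : ‖φ k * ψ‖ ≤ M * M := (norm_mul_le _ _).trans (by gcongr; exact hφM k)
    exact mul_le_mul_of_nonneg_right this (norm_nonneg _)
  have hwd : ∀ k, WD (ofC (φ k)) (-mulL2 (φ k * φ k)
      (derivH (b := 0) le_rfl h1 (trunc (b := θ) hθ0 (k + k₀) f)).toL2) := by
    intro k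
    set S : Hs 2 := trunc (b := 2) zero_le_two (k + k₀) f with hS
    have hShat : ∀ n, S.hat n = (trunc (b := θ) hθ0 (k + k₀) f).hat n := fun n => by
      rw [hS, hat_trunc, hat_trunc]
    have hST : toC S = toC (trunc (b := θ) hθ0 (k + k₀) f) := by
      refine ofC_injective ?_
      rw [ofC_toC, ofC_toC]
      exact L2_ext hShat
    have hS1 := isC1_toC (a := 2) (b := 1) zero_le_one (by norm_num) S
    have hne' : ∀ x, toC S x ≠ 0 := by rw [hST]; exact hne (k + k₀) (by omega)
    have e : invC (toC S) hne' = φ k := by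
      ext x
      change (toC S x)⁻¹ = (toC (trunc (b := θ) hθ0 (k + k₀) f) x)⁻¹
      rw [hST]
    have h2 := (hS1.inv hne').WD
    rw [e, map_neg, ← mulL2_ofC, ofC_toC] at h2
    have e3 : (derivH (b := 1) zero_le_one (by norm_num) S).toL2
        = (derivH (b := 0) le_rfl h1 (trunc (b := θ) hθ0 (k + k₀) f)).toL2 := by
      refine L2_ext fun n => ?_
      change (derivH (b := 1) zero_le_one (by norm_num) S).hat n
        = (derivH (b := 0) le_rfl h1 (trunc (b := θ) hθ0 (k + k₀) f)).hat n
      rw [hat_derivH, hat_derivH, hShat]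
    rwa [e3] at h2
  refine WD.of_tendsto hwd ((ofC.continuous.tendsto _).comp htφ) ?_
  have ht2 := ((toL2CLM (a := 0) le_rfl).continuous.tendsto _).comp
    (((derivH (b := 0) le_rfl h1).continuous.tendsto f).comp ht0)
  have ht3 : Tendsto (fun k => φ k * φ k) atTop (𝓝 (ψ * ψ)) := htφ.mul htφ
  exact ((mulL2.isBoundedBilinearMap.continuous.tendsto (_, _)).comp
    (ht3.prodMk_nhds ht2)).neg

/-- One step of the bootstrap: the inverse gains almost half a derivative. -/
theorem exists_inv_step [hθ : Fact (1 / 2 < θ)] (h1 : 0 + 1 ≤ θ) (f : Hs θ)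
    (h0 : ∀ x, toC f x ≠ 0) {a b c : ℝ} (ha : 0 ≤ a) (haθ : a + 1 ≤ θ) (hab : 1 / 2 < b - a)
    (hc : 0 ≤ c) (hca : c ≤ a + 1) (h : Hs b) (hh : h.toL2 = ofC (invC (toC f) h0)) :
    ∃ k : Hs c, k.toL2 = ofC (invC (toC f) h0) := by
  have : Fact (1 / 2 < b) := ⟨by linarith⟩
  have hhC : toC h = invC (toC f) h0 := ofC_injective (by rw [ofC_toC, hh])
  have hw := WD_invC h1 f h0
  have e : -mulL2 (invC (toC f) h0 * invC (toC f) h0) (derivH (b := 0) le_rfl h1 f).toL2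
      = (-prodH ha hab (h ⊙ h) (derivH ha haθ f)).toL2 := by
    rw [← toL2CLM_apply ha, map_neg, toL2CLM_apply, toL2_prodH, toC_mulH, hhC]
    congr 2
    exact L2_ext fun n => (hat_derivH _ _ f n).trans (hat_derivH _ _ f n).symm
  rw [e] at hw
  exact ⟨_, hw.eq_prim hc hca⟩

/-- The algebra `H^θ`, `θ > 1/2`, is closed under inversion of functions without zeros. -/
theorem exists_inv [hθ : Fact (1 / 2 < θ)] (f : Hs θ) (h0 : ∀ x, toC f x ≠ 0) :
    ∃ h : Hs θ, toC h * toC f = 1 := by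
  suffices H : ∃ h : Hs θ, h.toL2 = ofC (invC (toC f) h0) by
    obtain ⟨h, hh⟩ := H
    refine ⟨h, ?_⟩
    rw [show toC h = invC (toC f) h0 from ofC_injective (by rw [ofC_toC, hh]), invC_mul]
  rcases lt_or_ge θ 1 with h1 | h1
  · exact exists_inv_of_lt_one h1 f h0
  have key : ∀ n : ℕ, ∃ b, min θ (15 / 16 + 7 / 16 * n) = b ∧
      ∃ h : Hs b, h.toL2 = ofC (invC (toC f) h0) := by
    intro n
    induction n with
    | zero =>
      have : Fact ((1 : ℝ) / 2 < 15 / 16) := ⟨by norm_num⟩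
      refine ⟨15 / 16, by rw [min_eq_right] <;> norm_num; linarith, ?_⟩
      have hle : (15 / 16 : ℝ) ≤ θ := by linarith
      have e := toC_inclCLM (a := θ) (b := 15 / 16) (by norm_num) hle f
      have h0' : ∀ x, toC (inclCLM (b := 15 / 16) (by norm_num) hle f) x ≠ 0 := by
        rw [e]; exact h0
      obtain ⟨h, hh⟩ := exists_inv_of_lt_one (by norm_num)
        (inclCLM (b := 15 / 16) (by norm_num) hle f) h0'
      refine ⟨h, hh.trans ?_⟩
      congr 1
      ext x
      exact congrArg (fun φ : C(Circ, ℝ) => (φ x)⁻¹) e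
    | succ n ih =>
      obtain ⟨b, hb, h, hh⟩ := ih
      rcases le_or_gt θ (15 / 16 + 7 / 16 * n) with hc | hc
      · refine ⟨b, ?_, h, hh⟩
        rw [← hb, min_eq_left hc, min_eq_left]
        push_cast
        linarith
      · rw [min_eq_right hc.le] at hb
        refine ⟨_, rfl, ?_⟩
        have hn : (0 : ℝ) ≤ n := n.cast_nonneg
        have hp : 15 / 16 + 7 / 16 * ((n + 1 : ℕ) : ℝ) = b + 7 / 16 := by
          rw [← hb]
          push_cast
          ring
        have h1m : 1 ≤ min θ (15 / 16 + 7 / 16 * ((n + 1 : ℕ) : ℝ)) :=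
          le_min h1 (by push_cast; linarith)
        refine exists_inv_step (a := min θ (15 / 16 + 7 / 16 * ((n + 1 : ℕ) : ℝ)) - 1)
          (by linarith) f h0 (sub_nonneg.2 h1m)
          (by linarith [min_le_left θ (15 / 16 + 7 / 16 * ((n + 1 : ℕ) : ℝ))])
          (by linarith [min_le_right θ (15 / 16 + 7 / 16 * ((n + 1 : ℕ) : ℝ))])
          (by linarith) (sub_add_cancel _ _).ge h hh
  obtain ⟨n, hn⟩ := exists_nat_gt (16 / 7 * θ)
  obtain ⟨b, hb, h, hh⟩ := key n
  rw [min_eq_left (by linarith)] at hb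
  subst hb
  exact ⟨h, hh⟩

/-- The inverse in `H^θ` of a function without zeros (and `0` if there are zeros). -/
def invH [Fact (1 / 2 < θ)] (f : Hs θ) : Hs θ := by
  classical
  exact if h0 : ∀ x, toC f x ≠ 0 then (exists_inv f h0).choose else 0

theorem toC_invH_mul [Fact (1 / 2 < θ)] (f : Hs θ) (h0 : ∀ x, toC f x ≠ 0) :
    toC (invH f) * toC f = 1 := by
  rw [invH, dif_pos h0]
  exact (exists_inv f h0).choose_spec

theorem toC_invH_apply [Fact (1 / 2 < θ)] (f : Hs θ) (h0 : ∀ x, toC f x ≠ 0) (x : Circ) :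
    toC (invH f) x = (toC f x)⁻¹ :=
  eq_inv_of_mul_eq_one_left (congrArg (fun φ : C(Circ, ℝ) => φ x) (toC_invH_mul f h0))

/-- Inversion is continuous in `H^θ`. -/
theorem tendsto_invH [Fact (1 / 2 < θ)] {ι : Type*} {l : Filter ι} {f : ι → Hs θ} {f₀ : Hs θ}
    (hf : Tendsto f l (𝓝 f₀)) (h : ∀ i, ∀ x, toC (f i) x ≠ 0) (h0 : ∀ x, toC f₀ x ≠ 0) :
    Tendsto (fun i => invH (f i)) l (𝓝 (invH f₀)) := by
  obtain ⟨C, hC, hmul⟩ : ∃ C : ℝ, 0 ≤ C ∧ ∀ a b : Hs θ, ‖a ⊙ b‖ ≤ C * ‖a‖ * ‖b‖ :=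
    ⟨_, norm_nonneg (mulH (θ := θ)), fun a b => mulH.le_opNorm₂ a b⟩
  have e : ∀ i, invH (f i) - invH f₀ = (invH f₀ ⊙ (f₀ - f i)) ⊙ invH (f i) := fun i => by
    refine toC_injective ?_
    rw [map_sub, toC_mulH, toC_mulH, map_sub]
    linear_combination toC (invH f₀) * toC_invH_mul (f i) (h i) - toC (invH (f i)) * toC_invH_mul f₀ h0
  have hd : Tendsto (fun i => ‖f₀ - f i‖) l (𝓝 0) := by
    have := (tendsto_iff_norm_sub_tendsto_zero.1 hf)
    simpa only [norm_sub_rev] using this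
  set K := C * (C * ‖invH f₀‖)
  have hK : 0 ≤ K := by positivity
  have hle : ∀ i, ‖invH (f i) - invH f₀‖ ≤ K * ‖f₀ - f i‖ * ‖invH (f i)‖ := fun i => by
    rw [e]
    calc _ ≤ C * ‖invH f₀ ⊙ (f₀ - f i)‖ * ‖invH (f i)‖ := hmul _ _
      _ ≤ C * (C * ‖invH f₀‖ * ‖f₀ - f i‖) * ‖invH (f i)‖ := by gcongr; exact hmul _ _
      _ = _ := by ring
  rw [tendsto_iff_norm_sub_tendsto_zero]
  have hlim : Tendsto (fun i => K * ‖f₀ - f i‖ * (2 * ‖invH f₀‖)) l (𝓝 0) := by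
    have := (hd.const_mul K).mul_const (2 * ‖invH f₀‖)
    simpa using this
  have hsmall : ∀ᶠ i in l, K * ‖f₀ - f i‖ < 1 / 2 := by
    have := hd.const_mul K
    rw [mul_zero] at this
    exact this.eventually_lt_const (by norm_num)
  refine squeeze_zero' (Eventually.of_forall fun _ => norm_nonneg _) ?_ hlim
  filter_upwards [hsmall] with i hi
  refine (hle i).trans ?_
  have h2 : ‖invH (f i)‖ ≤ 2 * ‖invH f₀‖ := by
    have h3 := hle i
    have h4 : ‖invH (f i)‖ ≤ ‖invH f₀‖ + ‖invH (f i) - invH f₀‖ := by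
      simpa using norm_add_le (invH f₀) (invH (f i) - invH f₀)
    nlinarith [norm_nonneg (invH (f i))]
  gcongr

/-! ### Diffeomorphisms of the circle and composition with their inverses -/

/-- A `C¹` diffeomorphism `η` of the circle of degree one, given by its derivative `J > 0`, of
mean one, and by the value `e` of (a lift of) `η` at `0`. -/
structure CMap where
  /-- The derivative. -/
  J : C(Circ, ℝ)
  pos : ∀ x, 0 < J x
  avg_one : ∫ x, J x ∂haar = 1
  /-- The value at `0`. -/
  e : ℝ

namespace CMap

variable (c : CMap)

/-- The lift `x ↦ e + ∫₀ˣ J` of the diffeomorphism to the line. -/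
def lift (x : ℝ) : ℝ := c.e + ∫ y in (0 : ℝ)..x, c.J (y : Circ)

theorem hasDerivAt_lift (x : ℝ) : HasDerivAt c.lift (c.J (x : Circ)) x :=
  (intervalIntegral.integral_hasDerivAt_right ((IsC1.continuous_comp c.J).intervalIntegrable _ _)
    ((IsC1.continuous_comp c.J).stronglyMeasurableAtFilter _ _)
    (IsC1.continuous_comp c.J).continuousAt).const_add _

theorem continuous_lift : Continuous c.lift :=
  continuous_iff_continuousAt.2 fun x => (c.hasDerivAt_lift x).continuousAt

theorem lift_zero : c.lift 0 = c.e := by simp [lift]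

theorem lift_add_one (x : ℝ) : c.lift (x + 1) = c.lift x + 1 := by
  have hper : Function.Periodic (fun y : ℝ => c.J (y : Circ)) 1 := fun y =>
    congrArg c.J (AddCircle.coe_add_period 1 y)
  have h := hper.intervalIntegral_add_eq x 0
  rw [zero_add, ← integral_circ (fun x => c.J x), c.avg_one] at h
  rw [lift, lift, ← intervalIntegral.integral_add_adjacent_intervals
    ((IsC1.continuous_comp c.J).intervalIntegrable 0 x)
    ((IsC1.continuous_comp c.J).intervalIntegrable x (x + 1)), h]
  ring

theorem strictMono_lift : StrictMono c.lift :=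
  strictMono_of_hasDerivAt_pos (fun x => c.hasDerivAt_lift x) fun x => c.pos x

/-- The diffeomorphism, as a map of the circle. -/
def toFun : Circ → Circ :=
  Function.Periodic.lift (f := fun x => ((c.lift x : ℝ) : Circ)) (c := 1) fun x =>
    (congrArg _ (c.lift_add_one x)).trans (AddCircle.coe_add_period 1 _)

theorem toFun_coe (x : ℝ) : c.toFun (x : Circ) = ((c.lift x : ℝ) : Circ) := rfl

theorem continuous_toFun : Continuous c.toFun :=
  continuous_coinduced_dom.2 ((AddCircle.continuous_mk' (1 : ℝ)).comp c.continuous_lift)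

theorem lift_add_int (x : ℝ) (n : ℤ) : c.lift (x + n) = c.lift x + n := by
  induction n with
  | zero => simp
  | succ n ih =>
    have h := c.lift_add_one (x + (n : ℤ))
    rw [ih] at h
    push_cast at h ⊢
    rw [← add_assoc, h, add_assoc]
  | pred n ih =>
    have h := c.lift_add_one (x + ((-n - 1 : ℤ) : ℝ))
    have e : x + ((-n - 1 : ℤ) : ℝ) + 1 = x + ((-n : ℤ) : ℝ) := by push_cast; ring
    rw [e, ih] at h
    push_cast at h ⊢
    linarith

theorem bijective_toFun : Function.Bijective c.toFun := by
  constructor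
  · intro x y h
    induction x using QuotientAddGroup.induction_on with | H a => ?_
    induction y using QuotientAddGroup.induction_on with | H b => ?_
    change ((c.lift a : ℝ) : Circ) = ((c.lift b : ℝ) : Circ) at h
    rw [← sub_eq_zero, ← AddCircle.coe_sub, AddCircle.coe_eq_zero_iff] at h
    obtain ⟨n, hn⟩ := h
    have h2 : a = b + n := c.strictMono_lift.injective (by
      rw [c.lift_add_int]
      simp only [zsmul_eq_mul, mul_one] at hn
      linarith)
    change (a : Circ) = (b : Circ)
    rw [← sub_eq_zero, ← AddCircle.coe_sub, AddCircle.coe_eq_zero_iff]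
    exact ⟨n, by simp [h2]⟩
  · intro y
    induction y using QuotientAddGroup.induction_on with | H r => ?_
    obtain ⟨n, hn⟩ := exists_int_gt (r - c.e)
    obtain ⟨m, hm⟩ := exists_int_lt (r - c.e)
    have hn' := c.lift_add_int 0 n
    have hm' := c.lift_add_int 0 m
    rw [zero_add, lift_zero] at hn' hm'
    have hmn : (m : ℝ) ≤ n := (hm.trans hn).le
    obtain ⟨x, -, hx⟩ := intermediate_value_Icc hmn c.continuous_lift.continuousOn
      (show r ∈ Icc _ _ from ⟨by linarith, by linarith⟩)
    exact ⟨(x : Circ), (c.toFun_coe x).trans (congrArg _ hx)⟩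

/-- The diffeomorphism, as a homeomorphism of the circle. -/
def homeo : Circ ≃ₜ Circ :=
  Continuous.homeoOfEquivCompactToT2 (f := Equiv.ofBijective c.toFun c.bijective_toFun)
    c.continuous_toFun

theorem homeo_coe (x : ℝ) : c.homeo (x : Circ) = ((c.lift x : ℝ) : Circ) := rfl

/-- Composition of a continuous function with the diffeomorphism. -/
def comp (φ : C(Circ, ℝ)) : C(Circ, ℝ) := φ.comp c.homeo

theorem comp_apply (φ : C(Circ, ℝ)) (x : Circ) : c.comp φ x = φ (c.homeo x) := rfl

/-- The change of variables formula. -/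
theorem integral_comp (φ : C(Circ, ℝ)) : ∫ x, c.comp φ x * c.J x ∂haar = ∫ x, φ x ∂haar := by
  rw [integral_circ, integral_circ]
  have h := intervalIntegral.integral_comp_mul_deriv (a := 0) (b := 1) (f := c.lift)
    (f' := fun x : ℝ => c.J (x : Circ)) (g := fun x : ℝ => φ (x : Circ))
    (fun x _ => c.hasDerivAt_lift x) (IsC1.continuous_comp c.J).continuousOn
    (IsC1.continuous_comp φ)
  refine Eq.trans ?_ (h.trans ?_)
  · rfl
  · have hper : Function.Periodic (fun y : ℝ => φ (y : Circ)) 1 := fun y =>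
      congrArg φ (AddCircle.coe_add_period 1 y)
    have h2 := hper.intervalIntegral_add_eq (c.lift 0) 0
    rw [zero_add] at h2
    rw [← h2, ← c.lift_add_one, zero_add]

/-- The measure `J dx`. -/
def density : Measure Circ := haar.withDensity fun x => ENNReal.ofReal (c.J x)

theorem integral_density (f : Circ → ℝ) : ∫ x, f x ∂c.density = ∫ x, f x * c.J x ∂haar := by
  rw [density, integral_withDensity_eq_integral_toReal_smul
    (by fun_prop) (ae_of_all _ fun _ => ENNReal.ofReal_lt_top)]
  refine integral_congr_ae (ae_of_all _ fun x => ?_)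
  simp [ENNReal.toReal_ofReal (c.pos x).le, mul_comm]

theorem density_le : c.density ≤ ENNReal.ofReal ‖c.J‖ • haar := by
  rw [← withDensity_const]
  exact withDensity_mono (ae_of_all _ fun x =>
    ENNReal.ofReal_le_ofReal ((le_abs_self _).trans (c.J.norm_coe_le_norm x)))

instance : IsFiniteMeasure c.density :=
  ⟨(c.density_le Set.univ).trans_lt (by
    rw [Measure.smul_apply, measure_univ, smul_eq_mul, mul_one]
    exact ENNReal.ofReal_lt_top)⟩

theorem measurePreserving_homeo : MeasurePreserving c.homeo c.density haar := by
  refine ⟨c.homeo.continuous.measurable, ?_⟩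
  have : IsFiniteMeasure (Measure.map c.homeo c.density) := Measure.isFiniteMeasure_map _ _
  refine ext_of_forall_integral_eq_of_IsFiniteMeasure fun φ => ?_
  rw [integral_map c.homeo.continuous.aemeasurable φ.continuous.aestronglyMeasurable,
    integral_density]
  exact c.integral_comp φ.toContinuousMap

theorem measurePreserving_symm : MeasurePreserving c.homeo.symm haar c.density :=
  MeasurePreserving.symm c.homeo.toMeasurableEquiv c.measurePreserving_homeo

theorem memLp_comp_symm (f : L2) : MemLp (fun x => f (c.homeo.symm x)) 2 haar :=
  (((Lp.memLp f).smul_measure ENNReal.ofReal_ne_top).mono_measure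
    c.density_le).comp_measurePreserving c.measurePreserving_symm

/-- The composition `f ∘ η⁻¹` of a square-integrable function with the inverse of the
diffeomorphism. -/
def pull (f : L2) : L2 := (c.memLp_comp_symm f).toLp

theorem pull_ae (f : L2) : c.pull f =ᵐ[haar] fun x => f (c.homeo.symm x) :=
  (c.memLp_comp_symm f).coeFn_toLp

theorem pull_add (f g : L2) : c.pull (f + g) = c.pull f + c.pull g := by
  refine Lp.ext ?_
  have h := c.measurePreserving_symm.quasiMeasurePreserving.ae_eq_comp
    ((withDensity_absolutelyContinuous _ _).ae_le (Lp.coeFn_add f g))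
  filter_upwards [c.pull_ae f, c.pull_ae g, c.pull_ae (f + g), h,
    Lp.coeFn_add (c.pull f) (c.pull g)] with x h1 h2 h3 h4 h5
  rw [h3, h5, Pi.add_apply, h1, h2]
  exact h4

theorem pull_smul (r : ℝ) (f : L2) : c.pull (r • f) = r • c.pull f := by
  refine Lp.ext ?_
  have h := c.measurePreserving_symm.quasiMeasurePreserving.ae_eq_comp
    ((withDensity_absolutelyContinuous _ _).ae_le (Lp.coeFn_smul r f))
  filter_upwards [c.pull_ae f, c.pull_ae (r • f), h,
    Lp.coeFn_smul r (c.pull f)] with x h1 h3 h4 h5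
  rw [h3, h5, Pi.smul_apply, h1]
  exact h4

theorem pull_sub (f g : L2) : c.pull (f - g) = c.pull f - c.pull g := by
  rw [sub_eq_add_neg, ← neg_one_smul ℝ g, pull_add, pull_smul, neg_one_smul, sub_eq_add_neg]

theorem inner_pull_ofC (f : L2) (φ : C(Circ, ℝ)) :
    inner ℝ (c.pull f) (ofC φ) = inner ℝ f (ofC (c.comp φ * c.J)) := by
  have h1 : ∫ x, c.pull f x * φ x ∂haar = ∫ x, f (c.homeo.symm x) * φ x ∂haar :=
    integral_congr_ae (by filter_upwards [c.pull_ae f] with x hx; rw [hx])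
  have h2 := c.measurePreserving_symm.integral_comp
    c.homeo.symm.toMeasurableEquiv.measurableEmbedding (fun y => f y * c.comp φ y)
  rw [inner_ofC, inner_ofC, h1]
  simp only [comp_apply, Homeomorph.apply_symm_apply] at h2
  rw [h2, integral_density]
  exact integral_congr_ae (ae_of_all _ fun x => by
    simp only [ContinuousMap.mul_apply, comp_apply]; ring)

theorem norm_pull_sq (f : L2) : ‖c.pull f‖ ^ 2 = inner ℝ f (mulL2 c.J f) := by
  rw [← real_inner_self_eq_norm_sq, inner_eq, inner_eq]
  have h1 : ∫ x, c.pull f x * c.pull f x ∂haar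
      = ∫ x, f (c.homeo.symm x) * f (c.homeo.symm x) ∂haar :=
    integral_congr_ae (by filter_upwards [c.pull_ae f] with x hx; rw [hx])
  have h2 := c.measurePreserving_symm.integral_comp
    c.homeo.symm.toMeasurableEquiv.measurableEmbedding (fun y => f y * f y)
  rw [h1, h2, integral_density]
  exact integral_congr_ae (by
    filter_upwards [mulL2_ae c.J f] with x hx
    rw [hx]
    ring)

theorem norm_pull_sq_le (f : L2) : ‖c.pull f‖ ^ 2 ≤ ‖c.J‖ * ‖f‖ ^ 2 := by
  rw [norm_pull_sq]
  calc _ ≤ ‖f‖ * ‖mulL2 c.J f‖ := real_inner_le_norm _ _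
    _ ≤ ‖f‖ * (‖c.J‖ * ‖f‖) := by gcongr; exact norm_mulL2_le _ _
    _ = _ := by ring

theorem avg_pull (f : L2) : avg (c.pull f) = inner ℝ f (ofC c.J) := by
  have h := c.inner_pull_ofC f 1
  have e : c.comp 1 * c.J = c.J := by ext x; simp [comp_apply]
  rw [e] at h
  rw [← h, inner_ofC, avg_eq]
  simp

/-- Composition of a continuous function with the inverse of the diffeomorphism. -/
def pullC (φ : C(Circ, ℝ)) : C(Circ, ℝ) := φ.comp c.homeo.symm

theorem comp_pullC (φ : C(Circ, ℝ)) : c.comp (c.pullC φ) = φ := by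
  ext x; simp [comp_apply, pullC]

theorem pull_ofC (φ : C(Circ, ℝ)) : c.pull (ofC φ) = ofC (c.pullC φ) := by
  refine Lp.ext ?_
  have h := c.measurePreserving_symm.quasiMeasurePreserving.ae_eq_comp
    ((withDensity_absolutelyContinuous _ _).ae_le (ofC_ae φ))
  filter_upwards [c.pull_ae (ofC φ), h, ofC_ae (c.pullC φ)] with x h1 h2 h3
  rw [h1, h3]
  exact h2

theorem isC1_comp {φ ψ : C(Circ, ℝ)} (h : IsC1 φ ψ) : IsC1 (c.comp φ) (c.comp ψ * c.J) :=
  fun x => (h (c.lift x)).comp x (c.hasDerivAt_lift x)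

/-- The chain rule `(f ∘ η⁻¹)' = (f' / J) ∘ η⁻¹`. -/
theorem WD_pull {f g h : L2} (hfg : WD f g) (hg : mulL2 c.J h = g) :
    WD (c.pull f) (c.pull h) := by
  refine WD_of_test fun φ ψ hφ => ?_
  rw [inner_pull_ofC, inner_pull_ofC, hfg.test (c.isC1_comp hφ), ← hg, inner_ofC, inner_ofC]
  congr 1
  refine integral_congr_ae ?_
  filter_upwards [mulL2_ae c.J h] with x hx
  rw [hx, ContinuousMap.mul_apply]
  ring

end CMap

/-! ### Continuity of the composition with respect to both factors -/

/-- A family of linear maps is jointly continuous if it is locally uniformly bounded and, at every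
point, continuous on a dense set of vectors. -/
theorem continuous_of_dense {X E F : Type*} [TopologicalSpace X] [SeminormedAddCommGroup E]
    [SeminormedAddCommGroup F] (P : X → E → F) (hsub : ∀ x f g, P x (f - g) = P x f - P x g)
    (hb : ∀ x₀, ∃ C : ℝ, ∀ᶠ x in 𝓝 x₀, ∀ f, ‖P x f‖ ≤ C * ‖f‖)
    (hd : ∀ f : E, ∀ ε > 0, ∃ g, ‖f - g‖ < ε ∧ Continuous fun x => P x g) :
    Continuous fun p : X × E => P p.1 p.2 := by
  rw [continuous_iff_continuousAt]
  rintro ⟨x₀, f₀⟩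
  obtain ⟨C, hC⟩ := hb x₀
  set D := max C 1
  have hD : 0 < D := lt_max_of_lt_right one_pos
  have hD' : ∀ᶠ x in 𝓝 x₀, ∀ f, ‖P x f‖ ≤ D * ‖f‖ := by
    filter_upwards [hC] with x hx f
    exact (hx f).trans (by gcongr; exact le_max_left _ _)
  rw [ContinuousAt, Metric.tendsto_nhds]
  intro ε hε
  obtain ⟨g, hg, hgc⟩ := hd f₀ (ε / (8 * D)) (by positivity)
  have h1 : ∀ᶠ p : X × E in 𝓝 (x₀, f₀), ‖p.2 - f₀‖ < ε / (8 * D) := by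
    have : Tendsto (fun p : X × E => ‖p.2 - f₀‖) (𝓝 (x₀, f₀)) (𝓝 0) := by
      have h : Continuous fun p : X × E => ‖p.2 - f₀‖ := by fun_prop
      simpa using h.tendsto (x₀, f₀)
    exact this.eventually_lt_const (by positivity)
  have h2 : ∀ᶠ p : X × E in 𝓝 (x₀, f₀), ‖P p.1 g - P x₀ g‖ < ε / 4 := by
    have : Tendsto (fun p : X × E => ‖P p.1 g - P x₀ g‖) (𝓝 (x₀, f₀)) (𝓝 0) := by
      have h : Continuous fun p : X × E => ‖P p.1 g - P x₀ g‖ :=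
        ((hgc.comp continuous_fst).sub continuous_const).norm
      simpa using h.tendsto (x₀, f₀)
    exact this.eventually_lt_const (by positivity)
  have h3 : ∀ᶠ p : X × E in 𝓝 (x₀, f₀), ∀ f, ‖P p.1 f‖ ≤ D * ‖f‖ :=
    (continuous_fst.tendsto (x₀, f₀)).eventually hD'
  filter_upwards [h1, h2, h3] with p hp1 hp2 hp3
  have e : P p.1 p.2 - P x₀ f₀
      = P p.1 (p.2 - f₀) + P p.1 (f₀ - g) + (P p.1 g - P x₀ g) - P x₀ (f₀ - g) := by
    simp only [hsub]; abel
  have a1 := hp3 (p.2 - f₀)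
  have a2 := hp3 (f₀ - g)
  have a3 := hD'.self_of_nhds (f₀ - g)
  have b1 : D * ‖p.2 - f₀‖ ≤ D * (ε / (8 * D)) := by gcongr
  have b2 : D * ‖f₀ - g‖ ≤ D * (ε / (8 * D)) := by gcongr
  have b3 : D * (ε / (8 * D)) = ε / 8 := by field_simp
  rw [dist_eq_norm, e]
  calc _ ≤ ‖P p.1 (p.2 - f₀)‖ + ‖P p.1 (f₀ - g)‖ + ‖P p.1 g - P x₀ g‖ + ‖P x₀ (f₀ - g)‖ :=
        (norm_sub_le _ _).trans (by gcongr; exact norm_add₃_le)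
    _ < ε := by linarith

section Family

variable {X : Type*} [TopologicalSpace X] {c : X → CMap}

theorem CMap.dist_homeo_le (c d : CMap) (y : Circ) :
    dist (c.homeo y) (d.homeo y) ≤ |c.e - d.e| + ‖c.J - d.J‖ := by
  obtain ⟨x, hx, rfl⟩ : ∃ x ∈ Ico (0 : ℝ) (0 + 1), (x : Circ) = y :=
    ⟨_, (AddCircle.equivIco 1 0 y).2, AddCircle.coe_equivIco⟩
  have h0 : 0 ≤ x := hx.1
  rw [c.homeo_coe, d.homeo_coe, dist_eq_norm, ← AddCircle.coe_sub]
  have hn : ∀ r : ℝ, ‖(r : Circ)‖ ≤ |r| := fun r => QuotientAddGroup.norm_mk_le_norm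
  refine (hn _).trans ?_
  have e : c.lift x - d.lift x
      = (c.e - d.e) + ∫ y in (0 : ℝ)..x, (c.J - d.J) (y : Circ) := by
    simp only [CMap.lift, ContinuousMap.sub_apply]
    rw [intervalIntegral.integral_sub ((IsC1.continuous_comp _).intervalIntegrable _ _)
      ((IsC1.continuous_comp _).intervalIntegrable _ _)]
    ring
  rw [e]
  refine (abs_add_le _ _).trans ?_
  gcongr
  have h := intervalIntegral.norm_integral_le_of_norm_le_const
    (a := (0 : ℝ)) (b := x) (f := fun y : ℝ => (c.J - d.J) (y : Circ)) (C := ‖c.J - d.J‖)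
    fun y _ => (c.J - d.J).norm_coe_le_norm _
  rw [Real.norm_eq_abs, sub_zero, abs_of_nonneg h0] at h
  have hx1 : x ≤ 1 := by linarith [hx.2]
  exact h.trans (mul_le_of_le_one_right (norm_nonneg _) hx1)

theorem CMap.continuous_comp_family (hJ : Continuous fun x => (c x).J)
    (he : Continuous fun x => (c x).e) (φ : C(Circ, ℝ)) : Continuous fun x => (c x).comp φ := by
  rw [continuous_iff_continuousAt]
  intro x₀
  rw [ContinuousAt, Metric.tendsto_nhds]
  intro ε hε
  obtain ⟨δ, hδ, hφ⟩ := Metric.uniformContinuous_iff.1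
    (CompactSpace.uniformContinuous_of_continuous φ.continuous) (ε / 2) (by positivity)
  have h : Continuous fun x => |(c x).e - (c x₀).e| + ‖(c x).J - (c x₀).J‖ := by fun_prop
  have h2 := h.tendsto x₀
  simp only [sub_self, abs_zero, norm_zero, add_zero] at h2
  filter_upwards [h2.eventually_lt_const hδ] with x hx
  refine lt_of_le_of_lt ?_ (half_lt_self hε)
  rw [ContinuousMap.dist_le (by positivity)]
  intro y
  exact (hφ ((CMap.dist_homeo_le _ _ y).trans_lt hx)).le

theorem CMap.continuous_pull_ofC (hJ : Continuous fun x => (c x).J)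
    (he : Continuous fun x => (c x).e) (φ : C(Circ, ℝ)) :
    Continuous fun x => (c x).pull (ofC φ) := by
  rw [continuous_iff_continuousAt]
  intro x₀
  set ψ := (c x₀).pullC φ
  -- weak convergence together with convergence of the norms
  have h1 : Continuous fun x => ‖(c x).pull (ofC φ)‖ ^ 2 := by
    simp_rw [CMap.norm_pull_sq]
    exact continuous_const.inner ((mulL2.continuous.comp hJ).clm_apply continuous_const)
  have h2 : Continuous fun x => (inner ℝ ((c x).pull (ofC φ)) (ofC ψ) : ℝ) := by
    simp_rw [CMap.inner_pull_ofC]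
    exact continuous_const.inner
      (ofC.continuous.comp ((CMap.continuous_comp_family hJ he ψ).mul hJ))
  have h3 : Continuous fun x => ‖(c x).pull (ofC φ) - (c x₀).pull (ofC φ)‖ ^ 2 := by
    simp_rw [@norm_sub_sq_real, (c x₀).pull_ofC φ]
    exact (h1.sub (continuous_const.mul h2)).add continuous_const
  have h4 := h3.sqrt
  simp_rw [Real.sqrt_sq (norm_nonneg _)] at h4
  rw [ContinuousAt, tendsto_iff_norm_sub_tendsto_zero]
  simpa using h4.tendsto x₀

theorem CMap.eventually_norm_J_le (hJ : Continuous fun x => (c x).J) (x₀ : X) :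
    ∀ᶠ x in 𝓝 x₀, ‖(c x).J‖ ≤ ‖(c x₀).J‖ + 1 := by
  have := hJ.norm.tendsto x₀
  filter_upwards [this.eventually_lt_const (lt_add_one _)] with x hx using hx.le

/-- Composition is jointly continuous with values in `L²`. -/
theorem CMap.continuous_pull (hJ : Continuous fun x => (c x).J)
    (he : Continuous fun x => (c x).e) :
    Continuous fun p : X × L2 => (c p.1).pull p.2 := by
  refine continuous_of_dense (fun x f => (c x).pull f) (fun x => (c x).pull_sub) ?_ ?_
  · intro x₀
    refine ⟨√(‖(c x₀).J‖ + 1), ?_⟩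
    filter_upwards [CMap.eventually_norm_J_le hJ x₀] with x hx f
    refine le_of_sq_le_sq ?_ (by positivity)
    rw [mul_pow, Real.sq_sqrt (by positivity)]
    exact ((c x).norm_pull_sq_le f).trans (by gcongr)
  · intro f ε hε
    have hdense : DenseRange ofC := ContinuousMap.toLp_denseRange ℝ haar ℝ (by norm_num)
    obtain ⟨φ, hφ⟩ := hdense.exists_dist_lt f hε
    exact ⟨ofC φ, by rwa [← dist_eq_norm], CMap.continuous_pull_ofC hJ he φ⟩

end Family

/-- Composition with a diffeomorphism is bounded in `H^a`, `0 < a < 1`, with a bound that only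
depends on the derivatives of the diffeomorphism and of its inverse. Composing the frequency
truncations of `f` gives approximants to which `sobSq_le_of_approx` applies, since composition is
bounded in `L²` and in `H¹`. -/
theorem CMap.exists_sobSq_pull_le {a : ℝ} (h0 : 0 < a) (h1 : a < 1) :
    ∃ A : ℝ, 0 ≤ A ∧ ∀ (c : CMap) (r : C(Circ, ℝ)), c.J * r = 1 → ∀ f : Hs a,
      sobSq a (coeff (c.pull f.toL2))
        ≤ ENNReal.ofReal (A * (‖c.J‖ * (1 + ‖r‖ ^ 2)) * ‖f‖ ^ 2) := by
  have hq0 : 1 < (4 : ℝ) ^ a := Real.one_lt_rpow (by norm_num) h0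
  have hq1 : (4 : ℝ) ^ (a - 1) < 1 :=
    Real.rpow_lt_one_of_one_lt_of_neg (by norm_num) (by linarith)
  have hW := wConst_pos
  set A1 : ℝ := 2 * (4 * wConst) ^ a with hA1
  set A2 : ℝ := 4 ^ a / (4 ^ a - 1) with hA2
  set A3 : ℝ := wConst ^ (1 - a) / (1 - 4 ^ (a - 1)) with hA3
  have p1 : 0 ≤ A1 := by positivity
  have p2 : 0 ≤ A2 := div_nonneg (by positivity) (by linarith)
  have p3 : 0 ≤ A3 := div_nonneg (by positivity) (by linarith)
  refine ⟨A1 * (A2 + A3), by positivity, fun c r hr f => ?_⟩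
  set M : ℝ := ‖c.J‖ * (1 + ‖r‖ ^ 2) with hM
  have hM0 : 0 ≤ M := by positivity
  have hJM : ‖c.J‖ ≤ M := le_mul_of_one_le_right (norm_nonneg _) (by nlinarith [norm_nonneg r])
  let S : ℕ → Hs 1 := fun k => trunc zero_le_one k f
  have hS : ∀ k, coeff (S k).toL2 = truncSeq k f.hat := fun k =>
    funext fun n => hat_trunc zero_le_one k f n
  have key := sobSq_le_of_approx h0.le h1 (coeff (c.pull f.toL2))
    fun k => coeff (c.pull (S k).toL2)
  have e0 : ∀ k, sobSq 0 (fun n => coeff (c.pull f.toL2) n - coeff (c.pull (S k).toL2) n)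
      ≤ ENNReal.ofReal M * sobSq 0 (fun n => f.hat n - truncSeq k f.hat n) := fun k => by
    have : (fun n => f.hat n - truncSeq k f.hat n)
        = fun n => coeff f.toL2 n - coeff (S k).toL2 n := by rw [hS]; rfl
    rw [this, ofReal_norm_sub_sq, ofReal_norm_sub_sq, ← c.pull_sub, ← ENNReal.ofReal_mul hM0]
    exact ENNReal.ofReal_le_ofReal ((c.norm_pull_sq_le _).trans (by gcongr))
  have e1 : ∀ k, sobSq 1 (coeff (c.pull (S k).toL2))
      ≤ ENNReal.ofReal M * sobSq 1 (truncSeq k f.hat) := fun k => by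
    have hw := WD_derivH (a := 1) (b := 0) le_rfl (by norm_num) (S k)
    set g := (derivH (a := 1) (b := 0) le_rfl (by norm_num) (S k)).toL2
    have hg : mulL2 c.J (mulL2 r g) = g := by rw [mulL2_mulL2, hr, mulL2_one]
    rw [(c.WD_pull hw hg).sobSq_one, ← hS, hw.sobSq_one, ← ENNReal.ofReal_mul hM0]
    refine ENNReal.ofReal_le_ofReal ?_
    have b1 := c.norm_pull_sq_le (S k).toL2
    have b2 := c.norm_pull_sq_le (mulL2 r g)
    have b3 : ‖mulL2 r g‖ ^ 2 ≤ ‖r‖ ^ 2 * ‖g‖ ^ 2 := by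
      rw [← mul_pow]; gcongr; exact norm_mulL2_le _ _
    have b4 : ‖c.J‖ * ‖mulL2 r g‖ ^ 2 ≤ ‖c.J‖ * (‖r‖ ^ 2 * ‖g‖ ^ 2) := by gcongr
    have b5 : 0 ≤ ‖c.J‖ * ‖r‖ ^ 2 * ‖(S k).toL2‖ ^ 2 := by positivity
    have b6 : 0 ≤ ‖c.J‖ * ‖g‖ ^ 2 := by positivity
    rw [hM]
    nlinarith
  refine key.trans ?_
  have s0 : ∑' k : ℕ, ENNReal.ofReal ((4 ^ a) ^ k) *
      sobSq 0 (fun n => coeff (c.pull f.toL2) n - coeff (c.pull (S k).toL2) n)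
      ≤ ENNReal.ofReal M * (ENNReal.ofReal A2 * sobSq a f.hat) := by
    refine le_trans ?_ (mul_le_mul_right (tsum_sobSq_sub_trunc_le h0 f.hat) _)
    rw [← ENNReal.tsum_mul_left]
    refine ENNReal.tsum_le_tsum fun k => ?_
    rw [mul_left_comm]
    exact mul_le_mul_right (e0 k) _
  have s1 : ∑' k : ℕ, ENNReal.ofReal ((4 ^ (a - 1)) ^ k) * sobSq 1 (coeff (c.pull (S k).toL2))
      ≤ ENNReal.ofReal M * (ENNReal.ofReal A3 * sobSq a f.hat) := by
    refine le_trans ?_ (mul_le_mul_right (tsum_sobSq_trunc_le h1 f.hat) _)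
    rw [← ENNReal.tsum_mul_left]
    refine ENNReal.tsum_le_tsum fun k => ?_
    rw [mul_left_comm]
    exact mul_le_mul_right (e1 k) _
  refine (mul_le_mul_right (add_le_add s0 s1) _).trans ?_
  rw [Hs.sobSq_hat, ← ENNReal.ofReal_mul p2, ← ENNReal.ofReal_mul p3, ← ENNReal.ofReal_mul hM0,
    ← ENNReal.ofReal_mul hM0, ← ENNReal.ofReal_add (by positivity) (by positivity),
    ← ENNReal.ofReal_mul p1]
  exact ENNReal.ofReal_le_ofReal (by ring_nf; rfl)

section Family

variable {X : Type*} [TopologicalSpace X] {c : X → CMap} {r : X → Hs θ}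

theorem isometry_toL2 : Isometry (Hs.toL2 (s := 0)) :=
  AddMonoidHomClass.isometry_of_norm (toL2CLM (a := 0) le_rfl) fun f => by
    rw [toL2CLM_apply]
    have h1 := sobSq_zero f.toL2
    have h2 := Hs.sobSq_hat f
    change sobSq 0 (coeff f.toL2) = _ at h2
    rw [h1, ENNReal.ofReal_eq_ofReal_iff (by positivity) (by positivity)] at h2
    exact (pow_left_inj₀ (norm_nonneg _) (norm_nonneg _) two_ne_zero).1 h2

theorem sobSq_zero_ne_top (f : L2) : sobSq 0 (coeff f) ≠ ⊤ := by
  rw [sobSq_zero]; exact ENNReal.ofReal_ne_top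

/-- A jointly continuous family of composition operators `f ↦ f ∘ η⁻¹` in `H^a`. -/
def IsPullFamily (c : X → CMap) (a : ℝ) (P : X → Hs a → Hs a) : Prop :=
  (∀ x f, (P x f).toL2 = (c x).pull f.toL2) ∧ Continuous fun p : X × Hs a => P p.1 p.2

theorem exists_pullFamily_zero (hJ : Continuous fun x => (c x).J)
    (he : Continuous fun x => (c x).e) : ∃ P, IsPullFamily c 0 P := by
  refine ⟨fun x f => Hs.ofL2 ((c x).pull f.toL2) (sobSq_zero_ne_top _), fun _ _ => rfl, ?_⟩
  rw [isometry_toL2.isEmbedding.isInducing.continuous_iff]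
  exact (CMap.continuous_pull hJ he).comp
    (continuous_fst.prodMk (isometry_toL2.continuous.comp continuous_snd))

variable [hθ : Fact (1 / 2 < θ)]

theorem CMap.continuous_avg_pull (hJ : Continuous fun x => (c x).J) {a : ℝ} (ha : 0 ≤ a) :
    Continuous fun p : X × Hs a => avg ((c p.1).pull p.2.toL2) := by
  simp_rw [CMap.avg_pull]
  exact ((toL2CLM ha).continuous.comp continuous_snd).inner
    (ofC.continuous.comp (hJ.comp continuous_fst))

/-- The derivative of a composition, in terms of a family of compositions for `H^b`. -/
theorem IsPullFamily.toL2_eq {a b : ℝ} (hb : 0 ≤ b) (hab : b + 1 ≤ a) (hbθ : 1 / 2 < θ - b)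
    (hrJ : ∀ x, (c x).J * toC (r x) = 1) {P : X → Hs b → Hs b} (hP : IsPullFamily c b P)
    {d : ℝ} (hd : 0 ≤ d) (hdb : d ≤ b + 1) (x : X) (f : Hs a) :
    (constH hd (avg ((c x).pull f.toL2))
      + primH hd hdb (P x (prodH hb hbθ (r x) (derivH hb hab f)))).toL2 = (c x).pull f.toL2 := by
  refine WD.eq_prim hd hdb ?_
  rw [hP.1]
  refine (c x).WD_pull (WD_derivH hb hab f) ?_
  rw [toL2_prodH, mulL2_mulL2, hrJ, mulL2_one]

theorem IsPullFamily.continuous_prim {a b : ℝ} (hb : 0 ≤ b) (hab : b + 1 ≤ a)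
    (hbθ : 1 / 2 < θ - b) (hJ : Continuous fun x => (c x).J) (hr : Continuous r)
    {P : X → Hs b → Hs b} (hP : IsPullFamily c b P) {d : ℝ} (hd : 0 ≤ d) (hdb : d ≤ b + 1) :
    Continuous fun p : X × Hs a => constH hd (avg ((c p.1).pull p.2.toL2))
      + primH hd hdb (P p.1 (prodH hb hbθ (r p.1) (derivH hb hab p.2))) := by
  refine ((constH hd).continuous.comp (CMap.continuous_avg_pull hJ (by linarith))).add
    ((primH hd hdb).continuous.comp (hP.2.comp (continuous_fst.prodMk ?_)))
  exact ((prodH hb hbθ).continuous.comp (hr.comp continuous_fst)).clm_apply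
    ((derivH hb hab).continuous.comp continuous_snd)

theorem exists_pullFamily_of_lt_one (hJ : Continuous fun x => (c x).J)
    (he : Continuous fun x => (c x).e) (hr : Continuous r)
    (hrJ : ∀ x, (c x).J * toC (r x) = 1) {a : ℝ} (h0 : 0 < a) (h1 : a < 1) :
    ∃ P, IsPullFamily c a P := by
  obtain ⟨A, hA, hbound⟩ := CMap.exists_sobSq_pull_le h0 h1
  obtain ⟨Q, hQ⟩ := exists_pullFamily_zero hJ he
  let P : X → Hs a → Hs a := fun x f => Hs.ofL2 ((c x).pull f.toL2)
    (ne_top_of_le_ne_top ENNReal.ofReal_ne_top (hbound (c x) _ (hrJ x) f))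
  have hP : ∀ x f, (P x f).toL2 = (c x).pull f.toL2 := fun _ _ => rfl
  have hθ' : 1 / 2 < θ - 0 := by rw [sub_zero]; exact hθ.out
  refine ⟨P, hP, continuous_of_dense P (fun x f g => toL2_injective ?_) (fun x₀ => ?_)
    fun f ε hε => ?_⟩
  · change _ = (P x f).toL2 - (P x g).toL2
    rw [hP, hP, hP, ← CMap.pull_sub]
    rfl
  · have hJ' := CMap.eventually_norm_J_le hJ x₀
    have hr' : ∀ᶠ x in 𝓝 x₀, ‖toC (r x)‖ ≤ ‖toC (r x₀)‖ + 1 := by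
      have := (toC.continuous.comp hr).norm.tendsto x₀
      filter_upwards [this.eventually_lt_const (lt_add_one _)] with x hx using hx.le
    refine ⟨√(A * ((‖(c x₀).J‖ + 1) * (1 + (‖toC (r x₀)‖ + 1) ^ 2))), ?_⟩
    filter_upwards [hJ', hr'] with x hx1 hx2 f
    refine Hs.norm_le_of_sobSq (by positivity) ?_
    refine (hbound (c x) _ (hrJ x) f).trans (ENNReal.ofReal_le_ofReal ?_)
    rw [mul_pow, Real.sq_sqrt (by positivity)]
    gcongr
  · obtain ⟨k, hk⟩ := ((tendsto_iff_norm_sub_tendsto_zero.1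
      (tendsto_trunc h0.le f)).eventually_lt_const hε).exists
    refine ⟨trunc (b := a) h0.le k f, by rwa [norm_sub_rev], ?_⟩
    have hc := hQ.continuous_prim (a := 1) le_rfl (by norm_num) hθ' hJ hr h0.le
      (show a ≤ 0 + 1 by linarith)
    refine (hc.comp (continuous_id.prodMk
      (continuous_const (y := trunc (b := 1) zero_le_one k f)))).congr fun x => ?_
    refine toL2_injective ((hQ.toL2_eq le_rfl (by norm_num) hθ' hrJ h0.le (by linarith) x _).trans
      ?_)
    rw [hP]
    congr 1
    exact L2_ext fun n => (hat_trunc _ k f n).trans (hat_trunc _ k f n).symm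

/-- Composition with the inverse of a diffeomorphism `η` is jointly continuous in `H^a`,
`0 ≤ a ≤ θ`, if `1/η'` depends continuously in `H^θ` on the diffeomorphism. -/
theorem exists_pullFamily (hJ : Continuous fun x => (c x).J)
    (he : Continuous fun x => (c x).e) (hr : Continuous r)
    (hrJ : ∀ x, (c x).J * toC (r x) = 1) {a : ℝ} (h0 : 0 ≤ a) (h1 : a ≤ θ) :
    ∃ P, IsPullFamily c a P := by
  obtain ⟨n, hn⟩ := exists_nat_gt a
  induction n generalizing a with
  | zero => simp at hn; linarith
  | succ n ih =>
    rcases lt_or_ge a 1 with ha | ha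
    · rcases h0.eq_or_lt with rfl | h0
      · exact exists_pullFamily_zero hJ he
      · exact exists_pullFamily_of_lt_one hJ he hr hrJ h0 ha
    · have hb : 0 ≤ a - 1 := by linarith
      obtain ⟨P, hP⟩ := ih hb (by linarith) (by push_cast at hn; linarith)
      exact ⟨_, fun x f => hP.toL2_eq hb (by linarith) (by linarith) hrJ h0 (by linarith) x f,
        hP.continuous_prim hb (by linarith) (by linarith) hJ hr h0 (by linarith)⟩

end Family

/-! ### The equation as an evolution equation -/

/-- A continuous periodic function on the line, as a function on the circle. -/
def perC (φ : ℝ → ℝ) (hφ : Continuous φ) (hp : Function.Periodic φ 1) : C(Circ, ℝ) :=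
  ⟨hp.lift, continuous_coinduced_dom.2 hφ⟩

theorem IsTest.deriv {φ : ℝ → ℝ} (h : IsTest φ) : IsTest (deriv φ) := by
  refine ⟨(contDiff_infty_iff_deriv.1 h.1).2, fun x => ?_⟩
  rw [← deriv_comp_add_const]
  exact congrArg (fun f => _root_.deriv f x) (funext h.2)

/-- A test function, as a function on the circle. -/
def IsTest.toC {φ : ℝ → ℝ} (h : IsTest φ) : C(Circ, ℝ) := perC φ h.1.continuous h.2

theorem IsTest.isC1 {φ : ℝ → ℝ} (h : IsTest φ) : IsC1 h.toC h.deriv.toC := fun x =>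
  (h.1.differentiable (by simp) x).hasDerivAt

theorem IsTest.inner_eq {φ : ℝ → ℝ} (h : IsTest φ) (f : L2) :
    ∫ x in (0 : ℝ)..1, f (x : Circ) * φ x = inner ℝ f (ofC h.toC) := by
  rw [inner_ofC, integral_circ]; rfl

theorem isTest_one : IsTest fun _ => 1 := ⟨contDiff_const, fun _ => rfl⟩

theorem isTest_cos (n : ℤ) : IsTest fun x => Real.cos (2 * Real.pi * n * x) :=
  ⟨by fun_prop, fun x => by
    change Real.cos (2 * Real.pi * n * (x + 1)) = _
    rw [show 2 * Real.pi * n * (x + 1) = 2 * Real.pi * n * x + n * (2 * Real.pi) by ring,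
      Real.cos_add_int_mul_two_pi]⟩

theorem isTest_sin (n : ℤ) : IsTest fun x => Real.sin (2 * Real.pi * n * x) :=
  ⟨by fun_prop, fun x => by
    change Real.sin (2 * Real.pi * n * (x + 1)) = _
    rw [show 2 * Real.pi * n * (x + 1) = 2 * Real.pi * n * x + n * (2 * Real.pi) by ring,
      Real.sin_add_int_mul_two_pi]⟩

theorem C_ext_coe {φ ψ : C(Circ, ℝ)} (h : ∀ x : ℝ, φ (x : Circ) = ψ (x : Circ)) : φ = ψ := by
  ext x
  induction x using QuotientAddGroup.induction_on with | H a => exact h a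

theorem toC_isTest_cos (n : ℤ) : (isTest_cos n).toC = cosC n := C_ext_coe fun x =>
  (cosC_coe n x).symm

theorem toC_isTest_sin (n : ℤ) : (isTest_sin n).toC = sinC n := C_ext_coe fun x =>
  (sinC_coe n x).symm

theorem IsC1.unique {φ ψ ψ' : C(Circ, ℝ)} (h : IsC1 φ ψ) (h' : IsC1 φ ψ') : ψ = ψ' :=
  C_ext_coe fun x => (h x).unique (h' x)

theorem toC_isTest_cos_deriv (n : ℤ) :
    (isTest_cos n).deriv.toC = -(2 * Real.pi * n) • sinC n :=
  (isTest_cos n).isC1.unique (by rw [toC_isTest_cos]; exact isC1_cosC n)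

theorem toC_isTest_sin_deriv (n : ℤ) :
    (isTest_sin n).deriv.toC = (2 * Real.pi * n) • cosC n :=
  (isTest_sin n).isC1.unique (by rw [toC_isTest_sin]; exact isC1_sinC n)

theorem IsC1.smul {φ ψ : C(Circ, ℝ)} (h : IsC1 φ ψ) (a : ℝ) : IsC1 (a • φ) (a • ψ) :=
  fun x => (h x).const_smul a

theorem toC_isTest_cos_deriv₂ (n : ℤ) :
    (isTest_cos n).deriv.deriv.toC = -(2 * Real.pi * n) ^ 2 • cosC n := by
  refine (isTest_cos n).deriv.isC1.unique ?_
  rw [toC_isTest_cos_deriv]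
  convert (isC1_sinC n).smul (-(2 * Real.pi * n)) using 1
  rw [smul_smul]
  congr 1
  ring

theorem toC_isTest_sin_deriv₂ (n : ℤ) :
    (isTest_sin n).deriv.deriv.toC = -(2 * Real.pi * n) ^ 2 • sinC n := by
  refine (isTest_sin n).deriv.isC1.unique ?_
  rw [toC_isTest_sin_deriv]
  convert (isC1_cosC n).smul (2 * Real.pi * n) using 1
  rw [smul_smul]
  congr 1
  ring

theorem isWeakDeriv_iff {f g : L2} : IsWeakDeriv f g ↔ WD f g := by
  constructor
  · intro h
    refine WD_of_trig (fun n => ?_) fun n => ?_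
    · have := h _ (isTest_cos n)
      rw [(isTest_cos n).inner_eq, (isTest_cos n).deriv.inner_eq, toC_isTest_cos,
        toC_isTest_cos_deriv, map_smul, inner_smul_right] at this
      linarith
    · have := h _ (isTest_sin n)
      rw [(isTest_sin n).inner_eq, (isTest_sin n).deriv.inner_eq, toC_isTest_sin,
        toC_isTest_sin_deriv, map_smul, inner_smul_right] at this
      linarith
  · intro h φ hφ
    rw [hφ.inner_eq, hφ.deriv.inner_eq]
    exact h.test hφ.isC1

theorem inner_one (f : L2) : inner ℝ (ofC 1) f = avg f := by
  rw [real_inner_comm, inner_ofC, avg_eq]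
  simp

theorem avg_one : avg (ofC 1) = 1 := by rw [avg_ofC]; simp

theorem avg_cosC {n : ℤ} (hn : n ≠ 0) : avg (ofC (cosC n)) = 0 := by
  have h := (isC1_sinC n).integral_eq_zero
  rw [← avg_ofC, map_smul, map_smul, smul_eq_mul] at h
  exact (mul_eq_zero.1 h).resolve_left (by simp [hn])

theorem avg_sinC (n : ℤ) : avg (ofC (sinC n)) = 0 := by
  rcases eq_or_ne n 0 with rfl | hn
  · have : sinC 0 = 0 := C_ext_coe fun x => by simp [sinC_coe]
    rw [this, map_zero, map_zero]
  have h := (isC1_cosC n).integral_eq_zero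
  rw [← avg_ofC, map_smul, map_smul, smul_eq_mul] at h
  exact (mul_eq_zero.1 h).resolve_left (by simp [hn])

theorem isInertiaInvDeriv_iff {g : Circ → ℝ} {g' p : L2} (hg : g =ᵐ[haar] g') :
    IsInertiaInvDeriv g p ↔ avg p = 0 ∧ WD p (avg g' • ofC 1 - g') := by
  have hi : ∀ φ : ℝ → ℝ, ∀ h : IsTest φ,
      ∫ x in (0 : ℝ)..1, g (x : Circ) * φ x = inner ℝ g' (ofC h.toC) := fun φ h => by
    rw [inner_ofC]
    refine Eq.trans ?_ (integral_congr_ae (hg.mul (ae_eq_refl h.toC)))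
    rw [integral_circ]
    rfl
  have h1 : ∀ φ : ℝ → ℝ, ∀ h : IsTest φ,
      ∫ x in (0 : ℝ)..1, φ x = avg (ofC h.toC) := fun φ h => by
    rw [avg_ofC, integral_circ]; rfl
  constructor
  · intro h
    have h0 : avg p = 0 := by
      have := h _ isTest_one
      simpa [mean_eq] using this
    refine ⟨h0, WD_of_trig (fun n => ?_) fun n => ?_⟩
    · rw [inner_sub_left, inner_smul_left, inner_one]
      rcases eq_or_ne n 0 with rfl | hn
      · have e : cosC 0 = 1 := C_ext_coe fun x => by simp [cosC_coe]
        rw [e, avg_one, real_inner_comm, inner_one]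
        simp
      have := h _ (isTest_sin n)
      rw [(isTest_sin n).deriv.deriv.inner_eq, hi _ (isTest_sin n).deriv, toC_isTest_sin_deriv,
        toC_isTest_sin_deriv₂, mean_eq, h0, map_smul, map_smul, inner_smul_right,
        inner_smul_right] at this
      rw [avg_cosC hn]
      have hn' : 2 * Real.pi * (n : ℝ) ≠ 0 := by simp [hn]
      refine mul_left_cancel₀ hn' ?_
      simp only [conj_trivial]
      linear_combination -this
    · rw [inner_sub_left, inner_smul_left, inner_one, avg_sinC]
      rcases eq_or_ne n 0 with rfl | hn
      · have e : sinC 0 = 0 := C_ext_coe fun x => by simp [sinC_coe]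
        rw [e, map_zero, inner_zero_right]
        simp
      have := h _ (isTest_cos n)
      rw [(isTest_cos n).deriv.deriv.inner_eq, hi _ (isTest_cos n).deriv, toC_isTest_cos_deriv,
        toC_isTest_cos_deriv₂, mean_eq, h0, map_smul, map_smul, inner_smul_right,
        inner_smul_right] at this
      have hn' : 2 * Real.pi * (n : ℝ) ≠ 0 := by simp [hn]
      refine mul_left_cancel₀ hn' ?_
      simp only [conj_trivial]
      linear_combination this
  · rintro ⟨h0, hw⟩ φ hφ
    have h2 := hw.test hφ.deriv.isC1
    have h3 : avg (ofC hφ.deriv.toC) = 0 := by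
      rw [avg_ofC]; exact hφ.isC1.integral_eq_zero
    rw [inner_sub_left, inner_smul_left, inner_one, h3] at h2
    rw [mean_eq, h0, hφ.deriv.deriv.inner_eq, hi _ hφ.deriv, h2]
    ring

theorem toC_neg_apply [Fact (1 / 2 < θ)] (f : Hs θ) (x : Circ) : toC (-f) x = -toC f x := by
  rw [map_neg]; rfl

section Operators

variable {s : ℝ} [hs : Fact (3 / 2 < s)]

instance fact_sub_one : Fact (1 / 2 < s - 1) := ⟨by linarith [hs.out]⟩

instance fact_half : Fact (1 / 2 < s) := ⟨by linarith [hs.out]⟩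

/-- The inclusion of `H^s` in `H^{s-1}`. -/
def lowH (s : ℝ) [hs : Fact (3 / 2 < s)] : Hs s →L[ℝ] Hs (s - 1) :=
  inclCLM (by linarith [hs.out]) (by linarith)

/-- The derivative from `H^s` to `H^{s-1}`. -/
def dH (s : ℝ) [hs : Fact (3 / 2 < s)] : Hs s →L[ℝ] Hs (s - 1) :=
  derivH (by linarith [hs.out]) (by linarith)

/-- The primitive with mean zero of `f - ∫ f`, from `H^{s-1}` to `H^s`. -/
def iH (s : ℝ) [hs : Fact (3 / 2 < s)] : Hs (s - 1) →L[ℝ] Hs s :=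
  primH (by linarith [hs.out]) (by linarith)

/-- The constant functions in `H^s`. -/
def kH (s : ℝ) [hs : Fact (1 / 2 < s)] : ℝ →L[ℝ] Hs s := constH (half_lt_nonneg hs)

@[simp] theorem hat_lowH (f : Hs s) (n : ℤ) : (lowH s f).hat n = f.hat n := hat_inclCLM _ _ _ _

@[simp] theorem hat_dH (f : Hs s) (n : ℤ) : (dH s f).hat n = dSym n * f.hat n :=
  hat_derivH _ _ _ _

@[simp] theorem hat_iH (f : Hs (s - 1)) (n : ℤ) : (iH s f).hat n = (dSym n)⁻¹ * f.hat n :=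
  hat_primH _ _ _ _

@[simp] theorem hat_kH {s : ℝ} [Fact (1 / 2 < s)] (c : ℝ) (n : ℤ) :
    (kH s c).hat n = if n = 0 then (c : ℂ) else 0 := hat_constH _ _ _

@[simp] theorem toC_kH {s : ℝ} [Fact (1 / 2 < s)] (c : ℝ) (x : Circ) : toC (kH s c) x = c :=
  toC_constH _ _ _

theorem toL2_lowH (f : Hs s) : (lowH s f).toL2 = f.toL2 := toL2_inclCLM _ _ _

@[simp] theorem toC_lowH (f : Hs s) : toC (lowH s f) = toC f := toC_inclCLM _ _ _

theorem lower_eq (u : ℝ → Hs s) (t : ℝ) : lower u t = lowH s (u t) := incl_eq _ _ _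

theorem WD_dH (f : Hs s) : WD f.toL2 (dH s f).toL2 := WD_derivH _ _ f

theorem avg_iH (f : Hs (s - 1)) : avg (iH s f).toL2 = 0 := by
  have h := (iH s f).hat_zero_eq
  rw [hat_iH] at h
  simpa using h.symm

theorem avg_kH {s : ℝ} [Fact (1 / 2 < s)] (c : ℝ) : avg (kH s c).toL2 = c := by
  have h := (kH s c).hat_zero_eq
  rw [hat_kH] at h
  simpa using h.symm

theorem dH_iH (f : Hs (s - 1)) : dH s (iH s f) = f - kH (s - 1) (avg f.toL2) := by
  refine Hs.ext_hat fun n => ?_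
  rw [hat_dH, hat_iH, Hs.hat_sub, hat_kH]
  rcases eq_or_ne n 0 with rfl | hn
  · simp [Hs.hat_zero_eq]
  · rw [if_neg hn, sub_zero, mul_inv_cancel_left₀ (dSym_ne_zero hn)]

theorem iH_dH (f : Hs s) : iH s (dH s f) = f - kH s (avg f.toL2) := by
  refine Hs.ext_hat fun n => ?_
  rw [hat_iH, hat_dH, Hs.hat_sub, hat_kH]
  rcases eq_or_ne n 0 with rfl | hn
  · simp [Hs.hat_zero_eq]
  · rw [if_neg hn, sub_zero, inv_mul_cancel_left₀ (dSym_ne_zero hn)]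

/-- The nonlinearity `2 μ(u) u + u_x² / 2`. -/
def fluxH (u : Hs s) : Hs (s - 1) :=
  (2 * avg u.toL2) • lowH s u + (1 / 2 : ℝ) • (dH s u ⊙ dH s u)

/-- The right-hand side of the equation, written as `u_t = G(u)`. -/
def rhsH (u : Hs s) : Hs (s - 1) :=
  -(lowH s u ⊙ dH s u) + lowH s (iH s (fluxH u))

theorem toC_fluxH (u : Hs s) (x : Circ) :
    toC (fluxH u) x = 2 * avg u.toL2 * toC u x + 1 / 2 * toC (dH s u) x ^ 2 := by
  rw [fluxH, map_add, map_smul, map_smul, toC_mulH, toC_lowH]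
  simp only [ContinuousMap.add_apply, ContinuousMap.smul_apply, ContinuousMap.mul_apply,
    smul_eq_mul]
  ring

theorem toC_rhsH (u : Hs s) (x : Circ) :
    toC (rhsH u) x = -(toC u x * toC (dH s u) x) + toC (iH s (fluxH u)) x := by
  rw [rhsH, map_add, map_neg, toC_mulH, toC_lowH, toC_lowH]
  rfl

theorem avg_toL2_add (f g : Hs θ) : avg (f + g).toL2 = avg f.toL2 + avg g.toL2 :=
  avg.map_add f.toL2 g.toL2

theorem avg_toL2_neg (f : Hs θ) : avg (-f).toL2 = -avg f.toL2 := avg.map_neg f.toL2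

theorem avg_toL2_smul (a : ℝ) (f : Hs θ) : avg (a • f).toL2 = a * avg f.toL2 :=
  avg.map_smul a f.toL2

theorem isC1_toC_dH (u : Hs s) : IsC1 (toC u) (toC (dH s u)) := isC1_toC _ _ u

theorem avg_rhsH (u : Hs s) : avg (rhsH u).toL2 = 0 := by
  have h := ((isC1_toC_dH u).mul (isC1_toC_dH u)).integral_eq_zero
  have e : toC (dH s u) * toC u + toC u * toC (dH s u)
      = (2 : ℝ) • toC (lowH s u ⊙ dH s u) := by
    rw [toC_mulH, toC_lowH, two_smul, mul_comm (toC (dH s u))]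
  rw [e, ← avg_ofC, map_smul, map_smul, ofC_toC, smul_eq_mul] at h
  rw [rhsH, avg_toL2_add, avg_toL2_neg, toL2_lowH, avg_iH]
  linarith

theorem continuous_rhsH : Continuous (rhsH (s := s)) := by
  unfold rhsH fluxH
  have h1 : Continuous fun u : Hs s => avg u.toL2 :=
    avg.continuous.comp (toL2CLM (half_lt_nonneg fact_half)).continuous
  have hd := (dH s).continuous
  have hl := (lowH s).continuous
  have h2 : Continuous fun u : Hs s => dH s u ⊙ dH s u :=
    (mulH.continuous.comp hd).clm_apply hd
  have h3 : Continuous fun u : Hs s => lowH s u ⊙ dH s u :=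
    (mulH.continuous.comp hl).clm_apply hd
  have h4 : Continuous fun u : Hs s => (2 * avg u.toL2) • lowH s u :=
    (continuous_const.mul h1).smul hl
  have h5 : Continuous fun u : Hs s => (1 / 2 : ℝ) • (dH s u ⊙ dH s u) := h2.const_smul (1 / 2 : ℝ)
  exact h3.neg.add (hl.comp ((iH s).continuous.comp (h4.add h5)))

theorem equation_iff (u : Hs s) (v : Hs (s - 1)) : Equation u v ↔ v = rhsH u := by
  have hflux : ∀ ux : Hs (s - 1), ux = dH s u →
      (fun x => 2 * mean u.toL2 * u.toL2 x + 1 / 2 * (ux.toL2 x) ^ 2) =ᵐ[haar] (fluxH u).toL2 := by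
    rintro ux rfl
    filter_upwards [toC_ae u, toC_ae (dH s u), toC_ae (fluxH u)] with x h1 h2 h3
    rw [h1, h2, h3, toC_fluxH, mean_eq]
  have hp : ∀ p : Hs s, avg p.toL2 = 0 ∧ WD p.toL2 (avg (fluxH u).toL2 • ofC 1 - (fluxH u).toL2)
      ↔ p = -iH s (fluxH u) := by
    intro p
    have ha : avg (fluxH u).toL2 • ofC 1 - (fluxH u).toL2 = (-dH s (iH s (fluxH u))).toL2 := by
      rw [dH_iH, neg_sub]
      change _ = (kH (s - 1) (avg (fluxH u).toL2)).toL2 - (fluxH u).toL2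
      congr 1
      rw [← ofC_toC (kH (s - 1) _), ← map_smul]
      congr 1
      ext x
      rw [toC_kH]
      simp
    rw [ha]
    constructor
    · rintro ⟨h1, h2⟩
      have h3 : dH s p = -dH s (iH s (fluxH u)) :=
        Hs.ext_hat fun n => (hat_dH p n).trans (h2 n).symm
      have h4 := iH_dH p
      rw [h3, h1, map_zero, sub_zero, map_neg, iH_dH, avg_iH, map_zero, sub_zero] at h4
      exact h4.symm
    · rintro rfl
      have h := WD_dH (-iH s (fluxH u))
      rw [map_neg (dH s)] at h
      exact ⟨by rw [avg_toL2_neg, avg_iH, neg_zero], h⟩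
  constructor
  · rintro ⟨ux, p, h1, h2, h3⟩
    rw [isWeakDeriv_iff] at h1
    obtain rfl : ux = dH s u := Hs.ext_hat fun n => (h1 n).trans (hat_dH u n).symm
    rw [isInertiaInvDeriv_iff (hflux _ rfl), hp] at h2
    subst h2
    refine toL2_injective (Lp.ext ?_)
    filter_upwards [h3, toC_ae u, toC_ae (dH s u), toC_ae (rhsH u),
      toC_ae (-iH s (fluxH u))] with x h0 h1 h2 h3 h4
    rw [h1, h2, h4, toC_neg_apply] at h0
    rw [h3, toC_rhsH]
    linarith
  · rintro rfl
    refine ⟨dH s u, -iH s (fluxH u), isWeakDeriv_iff.2 (WD_dH u),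
      (isInertiaInvDeriv_iff (hflux _ rfl)).2 ((hp _).2 rfl), ?_⟩
    filter_upwards [toC_ae u, toC_ae (dH s u), toC_ae (rhsH u), toC_ae (-iH s (fluxH u))] with
      x h1 h2 h3 h4
    rw [h1, h2, h3, h4, toC_rhsH, toC_neg_apply]
    ring

theorem isSolution_iff {I : Set ℝ} {u₀ : Hs s} {u : ℝ → Hs s} :
    IsSolution I u₀ u ↔ ContinuousOn u I ∧
      (∀ t ∈ I, HasDerivAt (fun t => lowH s (u t)) (rhsH (u t)) t) ∧ u 0 = u₀ := by
  have hl : lower u = fun t => lowH s (u t) := funext fun t => lower_eq u t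
  constructor
  · rintro ⟨h1, h2, -, h4, h5⟩
    refine ⟨h1, fun t ht => ?_, h5⟩
    rw [← (equation_iff _ _).1 (h4 t ht), ← hl]
    exact (h2 t ht).hasDerivAt
  · rintro ⟨h1, h2, h5⟩
    rw [← hl] at h2
    refine ⟨h1, fun t ht => (h2 t ht).differentiableAt, ?_, fun t ht =>
      (equation_iff _ _).2 (h2 t ht).deriv, h5⟩
    exact (continuous_rhsH.comp_continuousOn h1).congr fun t ht => (h2 t ht).deriv

end Operators

/-! ### Lagrangian variables -/

/-- The Lagrangian states `(μ, ρ, σ, e)`: the mean `μ` of the velocity, the square root `ρ` of the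
derivative of the flow `η`, its time derivative `σ`, and the value `e` of `η` at `0`. -/
abbrev State (s : ℝ) : Type := ℝ × Hs (s - 1) × Hs (s - 1) × ℝ

theorem contDiff_rho {s : ℝ} : ContDiff ℝ 1 fun y : State s => y.2.1 := contDiff_fst.comp contDiff_snd

theorem contDiff_sigma {s : ℝ} : ContDiff ℝ 1 fun y : State s => y.2.2.1 :=
  contDiff_fst.comp (contDiff_snd.comp contDiff_snd)

section Lagrange

variable {s : ℝ} [hs : Fact (3 / 2 < s)]

/-- The primitive with mean zero of `∂ₓ ∂ₜ η = 2ρσ`. -/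
def velK (y : State s) : Hs s := iH s ((2 : ℝ) • (y.2.1 ⊙ y.2.2.1))

/-- The Lagrangian velocity `v = ∂ₜ η`: its derivative is `2ρσ`, and `∫ v ρ² = μ`. -/
def vel (y : State s) : Hs s :=
  velK y + kH s (y.1 - avg (lowH s (velK y) ⊙ (y.2.1 ⊙ y.2.1)).toL2)

/-- The second time derivative `(μ (v - μ) - ∫ σ²) ρ` of `ρ`. It is defined for all states,
admissible or not, so that the vector field lives on a linear space. -/
def acc (y : State s) : Hs (s - 1) :=
  y.1 • ((lowH s (vel y) - kH (s - 1) y.1) ⊙ y.2.1) - avg (y.2.2.1 ⊙ y.2.2.1).toL2 • y.2.1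

/-- The vector field of the equation in Lagrangian variables. -/
def field (y : State s) : State s := (0, y.2.2.1, acc y, toC (vel y) 0)

/-- The evaluation of a continuous function at a point of the circle. -/
def evalC (x : Circ) : C(Circ, ℝ) →L[ℝ] ℝ := ContinuousMap.evalCLM ℝ x

theorem contDiff_mulH {E : Type*} [NormedAddCommGroup E] [NormedSpace ℝ E] [Fact (1 / 2 < θ)]
    {f g : E → Hs θ} (hf : ContDiff ℝ 1 f) (hg : ContDiff ℝ 1 g) :
    ContDiff ℝ 1 fun x => f x ⊙ g x :=
  ((mulH (θ := θ)).contDiff.comp hf).clm_apply hg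

/-- The mean as a continuous linear form on `H^θ`. -/
def avgH [h : Fact (1 / 2 < θ)] : Hs θ →L[ℝ] ℝ := avg.comp (toL2CLM (half_lt_nonneg h))

theorem avgH_apply [h : Fact (1 / 2 < θ)] (f : Hs θ) : avgH f = avg f.toL2 := rfl

theorem contDiff_velK : ContDiff ℝ 1 (velK (s := s)) :=
  (iH s).contDiff.comp ((contDiff_mulH contDiff_rho contDiff_sigma).const_smul (2 : ℝ))

theorem contDiff_vel : ContDiff ℝ 1 (vel (s := s)) :=
  contDiff_velK.add ((kH s).contDiff.comp (contDiff_fst.sub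
    (avgH.contDiff.comp (contDiff_mulH ((lowH s).contDiff.comp contDiff_velK)
      (contDiff_mulH contDiff_rho contDiff_rho)))))

theorem contDiff_acc : ContDiff ℝ 1 (acc (s := s)) :=
  (contDiff_fst.smul (contDiff_mulH
    (((lowH s).contDiff.comp contDiff_vel).sub ((kH (s - 1)).contDiff.comp contDiff_fst))
    contDiff_rho)).sub
    ((avgH.contDiff.comp (contDiff_mulH contDiff_sigma contDiff_sigma)).smul contDiff_rho)

theorem contDiff_field : ContDiff ℝ 1 (field (s := s)) :=
  contDiff_const.prodMk (contDiff_sigma.prodMk (contDiff_acc.prodMk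
    (((evalC 0).comp toC).contDiff.comp contDiff_vel)))

/-- The states for which `ρ²` is the derivative of a diffeomorphism of the circle. -/
abbrev Adm (s : ℝ) [Fact (3 / 2 < s)] : Type :=
  {y : State s // (∀ x, 0 < toC y.2.1 x) ∧ avg (y.2.1 ⊙ y.2.1).toL2 = 1}

/-- The diffeomorphism `η` of an admissible state. -/
def Adm.cmap (y : Adm s) : CMap where
  J := toC (y.1.2.1 ⊙ y.1.2.1)
  pos x := by
    rw [toC_mulH]
    exact mul_pos (y.2.1 x) (y.2.1 x)
  avg_one := by rw [← avg_toL2]; exact y.2.2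
  e := y.1.2.2.2

theorem Adm.cmap_J (y : Adm s) (x : Circ) : y.cmap.J x = toC y.1.2.1 x ^ 2 := by
  change toC (y.1.2.1 ⊙ y.1.2.1) x = _
  rw [toC_mulH, sq]
  rfl

theorem Adm.rho_ne_zero (y : Adm s) (x : Circ) : toC y.1.2.1 x ≠ 0 := (y.2.1 x).ne'

theorem Adm.continuous_val : Continuous (Subtype.val : Adm s → State s) := continuous_subtype_val

theorem Adm.continuous_rho : Continuous fun y : Adm s => y.1.2.1 :=
  contDiff_rho.continuous.comp Adm.continuous_val

theorem continuous_invH_family {X : Type*} [TopologicalSpace X] [Fact (1 / 2 < θ)] {f : X → Hs θ}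
    (hf : Continuous f) (h : ∀ i, ∀ x, toC (f i) x ≠ 0) : Continuous fun i => invH (f i) :=
  continuous_iff_continuousAt.2 fun i => tendsto_invH (hf.tendsto i) h (h i)

theorem Adm.continuous_invH : Continuous fun y : Adm s => invH y.1.2.1 :=
  continuous_invH_family Adm.continuous_rho Adm.rho_ne_zero

theorem Adm.exists_pull : ∃ P, IsPullFamily (Adm.cmap (s := s)) (s - 1) P := by
  refine exists_pullFamily (θ := s - 1) (r := fun y : Adm s => invH y.1.2.1 ⊙ invH y.1.2.1)
    ?_ ?_ ?_ (fun y => ?_) (half_lt_nonneg fact_sub_one) le_rfl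
  · exact toC.continuous.comp ((mulH.continuous.comp Adm.continuous_rho).clm_apply
      Adm.continuous_rho)
  · exact continuous_snd.comp (continuous_snd.comp (continuous_snd.comp Adm.continuous_val))
  · exact (mulH.continuous.comp Adm.continuous_invH).clm_apply Adm.continuous_invH
  · ext x
    rw [ContinuousMap.mul_apply, Adm.cmap_J, toC_mulH, ContinuousMap.mul_apply,
      toC_invH_apply _ y.rho_ne_zero, ContinuousMap.one_apply]
    have := y.rho_ne_zero x
    field_simp

/-- The composition `f ↦ f ∘ η⁻¹` in `H^{s-1}`. -/
def Adm.pull (y : Adm s) (f : Hs (s - 1)) : Hs (s - 1) := Adm.exists_pull.choose y f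

theorem Adm.toL2_pull (y : Adm s) (f : Hs (s - 1)) : (y.pull f).toL2 = y.cmap.pull f.toL2 :=
  Adm.exists_pull.choose_spec.1 y f

theorem Adm.continuous_pull : Continuous fun p : Adm s × Hs (s - 1) => p.1.pull p.2 :=
  Adm.exists_pull.choose_spec.2

theorem Adm.comp_toC_pull (y : Adm s) (f : Hs (s - 1)) : y.cmap.comp (toC (y.pull f)) = toC f := by
  have h : toC (y.pull f) = y.cmap.pullC (toC f) := ofC_injective (by
    rw [ofC_toC, Adm.toL2_pull, ← ofC_toC, CMap.pull_ofC])
  rw [h, CMap.comp_pullC]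

/-- The function `u_x ∘ η = 2σ/ρ`. -/
def Adm.slope (y : Adm s) : Hs (s - 1) := (2 : ℝ) • (y.1.2.2.1 ⊙ invH y.1.2.1)

theorem Adm.toC_slope (y : Adm s) (x : Circ) :
    toC y.slope x = 2 * toC y.1.2.2.1 x / toC y.1.2.1 x := by
  rw [Adm.slope, map_smul, toC_mulH, ContinuousMap.smul_apply, ContinuousMap.mul_apply,
    toC_invH_apply _ y.rho_ne_zero, smul_eq_mul]
  ring

/-- The Eulerian velocity of an admissible Lagrangian state. -/
def Adm.euler (y : Adm s) : Hs s := iH s (y.pull y.slope) + kH s y.1.1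

theorem Adm.continuous_euler : Continuous (Adm.euler (s := s)) := by
  have h1 : Continuous fun y : Adm s => y.slope :=
    ((mulH.continuous.comp (contDiff_sigma.continuous.comp Adm.continuous_val)).clm_apply
      Adm.continuous_invH).const_smul (2 : ℝ)
  have h2 : Continuous fun y : Adm s => y.pull y.slope :=
    Adm.continuous_pull.comp (continuous_id.prodMk h1)
  exact ((iH s).continuous.comp h2).add
    ((kH s).continuous.comp (continuous_fst.comp Adm.continuous_val))

theorem avg_toL2_mulH [Fact (1 / 2 < θ)] (f g : Hs θ) :
    avg (f ⊙ g).toL2 = ∫ x, toC f x * toC g x ∂haar := by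
  rw [avg_toL2, toC_mulH]; rfl

theorem Adm.avg_pull (y : Adm s) (f : Hs (s - 1)) :
    avg (y.pull f).toL2 = ∫ x, toC f x * toC y.1.2.1 x ^ 2 ∂haar := by
  rw [Adm.toL2_pull, CMap.avg_pull, inner_ofC]
  refine integral_congr_ae ?_
  filter_upwards [toC_ae f] with x hx
  rw [hx, Adm.cmap_J]

theorem Adm.avg_pull_slope (y : Adm s) (hy : avg (y.1.2.1 ⊙ y.1.2.2.1).toL2 = 0) :
    avg (y.pull y.slope).toL2 = 0 := by
  have h : ∀ x, toC y.slope x * toC y.1.2.1 x ^ 2 = 2 * (toC y.1.2.1 x * toC y.1.2.2.1 x) :=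
    fun x => by
      have := y.rho_ne_zero x
      rw [Adm.toC_slope]
      field_simp
  rw [Adm.avg_pull]
  simp_rw [h]
  rw [integral_const_mul, ← avg_toL2_mulH, hy, mul_zero]

theorem dH_kH (a : ℝ) : dH s (kH s a) = 0 := by
  refine Hs.ext_hat fun n => ?_
  rw [hat_dH, hat_kH, Hs.hat_zero]
  split_ifs with h
  · simp [h]
  · simp

theorem Adm.dH_euler (y : Adm s) (hy : avg (y.1.2.1 ⊙ y.1.2.2.1).toL2 = 0) :
    dH s y.euler = y.pull y.slope := by
  rw [Adm.euler, map_add, dH_iH, dH_kH, y.avg_pull_slope hy, map_zero, sub_zero, add_zero]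

theorem Adm.avg_euler (y : Adm s) : avg y.euler.toL2 = y.1.1 := by
  rw [Adm.euler, avg_toL2_add, avg_iH, avg_kH, zero_add]

theorem dH_vel (y : State s) (hy : avg (y.2.1 ⊙ y.2.2.1).toL2 = 0) :
    dH s (vel y) = (2 : ℝ) • (y.2.1 ⊙ y.2.2.1) := by
  rw [vel, map_add, velK, dH_iH, dH_kH, avg_toL2_smul, hy, mul_zero, map_zero, sub_zero, add_zero]

/-- A function is determined by its derivative and a weighted mean. -/
theorem IsC1.eq_of_integral {φ φ' ψ : C(Circ, ℝ)} (h : IsC1 φ ψ) (h' : IsC1 φ' ψ) (c : CMap)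
    (hi : ∫ x, φ x * c.J x ∂haar = ∫ x, φ' x * c.J x ∂haar) : φ = φ' := by
  have hd : ∀ x y : ℝ, φ (x : Circ) - φ' (x : Circ) = φ (y : Circ) - φ' (y : Circ) :=
    is_const_of_deriv_eq_zero (fun x => ((h x).sub (h' x)).differentiableAt) fun x => by
      exact (((h x).sub (h' x)).deriv).trans (sub_self _)
  obtain ⟨k, hk⟩ : ∃ k, ∀ x, φ x = φ' x + k := by
    refine ⟨φ ((0 : ℝ) : Circ) - φ' ((0 : ℝ) : Circ), fun x => ?_⟩
    induction x using QuotientAddGroup.induction_on with | H a => ?_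
    have := hd a 0
    change φ (a : Circ) = φ' (a : Circ) + _
    linarith
  have h2 : ∫ x, φ x * c.J x ∂haar = (∫ x, φ' x * c.J x ∂haar) + k := by
    have e : ∀ x, φ x * c.J x = (φ' * c.J) x + k * c.J x := fun x => by
      rw [hk, ContinuousMap.mul_apply]; ring
    simp_rw [e]
    rw [integral_add (integrable_C _) ((integrable_C c.J).const_mul k), integral_const_mul,
      c.avg_one, mul_one]
    rfl
  ext x
  rw [hk, show k = 0 by linarith, add_zero]

theorem integral_vel (y : Adm s) : ∫ x, toC (vel y.1) x * y.cmap.J x ∂haar = y.1.1 := by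
  have h1 : ∫ x, toC (vel y.1) x * y.cmap.J x ∂haar
      = avg (lowH s (vel y.1) ⊙ (y.1.2.1 ⊙ y.1.2.1)).toL2 := by
    rw [avg_toL2_mulH, toC_lowH]; rfl
  have e : lowH s (vel y.1) ⊙ (y.1.2.1 ⊙ y.1.2.1) = lowH s (velK y.1) ⊙ (y.1.2.1 ⊙ y.1.2.1)
      + (y.1.1 - avg (lowH s (velK y.1) ⊙ (y.1.2.1 ⊙ y.1.2.1)).toL2) • (y.1.2.1 ⊙ y.1.2.1) := by
    refine toC_injective ?_
    rw [map_add, map_smul, toC_mulH, toC_mulH, toC_mulH, toC_mulH, toC_lowH, toC_lowH, vel, map_add]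
    ext x
    simp only [ContinuousMap.add_apply, ContinuousMap.smul_apply, ContinuousMap.mul_apply,
      toC_kH, smul_eq_mul]
    ring
  rw [h1, e, avg_toL2_add, avg_toL2_smul, y.2.2]
  ring

/-- The Lagrangian velocity is the composition of the Eulerian velocity with the flow. -/
theorem Adm.comp_euler (y : Adm s) (hy : avg (y.1.2.1 ⊙ y.1.2.2.1).toL2 = 0) :
    y.cmap.comp (toC y.euler) = toC (vel y.1) := by
  have h1 := y.cmap.isC1_comp (isC1_toC_dH y.euler)
  have h2 := isC1_toC_dH (vel y.1)
  have e : y.cmap.comp (toC (dH s y.euler)) * y.cmap.J = toC (dH s (vel y.1)) := by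
    rw [y.dH_euler hy, y.comp_toC_pull, dH_vel _ hy, map_smul, toC_mulH]
    ext x
    have := y.rho_ne_zero x
    rw [ContinuousMap.mul_apply, Adm.cmap_J, Adm.toC_slope, ContinuousMap.smul_apply,
      ContinuousMap.mul_apply, smul_eq_mul]
    field_simp
  rw [e] at h1
  refine h1.eq_of_integral h2 y.cmap ?_
  rw [integral_vel, CMap.integral_comp, ← avg_toL2, Adm.avg_euler]

/-- The Lagrangian state at time zero. -/
def initState (u : Hs s) : State s := (avg u.toL2, kH (s - 1) 1, (1 / 2 : ℝ) • dH s u, 0)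

theorem continuous_initState : Continuous (initState (s := s)) :=
  avgH.continuous.prodMk (continuous_const.prodMk
    (((dH s).continuous.const_smul (1 / 2 : ℝ)).prodMk continuous_const))

theorem avg_mulH_kH_one [Fact (1 / 2 < θ)] (f : Hs θ) : avg (kH θ 1 ⊙ f).toL2 = avg f.toL2 := by
  rw [avg_toL2_mulH, avg_toL2]
  simp

theorem avg_initState (u : Hs s) :
    avg ((initState u).2.1 ⊙ (initState u).2.1).toL2 = 1 := by
  change avg (kH (s - 1) 1 ⊙ kH (s - 1) 1).toL2 = 1
  rw [avg_mulH_kH_one, avg_kH]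

theorem avg_dH (u : Hs s) : avg (dH s u).toL2 = 0 := by
  have h := (dH s u).hat_zero_eq
  rw [hat_dH] at h
  simpa using h.symm

theorem avg_initState' (u : Hs s) :
    avg ((initState u).2.1 ⊙ (initState u).2.2.1).toL2 = 0 := by
  change avg (kH (s - 1) 1 ⊙ ((1 / 2 : ℝ) • dH s u)).toL2 = 0
  rw [avg_mulH_kH_one, avg_toL2_smul, avg_dH, mul_zero]

/-- The initial state as an admissible state. -/
def admInit (u : Hs s) : Adm s :=
  ⟨initState u, fun x => by
    change 0 < toC (kH (s - 1) 1) x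
    rw [toC_kH]; exact one_pos, avg_initState u⟩

theorem euler_admInit (u : Hs s) : (admInit u).euler = u := by
  have hJ : ∀ x, (admInit u).cmap.J x = 1 := fun x => by
    rw [Adm.cmap_J]
    change toC (kH (s - 1) 1) x ^ 2 = 1
    rw [toC_kH, one_pow]
  have hlift : ∀ x, (admInit u).cmap.lift x = x := fun x => by
    rw [CMap.lift]
    simp_rw [hJ]
    simp [Adm.cmap, admInit, initState]
  have hcomp : ∀ φ, (admInit u).cmap.comp φ = φ := fun φ => C_ext_coe fun x => by
    rw [CMap.comp_apply, CMap.homeo_coe, hlift]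
  have hp : (admInit u).pull (admInit u).slope = dH s u := by
    refine toC_injective ?_
    rw [← hcomp (toC ((admInit u).pull _)), Adm.comp_toC_pull]
    ext x
    rw [Adm.toC_slope]
    change 2 * toC ((1 / 2 : ℝ) • dH s u) x / toC (kH (s - 1) 1) x = _
    rw [toC_kH, map_smul, ContinuousMap.smul_apply, smul_eq_mul]
    ring
  rw [Adm.euler, hp, iH_dH]
  change u - kH s (avg u.toL2) + kH s (avg u.toL2) = u
  rw [sub_add_cancel]

end Lagrange

/-! ### From Lagrangian to Eulerian solutions -/

instance completeSpace_Hs [h : Fact (1 / 2 < θ)] : CompleteSpace (Hs θ) :=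
  Hs.completeSpace (half_lt_nonneg h)

/-- A curve is differentiable if it is so when tested against a separating family of linear forms,
with a derivative that is continuous as a vector-valued curve. -/
theorem hasDerivAt_of_separating {E : Type*} [NormedAddCommGroup E] [NormedSpace ℝ E]
    [CompleteSpace E] {I : Set ℝ} (hI : IsOpen I) (hI' : I.OrdConnected) {f g : ℝ → E}
    (hg : ContinuousOn g I) (S : Set (E →L[ℝ] ℝ)) (hS : ∀ x, (∀ l ∈ S, l x = 0) → x = 0)
    (h : ∀ l ∈ S, ∀ t ∈ I, HasDerivAt (fun t => l (f t)) (l (g t)) t) {t : ℝ} (ht : t ∈ I) :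
    HasDerivAt f (g t) t := by
  have hW : ∀ r ∈ I, HasDerivAt (fun r => f t + ∫ x in t..r, g x) (g r) r := fun r hr =>
    (intervalIntegral.integral_hasDerivAt_right
      ((hg.mono (hI'.uIcc_subset ht hr)).intervalIntegrable)
      (hg.stronglyMeasurableAtFilter hI r hr) (hg.continuousAt (hI.mem_nhds hr))).const_add _
  have hfW : ∀ r ∈ I, f r = f t + ∫ x in t..r, g x := fun r hr => by
    rw [← sub_eq_zero]
    refine hS _ fun l hl => ?_
    have hd : ∀ q ∈ I, HasDerivAt (fun q => l (f q) - l (f t + ∫ x in t..q, g x)) 0 q :=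
      fun q hq => by
        have := (h l hl q hq).sub (l.hasFDerivAt.comp_hasDerivAt q (hW q hq))
        rwa [sub_self] at this
    have hc := hI.is_const_of_deriv_eq_zero hI'.isPreconnected
      (fun q hq => (hd q hq).differentiableAt.differentiableWithinAt)
      (fun q hq => (hd q hq).deriv) hr ht
    simp only [intervalIntegral.integral_same, add_zero, sub_self] at hc
    rw [map_sub, hc]
  refine (hW t ht).congr_of_eventuallyEq ?_
  filter_upwards [hI.mem_nhds ht] with r hr using hfW r hr

theorem hasDerivAt_clm {E F : Type*} [NormedAddCommGroup E] [NormedSpace ℝ E]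
    [NormedAddCommGroup F] [NormedSpace ℝ F] (L : E →L[ℝ] F) {f : ℝ → E} {f' : E} {t : ℝ}
    (hf : HasDerivAt f f' t) : HasDerivAt (fun t => L (f t)) (L f') t :=
  L.hasFDerivAt.comp_hasDerivAt t hf

theorem hasDerivAt_mulH [Fact (1 / 2 < θ)] {f g : ℝ → Hs θ} {f' g' : Hs θ} {t : ℝ}
    (hf : HasDerivAt f f' t) (hg : HasDerivAt g g' t) :
    HasDerivAt (fun t => f t ⊙ g t) (f' ⊙ g t + f t ⊙ g') t :=
  (hasDerivAt_clm mulH hf).clm_apply hg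

/-- Integration of a function on the circle over `[0, x]`. -/
def intC (x : ℝ) : C(Circ, ℝ) →L[ℝ] ℝ :=
  LinearMap.mkContinuous
    { toFun := fun φ => ∫ y in (0 : ℝ)..x, φ (y : Circ)
      map_add' := fun φ ψ => intervalIntegral.integral_add
        ((IsC1.continuous_comp φ).intervalIntegrable _ _)
        ((IsC1.continuous_comp ψ).intervalIntegrable _ _)
      map_smul' := fun a φ => intervalIntegral.integral_smul a fun y : ℝ => φ (y : Circ) } |x| fun φ => by
    have h := intervalIntegral.norm_integral_le_of_norm_le_const
      (a := (0 : ℝ)) (b := x) (f := fun y : ℝ => φ (y : Circ)) (C := ‖φ‖)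
      fun y _ => φ.norm_coe_le_norm _
    rw [sub_zero, mul_comm] at h
    exact h

theorem IsC1.intC {φ ψ : C(Circ, ℝ)} (h : IsC1 φ ψ) (x : ℝ) :
    MuHS.intC x ψ = φ (x : Circ) - φ ((0 : ℝ) : Circ) :=
  intervalIntegral.integral_eq_sub_of_hasDerivAt (fun y _ => h y)
    ((IsC1.continuous_comp ψ).intervalIntegrable _ _)

section Lagrange

variable {s : ℝ} [hs : Fact (3 / 2 < s)]

theorem toC_acc (y : State s) (x : Circ) :
    toC (acc y) x = y.1 * ((toC (vel y) x - y.1) * toC y.2.1 x)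
      - avg (y.2.2.1 ⊙ y.2.2.1).toL2 * toC y.2.1 x := by
  rw [acc, map_sub, map_smul, map_smul, toC_mulH, map_sub, toC_lowH]
  simp only [ContinuousMap.sub_apply, ContinuousMap.smul_apply, ContinuousMap.mul_apply, toC_kH,
    smul_eq_mul]

theorem Adm.toC_flux_homeo (y : Adm s) (hy : avg (y.1.2.1 ⊙ y.1.2.2.1).toL2 = 0) (x : Circ) :
    toC (fluxH y.euler) (y.cmap.homeo x)
      = 2 * y.1.1 * toC (vel y.1) x + 1 / 2 * toC y.slope x ^ 2 := by
  rw [toC_fluxH, y.avg_euler, y.dH_euler hy, ← CMap.comp_apply, ← CMap.comp_apply,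
    y.comp_toC_pull, y.comp_euler hy]

theorem Adm.avg_flux (y : Adm s) (hy : avg (y.1.2.1 ⊙ y.1.2.2.1).toL2 = 0) :
    avg (fluxH y.euler).toL2 = 2 * y.1.1 ^ 2 + 2 * avg (y.1.2.2.1 ⊙ y.1.2.2.1).toL2 := by
  have e : ∀ x, y.cmap.comp (toC (fluxH y.euler)) x * y.cmap.J x
      = 2 * y.1.1 * (toC (vel y.1) * y.cmap.J) x
        + 2 * toC (y.1.2.2.1 ⊙ y.1.2.2.1) x := fun x => by
    have := y.rho_ne_zero x
    rw [CMap.comp_apply, y.toC_flux_homeo hy, toC_mulH, ContinuousMap.mul_apply,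
      ContinuousMap.mul_apply, Adm.cmap_J, Adm.toC_slope]
    field_simp
  rw [avg_toL2, ← y.cmap.integral_comp]
  simp_rw [e]
  rw [integral_add ((integrable_C _).const_mul _) ((integrable_C _).const_mul _),
    integral_const_mul, integral_const_mul, ← avg_toL2]
  simp only [ContinuousMap.mul_apply]
  rw [integral_vel]
  ring

theorem Adm.avg_acc (y : Adm s) :
    avg ((2 : ℝ) • (y.1.2.2.1 ⊙ y.1.2.2.1 + y.1.2.1 ⊙ acc y.1)).toL2 = 0 := by
  have e : ∀ x, toC y.1.2.1 x * toC (acc y.1) x = y.1.1 * (toC (vel y.1) * y.cmap.J) x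
      - (y.1.1 ^ 2 + avg (y.1.2.2.1 ⊙ y.1.2.2.1).toL2) * y.cmap.J x := fun x => by
    rw [toC_acc, ContinuousMap.mul_apply, Adm.cmap_J]
    ring
  rw [avg_toL2_smul, avg_toL2_add, avg_toL2_mulH y.1.2.1]
  simp_rw [e]
  rw [integral_sub ((integrable_C _).const_mul _) ((integrable_C _).const_mul _),
    integral_const_mul, integral_const_mul, y.cmap.avg_one]
  simp only [ContinuousMap.mul_apply]
  rw [integral_vel]
  ring

/-- A solution of the equation in Lagrangian variables, on a set of times, with values in the
admissible states. -/
structure IsFlow (I : Set ℝ) (Y : ℝ → Adm s) : Prop where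
  hasDerivAt : ∀ t ∈ I, HasDerivAt (fun t => (Y t).1) (field (Y t).1) t
  avg_eq_zero : ∀ t ∈ I, avg ((Y t).1.2.1 ⊙ (Y t).1.2.2.1).toL2 = 0

namespace IsFlow

variable {I : Set ℝ} {Y : ℝ → Adm s}

theorem continuousOn (h : IsFlow I Y) : ContinuousOn Y I :=
  Topology.IsInducing.subtypeVal.continuousOn_iff.2 fun t ht =>
    (h.hasDerivAt t ht).continuousAt.continuousWithinAt

theorem hasDerivAt_mu (h : IsFlow I Y) {t : ℝ} (ht : t ∈ I) :
    HasDerivAt (fun t => (Y t).1.1) 0 t :=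
  hasDerivAt_clm (ContinuousLinearMap.fst ℝ ℝ _) (h.hasDerivAt t ht)

theorem hasDerivAt_tail (h : IsFlow I Y) {t : ℝ} (ht : t ∈ I) :
    HasDerivAt (fun t => (Y t).1.2) (field (Y t).1).2 t :=
  hasDerivAt_clm (ContinuousLinearMap.snd ℝ ℝ _) (h.hasDerivAt t ht)

theorem hasDerivAt_rho (h : IsFlow I Y) {t : ℝ} (ht : t ∈ I) :
    HasDerivAt (fun t => (Y t).1.2.1) (Y t).1.2.2.1 t :=
  hasDerivAt_clm (ContinuousLinearMap.fst ℝ _ _) (h.hasDerivAt_tail ht)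

theorem hasDerivAt_sigma (h : IsFlow I Y) {t : ℝ} (ht : t ∈ I) :
    HasDerivAt (fun t => (Y t).1.2.2.1) (acc (Y t).1) t :=
  hasDerivAt_clm (ContinuousLinearMap.fst ℝ _ _)
    (hasDerivAt_clm (ContinuousLinearMap.snd ℝ _ _) (h.hasDerivAt_tail ht))

theorem hasDerivAt_e (h : IsFlow I Y) {t : ℝ} (ht : t ∈ I) :
    HasDerivAt (fun t => (Y t).1.2.2.2) (toC (vel (Y t).1) 0) t :=
  hasDerivAt_clm (ContinuousLinearMap.snd ℝ _ _)
    (hasDerivAt_clm (ContinuousLinearMap.snd ℝ _ _) (h.hasDerivAt_tail ht))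

theorem hasDerivAt_J (h : IsFlow I Y) {t : ℝ} (ht : t ∈ I) :
    HasDerivAt (fun t => (Y t).cmap.J) (toC (dH s (vel (Y t).1))) t := by
  have h1 := h.hasDerivAt_rho ht
  refine (hasDerivAt_clm toC (hasDerivAt_mulH h1 h1)).congr_deriv ?_
  rw [dH_vel _ (h.avg_eq_zero t ht), map_add, toC_mulH, toC_mulH, map_smul, toC_mulH, two_smul,
    mul_comm (toC (Y t).1.2.2.1)]

/-- The flow `η` moves with the velocity `v`. -/
theorem hasDerivAt_lift (h : IsFlow I Y) {t : ℝ} (ht : t ∈ I) (x : ℝ) :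
    HasDerivAt (fun t => (Y t).cmap.lift x) (toC (vel (Y t).1) (x : Circ)) t := by
  have h1 := hasDerivAt_clm (intC x) (h.hasDerivAt_J ht)
  refine ((h.hasDerivAt_e ht).add h1).congr_deriv ?_
  rw [(isC1_toC_dH (vel (Y t).1)).intC]
  exact add_sub_cancel _ _

theorem hasDerivAt_comp (h : IsFlow I Y) (hI : IsOpen I) (hI' : I.OrdConnected)
    {φ ψ : C(Circ, ℝ)} (hφ : IsC1 φ ψ) {t : ℝ} (ht : t ∈ I) :
    HasDerivAt (fun t => (Y t).cmap.comp φ) ((Y t).cmap.comp ψ * toC (vel (Y t).1)) t := by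
  refine hasDerivAt_of_separating (g := fun t => (Y t).cmap.comp ψ * toC (vel (Y t).1)) hI hI' ?_
    (range evalC) (fun φ h => ?_) ?_ ht
  · have h1 : Continuous fun y : Adm s => y.cmap.comp ψ * toC (vel y.1) :=
      (CMap.continuous_comp_family (toC.continuous.comp ((mulH.continuous.comp
        Adm.continuous_rho).clm_apply Adm.continuous_rho)) (continuous_snd.comp
        (continuous_snd.comp (continuous_snd.comp Adm.continuous_val))) ψ).mul
        (toC.continuous.comp (contDiff_vel.continuous.comp Adm.continuous_val))
    exact h1.comp_continuousOn h.continuousOn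
  · ext x; exact h _ ⟨x, rfl⟩
  · rintro _ ⟨x, rfl⟩ r hr
    induction x using QuotientAddGroup.induction_on with | H a => ?_
    exact (hφ ((Y r).cmap.lift a)).comp r (h.hasDerivAt_lift hr a)

/-- The Lagrangian acceleration is `-p ∘ η`, where `p` is the pressure. -/
theorem hasDerivAt_vel (h : IsFlow I Y) {t : ℝ} (ht : t ∈ I) :
    HasDerivAt (fun t => toC (vel (Y t).1))
      ((Y t).cmap.comp (toC (iH s (fluxH (Y t).euler)))) t := by
  have hρ := h.hasDerivAt_rho ht
  have hσ := h.hasDerivAt_sigma ht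
  have h0 := h.avg_eq_zero t ht
  have hK : HasDerivAt (fun t => velK (Y t).1)
      (iH s ((2 : ℝ) • ((Y t).1.2.2.1 ⊙ (Y t).1.2.2.1 + (Y t).1.2.1 ⊙ acc (Y t).1))) t :=
    hasDerivAt_clm (iH s) ((hasDerivAt_mulH hρ hσ).const_smul (2 : ℝ))
  obtain ⟨κ, hκ⟩ : ∃ κ, HasDerivAt (fun t => (Y t).1.1
      - avg (lowH s (velK (Y t).1) ⊙ ((Y t).1.2.1 ⊙ (Y t).1.2.1)).toL2) κ t :=
    ⟨_, (h.hasDerivAt_mu ht).sub (hasDerivAt_clm avgH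
      (hasDerivAt_mulH (hasDerivAt_clm (lowH s) hK) (hasDerivAt_mulH hρ hρ)))⟩
  have hv : HasDerivAt (fun t => toC (vel (Y t).1)) _ t :=
    hasDerivAt_clm toC (hK.add (hasDerivAt_clm (kH s) hκ))
  refine hv.congr_deriv ?_
  set A := iH s ((2 : ℝ) • ((Y t).1.2.2.1 ⊙ (Y t).1.2.2.1 + (Y t).1.2.1 ⊙ acc (Y t).1))
    + kH s κ with hA
  refine (isC1_toC_dH A).eq_of_integral (ψ := toC (dH s A)) (c := (Y t).cmap) ?_ ?_
  · have h1 := (Y t).cmap.isC1_comp (isC1_toC_dH (iH s (fluxH (Y t).euler)))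
    convert h1 using 1
    have hacc : avg ((2 : ℝ) • ((Y t).1.2.2.1 ⊙ (Y t).1.2.2.1
        + (Y t).1.2.1 ⊙ acc (Y t).1)).toL2 = 0 := (Y t).avg_acc
    rw [hA, map_add, dH_iH, dH_kH, add_zero, hacc, map_zero, sub_zero, dH_iH]
    ext x
    rw [ContinuousMap.mul_apply, CMap.comp_apply, map_sub, ContinuousMap.sub_apply,
      (Y t).toC_flux_homeo h0, (Y t).avg_flux h0, toC_kH, Adm.cmap_J, map_smul, map_add, toC_mulH,
      toC_mulH, ContinuousMap.smul_apply, ContinuousMap.add_apply, ContinuousMap.mul_apply,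
      ContinuousMap.mul_apply, toC_acc, Adm.toC_slope, smul_eq_mul]
    have := (Y t).rho_ne_zero x
    field_simp
    ring
  · have h2 : ∫ x, (Y t).cmap.comp (toC (iH s (fluxH (Y t).euler))) x * (Y t).cmap.J x ∂haar = 0 := by
      rw [CMap.integral_comp, ← avg_toL2, avg_iH]
    rw [h2]
    have h3 : HasDerivAt (fun t => avg (ofC (toC (vel (Y t).1) * (Y t).cmap.J))) _ t :=
      hasDerivAt_clm (avg.comp ofC) (hv.mul (h.hasDerivAt_J ht))
    have h4 : (fun t => avg (ofC (toC (vel (Y t).1) * (Y t).cmap.J))) = fun t => (Y t).1.1 :=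
      funext fun t => by rw [avg_ofC, ← integral_vel (Y t)]; rfl
    rw [h4] at h3
    have h5 := h3.unique (h.hasDerivAt_mu ht)
    have h6 := ((isC1_toC_dH (vel (Y t).1)).mul (isC1_toC_dH (vel (Y t).1))).integral_eq_zero
    rw [← avg_ofC, mul_comm (toC (dH s _)), ← two_smul ℝ, map_smul, map_smul, smul_eq_mul] at h6
    rw [ContinuousLinearMap.comp_apply, map_add, map_add, avg_ofC] at h5
    have h7 : avg (ofC (toC (vel (Y t).1) * toC (dH s (vel (Y t).1)))) = 0 := by linarith
    rw [h7, add_zero] at h5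
    exact h5

/-- The Eulerian velocity of a Lagrangian solution solves the equation. -/
theorem hasDerivAt_euler (h : IsFlow I Y) (hI : IsOpen I) (hI' : I.OrdConnected)
    {t : ℝ} (ht : t ∈ I) :
    HasDerivAt (fun t => lowH s (Y t).euler) (rhsH (Y t).euler) t := by
  let T : C(Circ, ℝ) → Hs (s - 1) →L[ℝ] ℝ := fun φ =>
    (innerSL ℝ (ofC φ)).comp (toL2CLM (half_lt_nonneg fact_sub_one))
  have hT : ∀ φ f, T φ f = avg (ofC (toC f * φ)) := fun φ f => by
    change inner ℝ (ofC φ) f.toL2 = _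
    rw [real_inner_comm, inner_ofC, avg_ofC]
    refine integral_congr_ae ?_
    filter_upwards [toC_ae f] with x hx
    rw [hx, ContinuousMap.mul_apply]
  refine hasDerivAt_of_separating (g := fun t => rhsH (Y t).euler) hI hI'
    ((continuous_rhsH.comp Adm.continuous_euler).comp_continuousOn h.continuousOn)
    {l | ∃ φ ψ, IsC1 φ ψ ∧ l = T φ} (fun f hf => ?_) ?_ ht
  · refine toL2_injective (L2_ext fun n => ?_)
    have h1 : ∀ φ ψ, IsC1 φ ψ → inner ℝ f.toL2 (ofC φ) = 0 := fun φ ψ hφ => by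
      rw [real_inner_comm]; exact hf _ ⟨φ, ψ, hφ, rfl⟩
    rw [coeff_eq_inner, h1 _ _ (isC1_cosC n), h1 _ _ (isC1_sinC n)]
    change _ = (0 : Hs (s - 1)).hat n
    simp
  · rintro _ ⟨φ, ψ, hφ, rfl⟩ r hr
    have h0 := h.avg_eq_zero r hr
    have h1 := hasDerivAt_clm (avg.comp ofC) (((h.hasDerivAt_vel hr).mul
      (h.hasDerivAt_comp hI hI' hφ hr)).mul (h.hasDerivAt_J hr))
    have hev : ∀ q ∈ I, T φ (lowH s (Y q).euler)
        = avg (ofC (toC (vel (Y q).1) * (Y q).cmap.comp φ * (Y q).cmap.J)) := fun q hq => by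
      rw [hT, toC_lowH, avg_ofC, avg_ofC, ← (Y q).cmap.integral_comp,
        ← (Y q).comp_euler (h.avg_eq_zero q hq)]
      rfl
    refine HasDerivAt.congr_of_eventuallyEq (h1.congr_deriv ?_)
      (by filter_upwards [hI.mem_nhds hr] with q hq using hev q hq)
    have hvv := (((isC1_toC_dH (vel (Y r).1)).mul (isC1_toC_dH (vel (Y r).1))).mul
      ((Y r).cmap.isC1_comp hφ)).integral_eq_zero
    rw [← avg_ofC] at hvv
    have hG : T φ (rhsH (Y r).euler) = avg (ofC ((-(toC (vel (Y r).1) * toC (Y r).slope)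
        + (Y r).cmap.comp (toC (iH s (fluxH (Y r).euler)))) * (Y r).cmap.comp φ
        * (Y r).cmap.J)) := by
      rw [hT, avg_ofC, avg_ofC, ← (Y r).cmap.integral_comp, ← (Y r).comp_euler h0]
      refine integral_congr_ae (ae_of_all _ fun x => ?_)
      have e : toC (dH s (Y r).euler) ((Y r).cmap.homeo x) = toC (Y r).slope x := by
        rw [(Y r).dH_euler h0, ← CMap.comp_apply, (Y r).comp_toC_pull]
      simp only [CMap.comp_apply, ContinuousMap.mul_apply, ContinuousMap.add_apply,
        ContinuousMap.neg_apply, toC_rhsH, e]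
    rw [hG, ← sub_eq_zero, ContinuousLinearMap.comp_apply, ← map_sub, ← map_sub, Pi.mul_apply]
    refine Eq.trans ?_ hvv
    congr 2
    have hsl : toC (Y r).slope * (Y r).cmap.J = toC (dH s (vel (Y r).1)) := by
      rw [dH_vel _ h0, map_smul, toC_mulH]
      ext x
      have := (Y r).rho_ne_zero x
      rw [ContinuousMap.mul_apply, Adm.cmap_J, Adm.toC_slope, ContinuousMap.smul_apply,
        ContinuousMap.mul_apply, smul_eq_mul]
      field_simp
    linear_combination toC (vel (Y r).1) * (Y r).cmap.comp φ * hsl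

end IsFlow

end Lagrange

/-! ### Local existence and continuous dependence -/

/-- Gronwall's lemma, forwards and backwards in time. -/
theorem eq_zero_of_norm_deriv_le {E : Type*} [NormedAddCommGroup E] [NormedSpace ℝ E] {I : Set ℝ}
    (hI : I.OrdConnected) {z z' : ℝ → E} {k : ℝ → ℝ} (hk : ContinuousOn k I)
    (hz : ∀ t ∈ I, HasDerivAt z (z' t) t) (h : ∀ t ∈ I, ‖z' t‖ ≤ k t * ‖z t‖) {t₀ : ℝ}
    (ht₀ : t₀ ∈ I) (h0 : z t₀ = 0) {t : ℝ} (ht : t ∈ I) : z t = 0 := by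
  have hsub : uIcc t₀ t ⊆ I := hI.uIcc_subset ht₀ ht
  obtain ⟨M, hM⟩ := isCompact_uIcc.exists_bound_of_continuousOn (hk.mono hsub)
  have hb : ∀ r ∈ uIcc t₀ t, ‖z' r‖ ≤ M * ‖z r‖ := fun r hr => (h r (hsub hr)).trans (by
    gcongr; exact (le_abs_self _).trans (hM r hr))
  rcases le_total t₀ t with hle | hle
  · rw [uIcc_of_le hle] at hsub hb
    exact eq_zero_of_abs_deriv_le_mul_abs_self_of_eq_zero_right
      (fun r hr => (hz r (hsub hr)).continuousAt.continuousWithinAt)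
      (fun r hr => (hz r (hsub (Ico_subset_Icc_self hr))).hasDerivWithinAt) h0
      (fun r hr => hb r (Ico_subset_Icc_self hr)) t ⟨hle, le_rfl⟩
  · rw [uIcc_of_ge hle] at hsub hb
    have hd : ∀ r ∈ Icc (-t₀) (-t), HasDerivAt (fun r => z (-r)) (-z' (-r)) r := fun r hr => by
      have := (hz (-r) (hsub ⟨by linarith [hr.2], by linarith [hr.1]⟩)).scomp r (hasDerivAt_neg r)
      rwa [neg_one_smul] at this
    have := eq_zero_of_abs_deriv_le_mul_abs_self_of_eq_zero_right (f := fun r => z (-r))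
      (f' := fun r => -z' (-r)) (K := M)
      (fun r hr => (hd r hr).continuousAt.continuousWithinAt)
      (fun r hr => (hd r (Ico_subset_Icc_self hr)).hasDerivWithinAt) (by simpa using h0)
      (fun r hr => by
        rw [norm_neg]
        exact hb (-r) ⟨by linarith [hr.2], by linarith [hr.1]⟩) (-t) ⟨by linarith, le_rfl⟩
    simpa using this

theorem avg_toL2_sub (f g : Hs θ) : avg (f - g).toL2 = avg f.toL2 - avg g.toL2 :=
  avg.map_sub f.toL2 g.toL2

section Local

variable {s : ℝ} [hs : Fact (3 / 2 < s)]

theorem avg_rho_acc (y : State s) :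
    avg (y.2.1 ⊙ acc y).toL2 = -avg (y.2.2.1 ⊙ y.2.2.1).toL2
      - (avg (y.2.1 ⊙ y.2.1).toL2 - 1) * (avg (y.2.2.1 ⊙ y.2.2.1).toL2
        + y.1 * avg (lowH s (velK y) ⊙ (y.2.1 ⊙ y.2.1)).toL2) := by
  have e : y.2.1 ⊙ acc y = y.1 • (lowH s (velK y) ⊙ (y.2.1 ⊙ y.2.1))
      - (y.1 * avg (lowH s (velK y) ⊙ (y.2.1 ⊙ y.2.1)).toL2
        + avg (y.2.2.1 ⊙ y.2.2.1).toL2) • (y.2.1 ⊙ y.2.1) := by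
    refine toC_injective ?_
    rw [map_sub, map_smul, map_smul, toC_mulH, toC_mulH, toC_mulH, toC_lowH]
    ext x
    simp only [ContinuousMap.sub_apply, ContinuousMap.smul_apply, ContinuousMap.mul_apply,
      toC_acc, smul_eq_mul]
    rw [vel, map_add, ContinuousMap.add_apply, toC_kH]
    ring
  rw [e, avg_toL2_sub, avg_toL2_smul, avg_toL2_smul]
  ring

/-- The two constraints `∫ ρ² = 1` and `∫ ρσ = 0` are preserved: along the Lagrangian equation,
`∫ ρ² - 1` and `∫ ρσ` solve a homogeneous linear system. -/
theorem constraints {I : Set ℝ} (hI : I.OrdConnected) {y : ℝ → State s}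
    (hy : ∀ t ∈ I, HasDerivAt y (field (y t)) t) {t₀ : ℝ} (ht₀ : t₀ ∈ I)
    (ha : avg ((y t₀).2.1 ⊙ (y t₀).2.1).toL2 = 1) (hb : avg ((y t₀).2.1 ⊙ (y t₀).2.2.1).toL2 = 0)
    {t : ℝ} (ht : t ∈ I) :
    avg ((y t).2.1 ⊙ (y t).2.1).toL2 = 1 ∧ avg ((y t).2.1 ⊙ (y t).2.2.1).toL2 = 0 := by
  have hρ : ∀ t ∈ I, HasDerivAt (fun t => (y t).2.1) (y t).2.2.1 t := fun t ht =>
    hasDerivAt_clm (ContinuousLinearMap.fst ℝ _ _)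
      (hasDerivAt_clm (ContinuousLinearMap.snd ℝ _ _) (hy t ht))
  have hσ : ∀ t ∈ I, HasDerivAt (fun t => (y t).2.2.1) (acc (y t)) t := fun t ht =>
    hasDerivAt_clm (ContinuousLinearMap.fst ℝ _ _) (hasDerivAt_clm (ContinuousLinearMap.snd ℝ _ _)
      (hasDerivAt_clm (ContinuousLinearMap.snd ℝ _ _) (hy t ht)))
  have hyc : ContinuousOn y I := fun t ht => (hy t ht).continuousAt.continuousWithinAt
  let c : State s → ℝ := fun y => avgH (y.2.2.1 ⊙ y.2.2.1)
    + y.1 * avgH (lowH s (velK y) ⊙ (y.2.1 ⊙ y.2.1))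
  have hc : Continuous c :=
    (avgH.continuous.comp (contDiff_mulH contDiff_sigma contDiff_sigma).continuous).add
      (continuous_fst.mul (avgH.continuous.comp (contDiff_mulH
        ((lowH s).contDiff.comp contDiff_velK) (contDiff_mulH contDiff_rho contDiff_rho)).continuous))
  have hz : ∀ t ∈ I, HasDerivAt
      (fun t => (avgH ((y t).2.1 ⊙ (y t).2.1) - 1, avgH ((y t).2.1 ⊙ (y t).2.2.1)))
      (2 * avgH ((y t).2.1 ⊙ (y t).2.2.1), -(c (y t) * (avgH ((y t).2.1 ⊙ (y t).2.1) - 1))) t :=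
    fun t ht => by
      refine HasDerivAt.prodMk ?_ ?_
      · refine ((hasDerivAt_clm avgH (hasDerivAt_mulH (hρ t ht) (hρ t ht))).sub_const 1).congr_deriv
          ?_
        rw [map_add, avgH_apply, avgH_apply, avg_toL2_mulH, avg_toL2_mulH]
        simp only [mul_comm (toC (y t).2.2.1 _)]
        ring
      · refine (hasDerivAt_clm avgH (hasDerivAt_mulH (hρ t ht) (hσ t ht))).congr_deriv ?_
        rw [map_add]
        simp only [c, avgH_apply]
        rw [avg_rho_acc]
        ring
  have h := eq_zero_of_norm_deriv_le hI (k := fun t => 2 + |c (y t)|)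
    (continuousOn_const.add (hc.comp_continuousOn hyc).abs) hz (fun t _ => ?_) ht₀ (by
      simp only [avgH_apply]; rw [ha, hb]; simp) ht
  · rw [Prod.mk_eq_zero, sub_eq_zero] at h
    exact h
  · generalize avgH ((y t).2.1 ⊙ (y t).2.1) - 1 = a
    generalize avgH ((y t).2.1 ⊙ (y t).2.2.1) = b
    have h1 : |a| ≤ ‖(a, b)‖ := norm_fst_le (a, b)
    have h2 : |b| ≤ ‖(a, b)‖ := norm_snd_le (a, b)
    have h3 := norm_nonneg (a, b)
    have h4 := abs_nonneg (c (y t))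
    refine norm_prod_le_iff.2 ⟨?_, ?_⟩
    · rw [Real.norm_eq_abs, abs_mul, abs_two]
      nlinarith
    · rw [Real.norm_eq_abs, abs_neg, abs_mul]
      nlinarith

theorem isOpen_pos : IsOpen {y : State s | ∀ x, 0 < toC y.2.1 x} := by
  have h1 : Continuous fun y : State s => toC y.2.1 := toC.continuous.comp contDiff_rho.continuous
  have h2 : IsOpen {φ : C(Circ, ℝ) | ∀ x, φ x ∈ Ioi 0} := by
    simpa [MapsTo] using ContinuousMap.isOpen_setOfPred_mapsTo isCompact_univ (isOpen_Ioi (a := (0:ℝ)))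
  exact h2.preimage h1

/-- A state, if it is admissible (and a fixed admissible state, if it is not). -/
def toAdm (y : State s) : Adm s := by
  classical
  exact if h : (∀ x, 0 < toC y.2.1 x) ∧ avg (y.2.1 ⊙ y.2.1).toL2 = 1 then ⟨y, h⟩ else admInit 0

theorem toAdm_val {y : State s} (h1 : ∀ x, 0 < toC y.2.1 x) (h2 : avg (y.2.1 ⊙ y.2.1).toL2 = 1) :
    (toAdm y).1 = y := by
  rw [toAdm, dif_pos ⟨h1, h2⟩]

theorem continuousOn_toAdm {X : Type*} [TopologicalSpace X] {A : Set X} {f : X → State s}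
    (hf : ContinuousOn f A) (h1 : ∀ a ∈ A, ∀ x, 0 < toC (f a).2.1 x)
    (h2 : ∀ a ∈ A, avg ((f a).2.1 ⊙ (f a).2.1).toL2 = 1) :
    ContinuousOn (fun a => toAdm (f a)) A :=
  Topology.IsInducing.subtypeVal.continuousOn_iff.2
    (hf.congr fun a ha => toAdm_val (h1 a ha) (h2 a ha))

/-- A curve that solves the equation in Lagrangian variables, with `ρ > 0`, stays in the admissible
states, because the constraints are preserved. -/
theorem isFlow_toAdm {I : Set ℝ} (hI : IsOpen I) (hI' : I.OrdConnected) {y : ℝ → State s}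
    (hy : ∀ t ∈ I, HasDerivAt y (field (y t)) t) {u₀ : Hs s} (h0 : (0 : ℝ) ∈ I)
    (hy0 : y 0 = initState u₀) (hpos : ∀ t ∈ I, ∀ x, 0 < toC (y t).2.1 x) :
    IsFlow I (fun t => toAdm (y t)) := by
  have hc : ∀ t ∈ I, _ := fun t ht => constraints hI' hy h0 (by rw [hy0]; exact avg_initState u₀)
    (by rw [hy0]; exact avg_initState' u₀) ht
  have hv : ∀ t ∈ I, (toAdm (y t)).1 = y t := fun t ht => toAdm_val (hpos t ht) (hc t ht).1
  refine ⟨fun t ht => ?_, fun t ht => ?_⟩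
  · rw [hv t ht]
    refine (hy t ht).congr_of_eventuallyEq ?_
    filter_upwards [hI.mem_nhds ht] with r hr using hv r hr
  · rw [hv t ht]
    exact (hc t ht).2

theorem IsFlow.isSolution {I : Set ℝ} {Y : ℝ → Adm s} (h : IsFlow I Y) (hI : IsOpen I)
    (hI' : I.OrdConnected) {u₀ : Hs s} (h0 : Y 0 = admInit u₀) :
    IsSolution I u₀ (fun t => (Y t).euler) :=
  isSolution_iff.2 ⟨Adm.continuous_euler.comp_continuousOn h.continuousOn,
    fun _ ht => h.hasDerivAt_euler hI hI' ht, by rw [h0, euler_admInit]⟩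

theorem toAdm_initState (u : Hs s) : toAdm (initState u) = admInit u :=
  Subtype.ext (toAdm_val (admInit u).2.1 (admInit u).2.2)

/-- The local flow of the equation in Lagrangian variables, near a given initial state. -/
theorem exists_lagrange_flow (u₀ : Hs s) :
    ∃ T > 0, ∃ δ > 0, ∃ α : Hs s × ℝ → State s,
      ContinuousOn α (Metric.ball u₀ δ ×ˢ Icc (-T) T) ∧
      ∀ v ∈ Metric.ball u₀ δ, α (v, 0) = initState v ∧
        (∀ t ∈ Icc (-T) T, ∀ x, 0 < toC (α (v, t)).2.1 x) ∧
        ∀ t ∈ Icc (-T) T, HasDerivAt (fun t => α (v, t)) (field (α (v, t))) t := by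
  obtain ⟨ε, hε, a, r, L, K, hr, hPL⟩ := IsPicardLindelof.of_contDiffAt_one
    (contDiff_field.contDiffAt (x := initState u₀))
  obtain ⟨α, hα, hαc⟩ := (hPL 0).exists_forall_mem_closedBall_eq_hasDerivWithinAt_continuousOn
  simp only [zero_sub, zero_add] at hα hαc
  have hmem : (initState u₀, (0 : ℝ)) ∈ Metric.closedBall (initState u₀) r ×ˢ Icc (-ε) ε :=
    ⟨Metric.mem_closedBall_self r.2, by constructor <;> linarith⟩
  have hα0 : α (initState u₀, 0) = initState u₀ := (hα _ hmem.1).1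
  have hP : {y : State s | ∀ x, 0 < toC y.2.1 x} ∈ 𝓝 (α (initState u₀, 0)) :=
    isOpen_pos.mem_nhds (by rw [hα0]; exact (admInit u₀).2.1)
  -- the flow stays near the initial state, where `ρ > 0`
  obtain ⟨η, hη, hsub⟩ := Metric.mem_nhdsWithin_iff.1 ((hαc _ hmem).preimage_mem_nhdsWithin hP)
  obtain ⟨δ, hδ, hδ'⟩ := Metric.continuous_iff.1 continuous_initState u₀ (min η r)
    (lt_min hη hr)
  have hm : 0 < min ε η := lt_min hε hη
  have hball : ∀ v ∈ Metric.ball u₀ δ, initState v ∈ Metric.closedBall (initState u₀) r :=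
    fun v hv => ((hδ' v hv).trans_le (min_le_right _ _)).le
  have hTε : ∀ t ∈ Icc (-(min ε η / 2)) (min ε η / 2), t ∈ Ioo (-ε) ε := fun t ht =>
    ⟨by linarith [ht.1, min_le_left ε η], by linarith [ht.2, min_le_left ε η]⟩
  refine ⟨min ε η / 2, half_pos hm, δ, hδ, fun p => α (initState p.1, p.2), ?_, fun v hv =>
    ⟨(hα _ (hball v hv)).1, fun t ht => ?_, fun t ht => ?_⟩⟩
  · refine hαc.comp ((continuous_initState.comp continuous_fst).prodMk
      continuous_snd).continuousOn fun p hp => ?_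
    exact ⟨hball p.1 hp.1, Ioo_subset_Icc_self (hTε _ hp.2)⟩
  · have ht' : |t| ≤ min ε η / 2 := abs_le.2 ht
    have h1 : (initState v, t) ∈ Metric.ball (initState u₀, (0 : ℝ)) η := by
      rw [Metric.mem_ball, Prod.dist_eq, max_lt_iff]
      refine ⟨(hδ' v hv).trans_le (min_le_left _ _), ?_⟩
      rw [Real.dist_eq, sub_zero]
      linarith [min_le_right ε η]
    exact hsub ⟨h1, hball v hv, Ioo_subset_Icc_self (hTε t ht)⟩
  · exact ((hα _ (hball v hv)).2 t (Ioo_subset_Icc_self (hTε t ht))).hasDerivAt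
      (Icc_mem_nhds (hTε t ht).1 (hTε t ht).2)

/-- A family that is jointly continuous on a compact set of times is continuous in the parameter,
uniformly in time. -/
theorem tendstoUniformlyOn_of_continuousOn {X E : Type*} [TopologicalSpace X] [UniformSpace E]
    {U : Set X} (hU : IsOpen U) {K : Set ℝ} (hK : IsCompact K) {f : X → ℝ → E}
    (hf : ContinuousOn (fun p : X × ℝ => f p.1 p.2) (U ×ˢ K)) {v : X} (hv : v ∈ U) :
    TendstoUniformlyOn f (f v) (𝓝 v) K := by
  intro V hV
  obtain ⟨W, hW, hWV⟩ := hK.mem_uniformity_of_prod hf hv (symm_le_uniformity hV)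
  rw [nhdsWithin_eq_nhds.2 (hU.mem_nhds hv)] at hW
  filter_upwards [hW] with w hw t ht using hWV w hw t ht

theorem local_existence (u₀ : Hs s) :
    ∃ T > 0, ∃ δ > 0, ∃ Φ : Hs s → ℝ → Hs s,
      ∀ v₀ ∈ Metric.ball u₀ δ,
        IsSolution (Ioo (-T) T) v₀ (Φ v₀) ∧
        TendstoUniformlyOn Φ (Φ v₀) (𝓝 v₀) (Ioo (-T) T) ∧
        TendstoUniformlyOn (fun w₀ => deriv (lower (Φ w₀))) (deriv (lower (Φ v₀)))
          (𝓝 v₀) (Ioo (-T) T) := by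
  obtain ⟨T, hT, δ, hδ, α, hαc, hα⟩ := exists_lagrange_flow u₀
  have h0 : (0 : ℝ) ∈ Icc (-T) T := ⟨by linarith, hT.le⟩
  have hcon : ∀ v ∈ Metric.ball u₀ δ, ∀ t ∈ Icc (-T) T,
      avg ((α (v, t)).2.1 ⊙ (α (v, t)).2.1).toL2 = 1 := fun v hv t ht =>
    (constraints ordConnected_Icc (hα v hv).2.2 h0
      (by rw [(hα v hv).1]; exact avg_initState v)
      (by rw [(hα v hv).1]; exact avg_initState' v) ht).1
  have hc : ContinuousOn (fun p => (toAdm (α p)).euler) (Metric.ball u₀ δ ×ˢ Icc (-T) T) :=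
    Adm.continuous_euler.comp_continuousOn (continuousOn_toAdm hαc
      (fun p hp => (hα p.1 hp.1).2.1 p.2 hp.2) fun p hp => hcon p.1 hp.1 p.2 hp.2)
  obtain ⟨Φ, hΦ⟩ : ∃ Φ : Hs s → ℝ → Hs s, ∀ v t, Φ v t = (toAdm (α (v, t))).euler :=
    ⟨_, fun _ _ => rfl⟩
  have hΦc : ContinuousOn (fun p : Hs s × ℝ => Φ p.1 p.2) (Metric.ball u₀ δ ×ˢ Icc (-T) T) :=
    hc.congr fun p _ => hΦ p.1 p.2
  have hIs : ∀ v ∈ Metric.ball u₀ δ, IsSolution (Ioo (-T) T) v (Φ v) := fun v hv => by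
    have h1 := isFlow_toAdm (y := fun t => α (v, t)) isOpen_Ioo ordConnected_Ioo
      (fun t ht => (hα v hv).2.2 t (Ioo_subset_Icc_self ht)) ⟨by linarith, hT⟩
      (hα v hv).1 fun t ht => (hα v hv).2.1 t (Ioo_subset_Icc_self ht)
    have h2 := h1.isSolution isOpen_Ioo ordConnected_Ioo (u₀ := v)
      ((congrArg toAdm (hα v hv).1).trans (toAdm_initState v))
    have e : Φ v = fun t => (toAdm (α (v, t))).euler := funext fun t => hΦ v t
    rwa [e]
  refine ⟨T, hT, δ, hδ, Φ, fun v₀ hv₀ => ⟨hIs v₀ hv₀, (tendstoUniformlyOn_of_continuousOn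
    Metric.isOpen_ball isCompact_Icc hΦc hv₀).mono Ioo_subset_Icc_self, ?_⟩⟩
  have hder : ∀ v ∈ Metric.ball u₀ δ, ∀ t ∈ Ioo (-T) T, rhsH (Φ v t) = deriv (lower (Φ v)) t :=
    fun v hv t ht => ((equation_iff _ _).1 ((hIs v hv).equation t ht)).symm
  have hr := (tendstoUniformlyOn_of_continuousOn (f := fun v t => rhsH (Φ v t))
    Metric.isOpen_ball isCompact_Icc (continuous_rhsH.comp_continuousOn hΦc) hv₀).mono
    (Ioo_subset_Icc_self : Ioo (-T) T ⊆ _)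
  refine (hr.congr ?_).congr_right (hder v₀ hv₀)
  filter_upwards [Metric.isOpen_ball.mem_nhds hv₀] with v hv using hder v hv

end Local

/-! ### Uniqueness -/

section Uniqueness

variable {s : ℝ} [hs : Fact (3 / 2 < s)]

theorem mulH_comm [Fact (1 / 2 < θ)] (f g : Hs θ) : f ⊙ g = g ⊙ f :=
  toC_injective (by rw [toC_mulH, toC_mulH, mul_comm])

theorem fluxH_sub (z w : Hs s) (hw : avg w.toL2 = 0) :
    fluxH (z + w) - fluxH (z - w)
      = (4 * avg z.toL2) • lowH s w + (2 : ℝ) • (dH s z ⊙ dH s w) := by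
  refine toC_injective ?_
  ext x
  have h1 : toC (fluxH (z + w) - fluxH (z - w)) x
      = toC (fluxH (z + w)) x - toC (fluxH (z - w)) x := by rw [map_sub]; rfl
  rw [h1, toC_fluxH, toC_fluxH, avg_toL2_add, avg_toL2_sub, hw, map_add (dH s), map_sub (dH s),
    map_add, map_sub, map_add, map_sub, map_add, map_smul, map_smul, toC_lowH, toC_mulH]
  simp only [ContinuousMap.add_apply, ContinuousMap.sub_apply, ContinuousMap.smul_apply,
    ContinuousMap.mul_apply, smul_eq_mul]
  ring

/-- The difference of the right-hand sides for two functions, in terms of half their sum and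
half their difference. -/
theorem rhsH_sub (z w : Hs s) (hw : avg w.toL2 = 0) :
    rhsH (z + w) - rhsH (z - w) = (2 : ℝ) • (-(lowH s z ⊙ dH s w + dH s z ⊙ lowH s w)
      + lowH s (iH s ((2 * avg z.toL2) • lowH s w + dH s z ⊙ dH s w))) := by
  have h : rhsH (z + w) - rhsH (z - w) = (2 : ℝ) • (-(lowH s z ⊙ dH s w + dH s z ⊙ lowH s w))
      + lowH s (iH s (fluxH (z + w) - fluxH (z - w))) := by
    rw [map_sub (iH s), map_sub (lowH s), rhsH, rhsH, map_add (dH s), map_sub (dH s),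
      map_add (lowH s) z, map_sub (lowH s) z]
    have e : (lowH s z + lowH s w) ⊙ (dH s z + dH s w) - (lowH s z - lowH s w) ⊙ (dH s z - dH s w)
        = (2 : ℝ) • (lowH s z ⊙ dH s w + dH s z ⊙ lowH s w) := by
      rw [mulH_comm (dH s z)]
      simp only [map_add, map_sub, _root_.add_apply, _root_.sub_apply]
      rw [two_smul]
      abel
    rw [smul_neg, ← e]
    abel
  have e2 : fluxH (z + w) - fluxH (z - w)
      = (2 : ℝ) • ((2 * avg z.toL2) • lowH s w + dH s z ⊙ dH s w) := by
    rw [fluxH_sub z w hw, smul_add, smul_smul]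
    ring_nf
  rw [h, e2, map_smul, map_smul, smul_add]

theorem abs_mul_dSym_inv (n : ℤ) :
    ((|n| : ℤ) : ℂ) * (dSym n)⁻¹ = (2 * Real.pi * Complex.I)⁻¹ * (n.sign : ℂ) := by
  rcases eq_or_ne n 0 with rfl | hn
  · simp
  have hn' : (n : ℂ) ≠ 0 := by exact_mod_cast hn
  have h : ((|n| : ℤ) : ℂ) = n.sign * n := by exact_mod_cast (Int.sign_mul_self_eq_abs n).symm
  rw [h, show dSym n = 2 * Real.pi * Complex.I * n by unfold dSym; ring, mul_inv]
  field_simp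

/-- The coefficients of `|∂ₓ|` applied to half the difference of the right-hand sides. The
leading symbol `n² - nk + k²` is symmetric in `n` and `k`. -/
theorem hasSum_hat_rhsH_sub (z w : Hs s) (hw : avg w.toL2 = 0) (n : ℤ) :
    HasSum (fun k => -(2 * Real.pi * Complex.I) * n.sign * (n ^ 2 - n * k + k ^ 2 : ℤ)
        * (z.hat (n - k) * w.hat k))
      (((|n| : ℤ) : ℂ) * ((1 / 2 : ℝ) • (rhsH (z + w) - rhsH (z - w))).hat n
        - (2 * Real.pi * Complex.I)⁻¹ * n.sign * (2 * avg z.toL2 : ℝ) * w.hat n) := by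
  have h1 := hasSum_hat_mulH (lowH s z) (dH s w) n
  have h2 := hasSum_hat_mulH (dH s z) (lowH s w) n
  have h3 := hasSum_hat_mulH (dH s z) (dH s w) n
  have h := ((h1.add h2).mul_left (-((|n| : ℤ) : ℂ))).add
    (h3.mul_left (((|n| : ℤ) : ℂ) * (dSym n)⁻¹))
  rw [rhsH_sub z w hw, smul_smul]
  norm_num only [one_smul]
  rw [Hs.hat_add, Hs.hat_neg, Hs.hat_add, hat_lowH, hat_iH, Hs.hat_add, Hs.hat_smul, hat_lowH]
  have hI : (2 * Real.pi * Complex.I : ℂ) ≠ 0 := Complex.two_pi_I_ne_zero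
  have hs : ((|n| : ℤ) : ℂ) = n.sign * n := by exact_mod_cast (Int.sign_mul_self_eq_abs n).symm
  have hd : ∀ m : ℤ, dSym m = 2 * Real.pi * Complex.I * m := fun m => by unfold dSym; ring
  rw [abs_mul_dSym_inv] at h
  convert h using 1
  · rfl
  · funext k
    rw [hat_dH, hat_dH, hat_lowH, hat_lowH, hd, hd, hs]
    push_cast
    field_simp
    ring
  · rw [mul_add, ← mul_assoc, abs_mul_dSym_inv]
    ring

theorem opposite_sign_le {s x y : ℝ} (hs : 3 / 2 < s) (hx : 0 < x) (hy : 0 < y) :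
    (x + y) ^ 2 ≤ 2 * (x + y) ^ s * (√x * √y * (y ^ (1 - s) + x ^ (1 - s))) := by
  wlog h : y ≤ x generalizing x y
  · have := this hy hx (le_of_not_ge h)
    rw [add_comm x y, mul_comm √x √y, add_comm (y ^ (1 - s))]
    exact this
  have h1 : √(x + y) ≤ 2 * √x := by
    refine Real.sqrt_le_iff.2 ⟨by positivity, ?_⟩
    rw [mul_pow, Real.sq_sqrt hx.le]
    linarith
  have h2 : (x + y) ^ (3 / 2 - s) ≤ √y * y ^ (1 - s) := by
    refine (Real.rpow_le_rpow_of_nonpos hy (by linarith : y ≤ x + y) (by linarith)).trans_eq ?_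
    rw [Real.sqrt_eq_rpow, ← Real.rpow_add hy]
    ring_nf
  have h3 : (x + y) ^ 2 = (x + y) ^ s * (√(x + y) * (x + y) ^ (3 / 2 - s)) := by
    rw [Real.sqrt_eq_rpow, ← Real.rpow_add (by positivity), ← Real.rpow_add (by positivity),
      ← Real.rpow_natCast]
    congr 1
    push_cast
    ring
  rw [h3]
  have h4 : √(x + y) * (x + y) ^ (3 / 2 - s) ≤ 2 * √x * (√y * y ^ (1 - s)) := by gcongr
  have h5 : 0 ≤ 2 * √x * √y * x ^ (1 - s) := by positivity
  calc _ ≤ (x + y) ^ s * (2 * (√x * √y * (y ^ (1 - s) + x ^ (1 - s)))) :=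
        mul_le_mul_of_nonneg_left (by linarith) (by positivity)
    _ = _ := by ring

/-- The antisymmetrized symbol vanishes unless `n` and `k` have opposite signs, and then the
frequency `n - k` dominates both. -/
theorem sign_symbol_le {s : ℝ} (hs : 3 / 2 < s) {n k : ℤ} (hn : n ≠ 0) (hk : k ≠ 0) :
    |((n.sign - k.sign : ℤ) : ℝ)| * |((n ^ 2 - n * k + k ^ 2 : ℤ) : ℝ)|
      ≤ 4 * weight (n - k) ^ (s / 2)
        * (√|(n : ℝ)| * √|(k : ℝ)| * (|(k : ℝ)| ^ (1 - s) + |(n : ℝ)| ^ (1 - s))) := by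
  have hw := weight_pos (n - k)
  have hx : 0 < |(n : ℝ)| := by positivity
  have hy : 0 < |(k : ℝ)| := by positivity
  have key : n * k < 0 → ((n.sign - k.sign : ℤ) : ℝ) = 2 ∨ ((n.sign - k.sign : ℤ) : ℝ) = -2 →
      |(n : ℝ)| + |(k : ℝ)| = |(n : ℝ) - k| → |((n.sign - k.sign : ℤ) : ℝ)| *
      |((n ^ 2 - n * k + k ^ 2 : ℤ) : ℝ)| ≤ 4 * weight (n - k) ^ (s / 2)
        * (√|(n : ℝ)| * √|(k : ℝ)| * (|(k : ℝ)| ^ (1 - s) + |(n : ℝ)| ^ (1 - s))) := by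
    intro hnk h2 hm
    have h2' : |((n.sign - k.sign : ℤ) : ℝ)| = 2 := by rcases h2 with h | h <;> rw [h] <;> norm_num
    have hnk' : (n : ℝ) * k < 0 := by exact_mod_cast hnk
    have hq : |((n ^ 2 - n * k + k ^ 2 : ℤ) : ℝ)| ≤ (|(n : ℝ)| + |(k : ℝ)|) ^ 2 := by
      rw [hm, sq_abs]
      push_cast
      rw [abs_of_nonneg (by nlinarith)]
      nlinarith
    have hms : (|(n : ℝ)| + |(k : ℝ)|) ^ s ≤ weight (n - k) ^ (s / 2) := by
      have e : (|(n : ℝ)| + |(k : ℝ)|) ^ s = ((|(n : ℝ)| + |(k : ℝ)|) ^ 2) ^ (s / 2) := by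
        rw [← Real.rpow_natCast, ← Real.rpow_mul (by positivity)]
        congr 1
        push_cast
        ring
      rw [e]
      refine Real.rpow_le_rpow (by positivity) ?_ (by linarith)
      rw [hm, sq_abs, weight, mul_pow]
      push_cast
      have : 1 ≤ (2 * Real.pi) ^ 2 := by nlinarith [Real.pi_gt_three]
      nlinarith [sq_nonneg ((n : ℝ) - k)]
    rw [h2']
    calc 2 * |((n ^ 2 - n * k + k ^ 2 : ℤ) : ℝ)|
        ≤ 2 * (2 * (|(n : ℝ)| + |(k : ℝ)|) ^ s
          * (√|(n : ℝ)| * √|(k : ℝ)| * (|(k : ℝ)| ^ (1 - s) + |(n : ℝ)| ^ (1 - s)))) := by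
          gcongr
          exact hq.trans (opposite_sign_le hs hx hy)
      _ = 4 * (|(n : ℝ)| + |(k : ℝ)|) ^ s
          * (√|(n : ℝ)| * √|(k : ℝ)| * (|(k : ℝ)| ^ (1 - s) + |(n : ℝ)| ^ (1 - s))) := by ring
      _ ≤ _ := by gcongr
  have triv : n.sign = k.sign → |((n.sign - k.sign : ℤ) : ℝ)| *
      |((n ^ 2 - n * k + k ^ 2 : ℤ) : ℝ)| ≤ 4 * weight (n - k) ^ (s / 2)
        * (√|(n : ℝ)| * √|(k : ℝ)| * (|(k : ℝ)| ^ (1 - s) + |(n : ℝ)| ^ (1 - s))) := by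
    intro h
    rw [h, sub_self, Int.cast_zero, abs_zero, zero_mul]
    positivity
  rcases hn.lt_or_gt with h | h <;> rcases hk.lt_or_gt with h' | h'
  · exact triv (by rw [Int.sign_eq_neg_one_of_neg h, Int.sign_eq_neg_one_of_neg h'])
  · have h1 : (n : ℝ) < 0 := by exact_mod_cast h
    have h2 : (0 : ℝ) < k := by exact_mod_cast h'
    refine key (mul_neg_of_neg_of_pos h h') (Or.inr ?_) ?_
    · rw [Int.sign_eq_neg_one_of_neg h, Int.sign_eq_one_of_pos h']
      norm_num
    · rw [abs_of_neg h1, abs_of_pos h2, abs_of_neg (by linarith)]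
      ring
  · have h1 : (0 : ℝ) < n := by exact_mod_cast h
    have h2 : (k : ℝ) < 0 := by exact_mod_cast h'
    refine key (mul_neg_of_pos_of_neg h h') (Or.inl ?_) ?_
    · rw [Int.sign_eq_neg_one_of_neg h', Int.sign_eq_one_of_pos h]
      norm_num
    · rw [abs_of_neg h2, abs_of_pos h1, abs_of_pos (by linarith)]
      ring
  · exact triv (by rw [Int.sign_eq_one_of_pos h, Int.sign_eq_one_of_pos h'])

theorem tsum_trilinear_sq_le (a κ b : ℤ → ENNReal) :
    (∑' n, ∑' k, a (n - k) * (κ k * b k) * b n) ^ 2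
      ≤ (∑' k, κ k ^ 2) * (∑' k, a k ^ 2) * (∑' k, b k ^ 2) ^ 2 := by
  simp_rw [ENNReal.tsum_mul_right]
  refine (ennreal_tsum_mul_sq_le _ _).trans ?_
  have h1 : ∑' n, (∑' k, a (n - k) * (κ k * b k)) ^ 2 ≤ (∑' k, κ k * b k) ^ 2 * ∑' k, a k ^ 2 := by
    simp_rw [tsum_conv_comm a (fun k => κ k * b k)]
    exact young _ _
  calc _ ≤ ((∑' k, κ k * b k) ^ 2 * ∑' k, a k ^ 2) * ∑' k, b k ^ 2 := by gcongr
    _ ≤ (((∑' k, κ k ^ 2) * ∑' k, b k ^ 2) * ∑' k, a k ^ 2) * ∑' k, b k ^ 2 := by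
        gcongr
        exact ennreal_tsum_mul_sq_le _ _
    _ = _ := by ring

theorem isSymbol_half : IsSymbol (s - 1) 0 1 (fun n => ((√|(n : ℝ)| : ℝ) : ℂ)) where
  nonneg := zero_le_one
  conj_symm n := by simp
  bound n := by
    have hw := one_le_weight n
    have h1 : |(n : ℝ)| ≤ weight n ^ (1 / 2 : ℝ) := by
      rw [← Real.sqrt_eq_rpow]
      refine Real.abs_le_sqrt ?_
      rw [weight, mul_pow]
      have : 1 ≤ (2 * Real.pi) ^ 2 := by nlinarith [Real.pi_gt_three]
      nlinarith [sq_nonneg (n : ℝ)]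
    have h2 : weight n ^ (1 / 2 : ℝ) ≤ weight n ^ (s - 1) :=
      Real.rpow_le_rpow_of_exponent_le hw (fact_sub_one (s := s)).out.le
    rw [Real.rpow_zero, one_mul, one_pow, one_mul, Complex.norm_real, Real.norm_eq_abs, sq_abs,
      Real.sq_sqrt (abs_nonneg _)]
    exact h1.trans h2

/-- The operator `|∂ₓ / 2πi|^{1/2}` from `H^{s-1}` to `L²`. -/
def halfD (s : ℝ) [hs : Fact (3 / 2 < s)] : Hs (s - 1) →L[ℝ] L2 :=
  (toL2CLM le_rfl).comp (mult le_rfl isSymbol_half)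

theorem coeff_halfD (f : Hs (s - 1)) (n : ℤ) :
    coeff (halfD s f) n = ((√|(n : ℝ)| : ℝ) : ℂ) * f.hat n := hat_mult le_rfl isSymbol_half f n

theorem hasSum_inner_halfD (f g : Hs (s - 1)) :
    HasSum (fun n => ((|n| : ℤ) : ℂ) * g.hat n * conj (f.hat n))
      ((inner ℝ (halfD s f) (halfD s g) : ℝ) : ℂ) := by
  convert hasSum_coeff_mul (halfD s f) (halfD s g) using 1
  funext n
  rw [coeff_halfD, coeff_halfD, map_mul, Complex.conj_ofReal]
  have h : ((|n| : ℤ) : ℂ) = ((√|(n : ℝ)| : ℝ) : ℂ) * ((√|(n : ℝ)| : ℝ) : ℂ) := by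
    rw [← Complex.ofReal_mul, Real.mul_self_sqrt (abs_nonneg _), ← Int.cast_abs,
      Complex.ofReal_intCast]
  rw [h]
  ring

theorem tsum_halfD (f : Hs (s - 1)) :
    ∑' n : ℤ, ENNReal.ofReal (√|(n : ℝ)| * ‖f.hat n‖) ^ 2 = ENNReal.ofReal (‖halfD s f‖ ^ 2) := by
  have h := hasSum_norm_coeff_sq (halfD s f)
  rw [← h.tsum_eq, ENNReal.ofReal_tsum_of_nonneg (fun n => sq_nonneg _) h.summable]
  refine tsum_congr fun n => ?_
  rw [coeff_halfD, norm_mul, Complex.norm_real, Real.norm_of_nonneg (Real.sqrt_nonneg _),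
    ENNReal.ofReal_pow (by positivity)]


/-- The terms of the double series for the time derivative of the energy. -/
def energyTerm (z w : ℤ → ℂ) (p : ℤ × ℤ) : ℂ :=
  -(2 * Real.pi * Complex.I) * p.1.sign * (p.1 ^ 2 - p.1 * p.2 + p.2 ^ 2 : ℤ)
    * (z (p.1 - p.2) * w p.2) * conj (w p.1)

theorem norm_energyTerm_le (z w : ℤ → ℂ) (n k : ℤ) :
    ‖energyTerm z w (n, k)‖ ≤ 4 * Real.pi * (weight n * ‖w n‖ * (‖z (n - k)‖ * ‖w k‖)
      + weight k * ‖w k‖ * (‖z (n - k)‖ * ‖w n‖)) := by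
  have hw : ∀ m : ℤ, (m : ℝ) ^ 2 ≤ weight m := fun m => by
    rw [weight, mul_pow]
    have : 1 ≤ (2 * Real.pi) ^ 2 := by nlinarith [Real.pi_gt_three]
    nlinarith [sq_nonneg (m : ℝ)]
  have h1 : ‖((n.sign : ℤ) : ℂ)‖ ≤ 1 := by
    rcases Int.sign_trichotomy n with h | h | h <;> rw [h] <;> simp
  have h2 : ‖((n ^ 2 - n * k + k ^ 2 : ℤ) : ℂ)‖ ≤ 2 * (weight n + weight k) := by
    rw [Complex.norm_intCast]
    push_cast
    rw [abs_of_nonneg (by nlinarith [sq_nonneg ((n : ℝ) - k), sq_nonneg (n : ℝ), sq_nonneg (k : ℝ)])]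
    nlinarith [hw n, hw k, sq_nonneg ((n : ℝ) + k)]
  have h3 : ‖-(2 * Real.pi * Complex.I : ℂ)‖ = 2 * Real.pi := by
    simp [abs_of_pos Real.pi_pos]
  have hp1 := weight_pos n
  have hp2 := weight_pos k
  have hpi := Real.pi_pos
  simp only [energyTerm, norm_mul, h3, RCLike.norm_conj]
  calc _ ≤ 2 * Real.pi * 1 * (2 * (weight n + weight k)) * (‖z (n - k)‖ * ‖w k‖) * ‖w n‖ := by
        gcongr
    _ = _ := by ring

theorem tsum_weight_conv_ne_top (hs1 : 1 ≤ s) (z w : Hs s) :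
    ∑' n, ∑' k, ENNReal.ofReal (weight n * ‖w.hat n‖ * (‖z.hat (n - k)‖ * ‖w.hat k‖)) ≠ ⊤ := by
  have hp := weight_pos
  have fin1 : ∀ f : Hs s, sobSq 1 f.hat ≠ ⊤ := fun f =>
    ne_top_of_le_ne_top (by rw [Hs.sobSq_hat]; exact ENNReal.ofReal_ne_top) (sobSq_mono hs1 f.hat)
  have fin0 : ∀ f : Hs s, sobSq 0 f.hat ≠ ⊤ := fun f =>
    ne_top_of_le_ne_top (fin1 f) (sobSq_mono zero_le_one f.hat)
  set H : ℤ → ENNReal := fun n => ∑' k, ENNReal.ofReal ‖z.hat (n - k)‖ * ENNReal.ofReal ‖w.hat k‖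
    with hH
  have hHfin : ∀ n, H n ≠ ⊤ := fun n h => by
    have := ennreal_tsum_mul_sq_le (fun k => ENNReal.ofReal ‖z.hat (n - k)‖)
      (fun k => ENNReal.ofReal ‖w.hat k‖)
    rw [show ∑' k, ENNReal.ofReal ‖z.hat (n - k)‖ * ENNReal.ofReal ‖w.hat k‖ = ⊤ from h,
      tsum_sub_left (fun k => ENNReal.ofReal ‖z.hat k‖ ^ 2), ← sobSq_zero_eq, ← sobSq_zero_eq] at this
    exact ENNReal.mul_ne_top (fin0 z) (fin0 w) (top_le_iff.1 (by simpa using this))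
  have hHr : ∀ n, ENNReal.ofReal ‖(((H n).toReal : ℝ) : ℂ)‖ = H n := fun n => by
    rw [Complex.norm_real, Real.norm_of_nonneg ENNReal.toReal_nonneg, ENNReal.ofReal_toReal (hHfin n)]
  have h1 := sobSq_conv_le (zero_le_one (α := ℝ)) (f := z.hat) (g := w.hat)
    (h := fun n => (((H n).toReal : ℝ) : ℂ)) (fun n => (hHr n).le)
  have h2 : sobSq 1 (fun n => (((H n).toReal : ℝ) : ℂ)) ≠ ⊤ := by
    refine ne_top_of_le_ne_top ?_ h1
    rw [Hs.wSum_eq, Hs.wSum_eq]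
    finiteness [fin1 z, fin1 w]
  have h3 : ∀ n, ∑' k, ENNReal.ofReal (weight n * ‖w.hat n‖ * (‖z.hat (n - k)‖ * ‖w.hat k‖))
      = ENNReal.ofReal (weight n ^ ((1 : ℝ) / 2) * ‖w.hat n‖)
        * ENNReal.ofReal (weight n ^ ((1 : ℝ) / 2) * ‖(((H n).toReal : ℝ) : ℂ)‖) := fun n => by
    have := hp n
    have e : weight n = weight n ^ ((1 : ℝ) / 2) * weight n ^ ((1 : ℝ) / 2) := by
      rw [← Real.rpow_add this]; norm_num
    rw [ENNReal.ofReal_mul (p := weight n ^ ((1 : ℝ) / 2)) (q := ‖(((H n).toReal : ℝ) : ℂ)‖)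
      (by positivity), hHr, hH, ← ENNReal.tsum_mul_left, ← ENNReal.tsum_mul_left]
    refine tsum_congr fun k => ?_
    rw [← ENNReal.ofReal_mul (by positivity), ← ENNReal.ofReal_mul (by positivity),
      ← ENNReal.ofReal_mul (by positivity)]
    congr 1
    nth_rewrite 1 [e]
    ring
  simp_rw [h3]
  have h4 := ennreal_tsum_mul_sq_le (fun n => ENNReal.ofReal (weight n ^ ((1 : ℝ) / 2) * ‖w.hat n‖))
    (fun n => ENNReal.ofReal (weight n ^ ((1 : ℝ) / 2) * ‖(((H n).toReal : ℝ) : ℂ)‖))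
  rw [← sobSq_eq_tsum_sq, ← sobSq_eq_tsum_sq] at h4
  intro h5
  rw [h5] at h4
  exact ENNReal.mul_ne_top (fin1 w) h2 (top_le_iff.1 (by simpa using h4))

theorem tsum_swap_conv (z w v : ℤ → ℂ) (hz : ∀ n, ‖z (-n)‖ = ‖z n‖) (f : ℤ → ℝ) :
    ∑' n, ∑' k, ENNReal.ofReal (f k * ‖w k‖ * (‖z (n - k)‖ * ‖v n‖))
      = ∑' n, ∑' k, ENNReal.ofReal (f n * ‖w n‖ * (‖z (n - k)‖ * ‖v k‖)) := by
  rw [ENNReal.tsum_comm]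
  refine tsum_congr fun n => tsum_congr fun k => ?_
  rw [← hz, neg_sub]

theorem summable_norm_energyTerm (z w : Hs s) :
    Summable fun p => ‖energyTerm z.hat w.hat p‖ := by
  have hp := weight_pos
  have hpi := Real.pi_pos
  have hz : ∀ n, ‖z.hat (-n)‖ = ‖z.hat n‖ := fun n => by rw [Hs.hat_conj, RCLike.norm_conj]
  have h1 : ∑' n, ∑' k, ENNReal.ofReal (weight n * ‖w.hat n‖ * (‖z.hat (n - k)‖ * ‖w.hat k‖)) ≠ ⊤ :=
    tsum_weight_conv_ne_top (by linarith [hs.out]) z w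
  have h2 : ∑' p, ENNReal.ofReal ‖energyTerm z.hat w.hat p‖ ≠ ⊤ := by
    rw [ENNReal.tsum_prod']
    refine ne_top_of_le_ne_top ?_ (ENNReal.tsum_le_tsum fun n => ENNReal.tsum_le_tsum fun k =>
      ENNReal.ofReal_le_ofReal (norm_energyTerm_le z.hat w.hat n k))
    have e : ∀ n k : ℤ, ENNReal.ofReal (4 * Real.pi * (weight n * ‖w.hat n‖
        * (‖z.hat (n - k)‖ * ‖w.hat k‖) + weight k * ‖w.hat k‖ * (‖z.hat (n - k)‖ * ‖w.hat n‖)))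
        = ENNReal.ofReal (4 * Real.pi) * (ENNReal.ofReal (weight n * ‖w.hat n‖
          * (‖z.hat (n - k)‖ * ‖w.hat k‖)) + ENNReal.ofReal (weight k * ‖w.hat k‖
          * (‖z.hat (n - k)‖ * ‖w.hat n‖))) := fun n k => by
      have := hp n
      have := hp k
      rw [ENNReal.ofReal_mul (by positivity), ENNReal.ofReal_add (by positivity) (by positivity)]
    simp_rw [e, ENNReal.tsum_mul_left, ENNReal.tsum_add, tsum_swap_conv z.hat w.hat w.hat hz weight]
    exact ENNReal.mul_ne_top ENNReal.ofReal_ne_top (ENNReal.add_ne_top.2 ⟨h1, h1⟩)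
  refine (ENNReal.summable_toReal h2).congr fun p => ?_
  rw [ENNReal.toReal_ofReal (norm_nonneg _)]

theorem norm_energyTerm_add_le (z w : ℤ → ℂ) (hz : ∀ n, z (-n) = conj (z n))
    (hw : w 0 = 0) (n k : ℤ) :
    ‖energyTerm z w (n, k) + conj (energyTerm z w (k, n))‖ ≤ 8 * Real.pi *
      (weight (n - k) ^ (s / 2) * ‖z (n - k)‖ * (|(k : ℝ)| ^ (1 - s) * (√|(k : ℝ)| * ‖w k‖))
          * (√|(n : ℝ)| * ‖w n‖)
        + weight (n - k) ^ (s / 2) * ‖z (n - k)‖ * (|(n : ℝ)| ^ (1 - s) * (√|(n : ℝ)| * ‖w n‖))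
          * (√|(k : ℝ)| * ‖w k‖)) := by
  have hpi := Real.pi_pos
  have hp := weight_pos (n - k)
  have e : energyTerm z w (n, k) + conj (energyTerm z w (k, n))
      = -(2 * Real.pi * Complex.I) * (n.sign - k.sign : ℤ) * (n ^ 2 - n * k + k ^ 2 : ℤ)
        * (z (n - k) * w k) * conj (w n) := by
    simp only [energyTerm]
    rw [← neg_sub n k, hz]
    simp only [map_mul, map_neg, Complex.conj_ofReal, Complex.conj_I, Complex.conj_conj,
      Complex.conj_ofNat, map_intCast]
    push_cast
    ring
  rw [e]
  simp only [norm_mul, RCLike.norm_conj]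
  rcases eq_or_ne n 0 with rfl | hn
  · rw [hw, norm_zero]
    simp only [mul_zero]
    positivity
  rcases eq_or_ne k 0 with rfl | hk
  · rw [hw, norm_zero]
    simp only [mul_zero, zero_mul]
    positivity
  have h := sign_symbol_le hs.out hn hk
  have h3 : ‖-(2 * Real.pi * Complex.I : ℂ)‖ = 2 * Real.pi := by
    simp [abs_of_pos Real.pi_pos]
  rw [h3, Complex.norm_intCast, Complex.norm_intCast]
  have h4 := mul_le_mul_of_nonneg_left h (by positivity :
    0 ≤ 2 * Real.pi * (‖z (n - k)‖ * ‖w k‖ * ‖w n‖))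
  calc _ = _ := ?_
    _ ≤ _ := h4
    _ = _ := ?_
  · ring
  · ring

/-- The squared `ℓ²` norm of `|k|^{1-s}`, which is finite as `s > 3/2`. -/
def tailConst (s : ℝ) : ℝ := ∑' k : ℤ, |(k : ℝ)| ^ (2 * (1 - s))

theorem tsum_tail : ∑' k : ℤ, ENNReal.ofReal (|(k : ℝ)| ^ (1 - s)) ^ 2
    = ENNReal.ofReal (tailConst s) := by
  have h : Summable fun k : ℤ => |(k : ℝ)| ^ (-(2 * (s - 1))) :=
    Real.summable_abs_int_rpow (by linarith [hs.out])
  rw [tailConst, ENNReal.ofReal_tsum_of_nonneg (fun k => by positivity) (h.congr fun k => by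
    congr 1; ring)]
  refine tsum_congr fun k => ?_
  rw [← ENNReal.ofReal_pow (by positivity), ← Real.rpow_natCast, ← Real.rpow_mul (abs_nonneg _)]
  congr 2
  push_cast
  ring

theorem tailConst_nonneg (s : ℝ) : 0 ≤ tailConst s := tsum_nonneg fun _ => by positivity

theorem tsum_norm_energyTerm_add_le (z w : Hs s) (hw : avg w.toL2 = 0) :
    ∑' p : ℤ × ℤ, ‖energyTerm z.hat w.hat p + conj (energyTerm z.hat w.hat p.swap)‖
      ≤ 16 * Real.pi * √(tailConst s) * ‖z‖ * ‖halfD s (lowH s w)‖ ^ 2 := by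
  have hpi := Real.pi_pos
  have hz : ∀ n, ‖z.hat (-n)‖ = ‖z.hat n‖ := fun n => by rw [Hs.hat_conj, RCLike.norm_conj]
  have hw0 : w.hat 0 = 0 := by rw [Hs.hat_zero_eq, hw, Complex.ofReal_zero]
  set a : ℤ → ENNReal := fun m => ENNReal.ofReal (weight m ^ (s / 2) * ‖z.hat m‖) with ha
  set κ : ℤ → ENNReal := fun k => ENNReal.ofReal (|(k : ℝ)| ^ (1 - s)) with hκ
  set b : ℤ → ENNReal := fun k => ENNReal.ofReal (√|(k : ℝ)| * ‖w.hat k‖) with hb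
  have haneg : ∀ m, a (-m) = a m := fun m => by simp only [ha, hz]; simp [weight]
  set X := ∑' n, ∑' k, a (n - k) * (κ k * b k) * b n with hX
  have hX' : ∑' n, ∑' k, a (n - k) * (κ n * b n) * b k = X := by
    rw [hX, ENNReal.tsum_comm]
    refine tsum_congr fun n => tsum_congr fun k => ?_
    rw [← haneg, neg_sub]
  have hXle : X ≤ ENNReal.ofReal (√(tailConst s) * ‖z‖ * ‖halfD s (lowH s w)‖ ^ 2) := by
    have h := tsum_trilinear_sq_le a κ b
    have hb2 : ∑' k, b k ^ 2 = ENNReal.ofReal (‖halfD s (lowH s w)‖ ^ 2) := by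
      rw [← tsum_halfD]
      simp only [hat_lowH, hb]
    have hκ2 : ∑' k, κ k ^ 2 = ENNReal.ofReal (tailConst s) := tsum_tail
    rw [hκ2, ← sobSq_eq_tsum_sq, Hs.sobSq_hat, hb2, ← ENNReal.ofReal_pow (by positivity),
      ← ENNReal.ofReal_mul (tailConst_nonneg s),
      ← ENNReal.ofReal_mul (mul_nonneg (tailConst_nonneg s) (sq_nonneg _))] at h
    have e : tailConst s * ‖z‖ ^ 2 * (‖halfD s (lowH s w)‖ ^ 2) ^ 2
        = (√(tailConst s) * ‖z‖ * ‖halfD s (lowH s w)‖ ^ 2) ^ 2 := by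
      rw [mul_pow, mul_pow, Real.sq_sqrt (tailConst_nonneg s)]
    rw [e, ENNReal.ofReal_pow (by positivity)] at h
    exact (ENNReal.pow_le_pow_left_iff two_ne_zero).1 h
  have h1 : ∑' p : ℤ × ℤ, ENNReal.ofReal
      ‖energyTerm z.hat w.hat p + conj (energyTerm z.hat w.hat p.swap)‖
      ≤ ENNReal.ofReal (16 * Real.pi * √(tailConst s) * ‖z‖ * ‖halfD s (lowH s w)‖ ^ 2) := by
    rw [ENNReal.tsum_prod']
    refine (ENNReal.tsum_le_tsum fun n => ENNReal.tsum_le_tsum fun k => ENNReal.ofReal_le_ofReal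
      (norm_energyTerm_add_le (s := s) z.hat w.hat z.hat_conj hw0 n k)).trans ?_
    have e : ∀ n k : ℤ, ENNReal.ofReal (8 * Real.pi *
        (weight (n - k) ^ (s / 2) * ‖z.hat (n - k)‖ * (|(k : ℝ)| ^ (1 - s)
            * (√|(k : ℝ)| * ‖w.hat k‖)) * (√|(n : ℝ)| * ‖w.hat n‖)
          + weight (n - k) ^ (s / 2) * ‖z.hat (n - k)‖ * (|(n : ℝ)| ^ (1 - s)
            * (√|(n : ℝ)| * ‖w.hat n‖)) * (√|(k : ℝ)| * ‖w.hat k‖)))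
        = ENNReal.ofReal (8 * Real.pi) * (a (n - k) * (κ k * b k) * b n
          + a (n - k) * (κ n * b n) * b k) := fun n k => by
      have hp := weight_pos (n - k)
      simp only [ha, hκ, hb]
      rw [← ENNReal.ofReal_mul (by positivity), ← ENNReal.ofReal_mul (by positivity),
        ← ENNReal.ofReal_mul (by positivity), ← ENNReal.ofReal_mul (by positivity),
        ← ENNReal.ofReal_mul (by positivity), ← ENNReal.ofReal_mul (by positivity),
        ← ENNReal.ofReal_add (by positivity) (by positivity), ← ENNReal.ofReal_mul (by positivity)]
    simp_rw [e, ENNReal.tsum_mul_left, ENNReal.tsum_add, hX']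
    calc ENNReal.ofReal (8 * Real.pi) * (X + X)
        ≤ ENNReal.ofReal (8 * Real.pi)
          * (ENNReal.ofReal (√(tailConst s) * ‖z‖ * ‖halfD s (lowH s w)‖ ^ 2)
            + ENNReal.ofReal (√(tailConst s) * ‖z‖ * ‖halfD s (lowH s w)‖ ^ 2)) := by gcongr
      _ = _ := by
        rw [← ENNReal.ofReal_add (by positivity) (by positivity),
          ← ENNReal.ofReal_mul (by positivity)]
        congr 1
        ring
  have hsum : Summable fun p : ℤ × ℤ =>
      ‖energyTerm z.hat w.hat p + conj (energyTerm z.hat w.hat p.swap)‖ := by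
    have h := summable_norm_energyTerm z w
    refine (h.add ((Equiv.prodComm ℤ ℤ).summable_iff.2 h)).of_nonneg_of_le
      (fun _ => norm_nonneg _) fun p => (norm_add_le _ _).trans_eq ?_
    rw [RCLike.norm_conj]
    rfl
  rwa [← ENNReal.ofReal_tsum_of_nonneg (fun _ => norm_nonneg _) hsum,
    ENNReal.ofReal_le_ofReal_iff (by positivity)] at h1

/-- The energy estimate behind uniqueness: in `H^{1/2}`, the difference of two solutions satisfies
a linear Gronwall inequality. The terms of highest order cancel, because the symbol of the equation
is symmetric, except for those that couple positive and negative frequencies. -/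
theorem energy_estimate (z w : Hs s) (hw : avg w.toL2 = 0) :
    |inner ℝ (halfD s (lowH s w)) (halfD s ((1 / 2 : ℝ) • (rhsH (z + w) - rhsH (z - w))))|
      ≤ 8 * Real.pi * √(tailConst s) * ‖z‖ * ‖halfD s (lowH s w)‖ ^ 2 := by
  set g := (1 / 2 : ℝ) • (rhsH (z + w) - rhsH (z - w)) with hg
  set S := inner ℝ (halfD s (lowH s w)) (halfD s g) with hS
  have h1 := Complex.hasSum_re (hasSum_inner_halfD (lowH s w) g)
  rw [Complex.ofReal_re] at h1
  set T := energyTerm z.hat w.hat with hT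
  have hsum : Summable T := (summable_norm_energyTerm z w).of_norm
  have hrow : ∀ n : ℤ, (∑' k, T (n, k)).re = (((|n| : ℤ) : ℂ) * g.hat n
      * conj ((lowH s w).hat n)).re := fun n => by
    have h := (hasSum_hat_rhsH_sub z w hw n).mul_right (conj (w.hat n))
    have e : (∑' k, T (n, k)) = _ := h.tsum_eq
    rw [e, hat_lowH, sub_mul, Complex.sub_re]
    -- the contribution of the mean is purely imaginary
    have : ((2 * Real.pi * Complex.I : ℂ)⁻¹ * n.sign * (2 * avg z.toL2 : ℝ) * w.hat n
        * conj (w.hat n)).re = 0 := by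
      rw [mul_assoc _ (w.hat n), Complex.mul_conj]
      have e : ((2 * Real.pi * Complex.I : ℂ)⁻¹ * n.sign * (2 * avg z.toL2 : ℝ)
          * (Complex.normSq (w.hat n) : ℝ)) = ((-((2 * Real.pi)⁻¹ * n.sign * (2 * avg z.toL2)
            * Complex.normSq (w.hat n)) : ℝ) : ℂ) * Complex.I := by
        rw [mul_inv, Complex.inv_I]
        push_cast
        ring
      rw [e, Complex.re_ofReal_mul, Complex.I_re, mul_zero]
    rw [this, sub_zero]
  have h2 : S = (∑' p, T p).re := by
    have h3 : HasSum (fun n => (∑' k, T (n, k)).re) (∑' p, T p).re :=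
      Complex.hasSum_re (hsum.hasSum.prod_fiberwise fun n =>
        (hsum.prod_factor n).hasSum)
    simp_rw [hrow] at h3
    exact h1.unique h3
  have hswap : Summable fun p : ℤ × ℤ => conj (T p.swap) :=
    (Complex.hasSum_conj'.2 ((Equiv.prodComm ℤ ℤ).hasSum_iff.2 hsum.hasSum)).summable
  have h4 : (∑' p : ℤ × ℤ, conj (T p.swap)) = conj (∑' p, T p) := by
    rw [← Complex.conj_tsum]
    congr 1
    exact (Equiv.prodComm ℤ ℤ).tsum_eq T
  have h5 : 2 * S = (∑' p : ℤ × ℤ, (T p + conj (T p.swap))).re := by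
    rw [hsum.tsum_add hswap, h4, Complex.add_re, Complex.conj_re, h2]
    ring
  have hsn : Summable fun p : ℤ × ℤ => ‖T p + conj (T p.swap)‖ := (hsum.add hswap).norm
  have h6 : 2 * |S| ≤ 16 * Real.pi * √(tailConst s) * ‖z‖ * ‖halfD s (lowH s w)‖ ^ 2 := by
    have e : 2 * |S| = |2 * S| := by rw [abs_mul, abs_two]
    rw [e, h5]
    exact (Complex.abs_re_le_norm _).trans ((norm_tsum_le_tsum_norm hsn).trans
      (tsum_norm_energyTerm_add_le z w hw))
  linarith

theorem eq_zero_of_halfD {f : Hs s} (h0 : avg f.toL2 = 0) (h : halfD s (lowH s f) = 0) : f = 0 := by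
  refine Hs.ext_hat fun n => ?_
  rw [Hs.hat_zero]
  rcases eq_or_ne n 0 with rfl | hn
  · rw [Hs.hat_zero_eq, h0, Complex.ofReal_zero]
  · have h1 := coeff_halfD (lowH s f) n
    rw [h, hat_lowH, ← coeffCLM_apply, map_zero] at h1
    refine (mul_eq_zero.1 h1.symm).resolve_left ?_
    exact Complex.ofReal_ne_zero.2 (Real.sqrt_ne_zero'.2 (by positivity))

theorem uniqueness {I : Set ℝ} (hI : I.OrdConnected) (h0 : (0 : ℝ) ∈ I) {u₀ : Hs s}
    {u v : ℝ → Hs s} (hu : IsSolution I u₀ u) (hv : IsSolution I u₀ v) : EqOn u v I := by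
  obtain ⟨huc, hu', hu0⟩ := isSolution_iff.1 hu
  obtain ⟨hvc, hv', hv0⟩ := isSolution_iff.1 hv
  obtain ⟨z, hz⟩ : ∃ z : ℝ → Hs s, ∀ t, z t = (1 / 2 : ℝ) • (u t + v t) := ⟨_, fun _ => rfl⟩
  obtain ⟨w, hw⟩ : ∃ w : ℝ → Hs s, ∀ t, w t = (1 / 2 : ℝ) • (u t - v t) := ⟨_, fun _ => rfl⟩
  have hzw : ∀ t, z t + w t = u t := fun t => by rw [hz, hw]; module
  have hzw' : ∀ t, z t - w t = v t := fun t => by rw [hz, hw]; module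
  have hzc : ContinuousOn z I := ((huc.add hvc).const_smul (1 / 2 : ℝ)).congr fun t _ => hz t
  have hwd : ∀ t ∈ I, HasDerivAt (fun t => lowH s (w t))
      ((1 / 2 : ℝ) • (rhsH (z t + w t) - rhsH (z t - w t))) t := fun t ht => by
    rw [hzw, hzw']
    have h : HasDerivAt (fun t => (1 / 2 : ℝ) • (lowH s (u t) - lowH s (v t)))
      ((1 / 2 : ℝ) • (rhsH (u t) - rhsH (v t))) t :=
        ((hu' t ht).sub (hv' t ht)).const_smul (1 / 2 : ℝ)
    have e : (fun t => lowH s (w t)) = fun t => (1 / 2 : ℝ) • (lowH s (u t) - lowH s (v t)) :=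
      funext fun t => by rw [hw, map_smul, map_sub]
    rwa [e]
  have hw0 : w 0 = 0 := by rw [hw, hu0, hv0, sub_self, smul_zero]
  have havg : ∀ t ∈ I, avg (w t).toL2 = 0 := fun t ht => by
    have h := eq_zero_of_norm_deriv_le hI (k := fun _ => 0) (z' := fun _ => (0 : ℝ))
      (z := fun t => avgH (lowH s (w t))) continuousOn_const (fun t ht => ?_) (fun _ _ => by simp)
      h0 (by rw [hw0, map_zero, map_zero]) ht
    · rwa [avgH_apply, toL2_lowH] at h
    · refine (hasDerivAt_clm avgH (hwd t ht)).congr_deriv ?_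
      rw [map_smul, map_sub, avgH_apply, avgH_apply, avg_rhsH, avg_rhsH, sub_zero, smul_zero]
  intro t ht
  have hN := eq_zero_of_norm_deriv_le hI
    (k := fun t => 16 * Real.pi * √(tailConst s) * ‖z t‖)
    (z := fun t => ‖halfD s (lowH s (w t))‖ ^ 2)
    (z' := fun t => 2 * inner ℝ (halfD s (lowH s (w t)))
      (halfD s ((1 / 2 : ℝ) • (rhsH (z t + w t) - rhsH (z t - w t)))))
    (continuousOn_const.mul hzc.norm)
    (fun t ht => (hasDerivAt_clm (halfD s) (hwd t ht)).norm_sq) (fun t ht => ?_) h0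
    (by rw [hw0, map_zero, map_zero, norm_zero, zero_pow two_ne_zero]) ht
  · have h1 : w t = 0 := eq_zero_of_halfD (havg t ht) (by simpa using hN)
    rw [← hzw, ← hzw', h1, add_zero, sub_zero]
  · have h := energy_estimate (z t) (w t) (havg t ht)
    rw [Real.norm_eq_abs, Real.norm_eq_abs, abs_mul, abs_two,
      abs_of_nonneg (sq_nonneg ‖_‖)]
    linarith

end Uniqueness

/-! ### Continuation of solutions of ordinary differential equations -/

section Ode

variable {E : Type*} [NormedAddCommGroup E] [NormedSpace ℝ E]

/-- Two solutions of an autonomous equation with a `C¹` vector field, on the same open interval,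
coincide if they do at one time. -/
theorem ode_eqOn {F : E → E} (hF : ContDiff ℝ 1 F) {I : Set ℝ} (hI : IsOpen I)
    (hI' : I.OrdConnected) {y z : ℝ → E} (hy : ∀ t ∈ I, HasDerivAt y (F (y t)) t)
    (hz : ∀ t ∈ I, HasDerivAt z (F (z t)) t) {t₀ : ℝ} (ht₀ : t₀ ∈ I) (h0 : y t₀ = z t₀) :
    EqOn y z I := by
  have hloc : ∀ t ∈ I, y t = z t → y =ᶠ[𝓝 t] z := fun t ht h => by
    obtain ⟨K, U, hU, hK⟩ := (hF.contDiffAt (x := y t)).exists_lipschitzOnWith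
    refine ODE_solution_unique_of_eventually (v := fun _ => F) (s := fun _ => U) (K := K)
      (Eventually.of_forall fun _ => hK) ?_ ?_ h
    · filter_upwards [hI.mem_nhds ht, (hy t ht).continuousAt hU] with r h1 h2 using ⟨hy r h1, h2⟩
    · rw [h] at hU
      filter_upwards [hI.mem_nhds ht, (hz t ht).continuousAt hU] with r h1 h2 using ⟨hz r h1, h2⟩
  have hsub : I ⊆ {t | y =ᶠ[𝓝 t] z} := by
    refine hI'.isPreconnected.subset_of_closure_inter_subset isOpen_setOfPred_eventually_nhds
      ⟨t₀, ht₀, hloc t₀ ht₀ h0⟩ ?_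
    rintro t ⟨htc, ht⟩
    refine hloc t ht ?_
    by_contra hne
    have h1 : ∀ᶠ r in 𝓝 t, y r ≠ z r :=
      ((hy t ht).continuousAt.sub (hz t ht).continuousAt).eventually_ne (sub_ne_zero.2 hne)
        |>.mono fun r hr => sub_ne_zero.1 hr
    obtain ⟨r, hr1, hr2⟩ := (mem_closure_iff_frequently.1 htc).and_eventually h1 |>.exists
    exact hr2 hr1.self_of_nhds
  exact fun t ht => (hsub ht).self_of_nhds

/-- Gronwall's lemma for a seminorm that may be weaker than the norm in which the curve is
differentiable. -/
theorem exists_bound_of_seminorm_deriv_le (p : Seminorm ℝ E) (hp : Continuous p) {a b k ε : ℝ}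
    {y y' : ℝ → E} (hy : ∀ t ∈ Ico a b, HasDerivAt y (y' t) t)
    (h : ∀ t ∈ Ico a b, p (y' t) ≤ k * p (y t) + ε) : ∃ C, ∀ t ∈ Ico a b, p (y t) ≤ C := by
  have hg : Continuous (gronwallBound (p (y a)) k ε) :=
    continuous_iff_continuousAt.2 fun x => (hasDerivAt_gronwallBound _ _ _ x).continuousAt
  obtain ⟨C, hC⟩ := (isCompact_Icc (a := (0 : ℝ)) (b := b - a)).exists_bound_of_continuousOn
    hg.continuousOn
  refine ⟨C, fun t ht => ?_⟩
  have hsub : Icc a t ⊆ Ico a b := fun r hr => ⟨hr.1, hr.2.trans_lt ht.2⟩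
  have h1 := le_gronwallBound_of_liminf_deriv_right_le (f := fun t => p (y t))
    (f' := fun t => p (y' t)) (δ := p (y a)) (K := k) (ε := ε) (a := a) (b := t)
    (fun r hr => (hp.continuousAt.comp (hy r (hsub hr)).continuousAt).continuousWithinAt)
    (fun r hr q hq => ?_) le_rfl (fun r hr => h r (hsub (Ico_subset_Icc_self hr))) t ⟨ht.1, le_rfl⟩
  · exact h1.trans ((le_abs_self _).trans (hC (t - a) ⟨by linarith [ht.1], by linarith [ht.2]⟩))
  · have h2 := (hasDerivAt_iff_tendsto_slope.1 (hy r (hsub (Ico_subset_Icc_self hr)))).mono_left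
      (nhdsWithin_mono r (fun x (hx : r < x) => hx.ne') : 𝓝[>] r ≤ 𝓝[≠] r)
    have h3 := ((hp.tendsto _).comp h2).eventually_lt_const hq
    refine Eventually.frequently ?_
    filter_upwards [h3, self_mem_nhdsWithin] with z hz hz'
    have hz0 : 0 < z - r := sub_pos.2 hz'
    refine lt_of_le_of_lt ?_ hz
    rw [Function.comp_apply, slope, vsub_eq_sub, map_smul_eq_mul, Real.norm_of_nonneg (by positivity)]
    gcongr
    have := map_add_le_add p (y z - y r) (y r)
    rw [sub_add_cancel] at this
    linarith

/-- A solution with a bounded derivative can be continued beyond the end of its interval of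
definition. -/
theorem exists_ode_extension [CompleteSpace E] {F : E → E} (hF : ContDiff ℝ 1 F) {a t₀ τ C : ℝ}
    (ha : a < t₀) (hτ : t₀ < τ) {y : ℝ → E} (hy : ∀ t ∈ Ioo a τ, HasDerivAt y (F (y t)) t)
    (hC : ∀ t ∈ Ico t₀ τ, ‖F (y t)‖ ≤ C) :
    ∃ τ' > τ, ∃ z : ℝ → E, EqOn z y (Ioo a τ) ∧ Tendsto y (𝓝[<] τ) (𝓝 (z τ)) ∧
      ∀ t ∈ Ioo a τ', HasDerivAt z (F (z t)) t := by
  have hlip : LipschitzOnWith (C.toNNReal) y (Ico t₀ τ) :=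
    (convex_Ico t₀ τ).lipschitzOnWith_of_nnnorm_hasDerivWithin_le
      (f' := fun t => F (y t)) (fun t ht => (hy t ⟨ha.trans_le ht.1, ht.2⟩).hasDerivWithinAt)
      fun t ht => by
        rw [← NNReal.coe_le_coe, coe_nnnorm]
        exact (hC t ht).trans (Real.le_coe_toNNReal C)
  obtain ⟨e, he⟩ : ∃ e, Tendsto y (𝓝[<] τ) (𝓝 e) := by
    have h1 : 𝓝[<] τ ≤ 𝓟 (Ico t₀ τ) := le_principal_iff.2 (Ico_mem_nhdsLT hτ)
    exact CompleteSpace.complete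
      ((cauchy_nhds.mono nhdsWithin_le_nhds).map_of_le hlip.uniformContinuousOn h1)
  obtain ⟨α, hα0, ε, hε, hα⟩ :=
    (hF.contDiffAt (x := e)).exists_forall_mem_closedBall_exists_eq_forall_mem_Ioo_hasDerivAt₀ τ
  obtain ⟨z, hz1, hz2⟩ : ∃ z : ℝ → E, (∀ t < τ, z t = y t) ∧ ∀ t, τ ≤ t → z t = α t :=
    ⟨fun t => if t < τ then y t else α t, fun t ht => if_pos ht, fun t ht => if_neg ht.not_gt⟩
  have hzτ : z τ = e := (hz2 τ le_rfl).trans hα0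
  have hzy : ∀ t < τ, z =ᶠ[𝓝 t] y := fun t ht => by
    filter_upwards [Iio_mem_nhds ht] with r hr using hz1 r hr
  have hleft : ∀ t ∈ Ioo a τ, HasDerivAt z (F (z t)) t := fun t ht => by
    rw [hz1 t ht.2]
    exact (hy t ht).congr_of_eventuallyEq (hzy t ht.2)
  refine ⟨τ + ε, by linarith, z, fun t ht => hz1 t ht.2, by rwa [hzτ], fun t ht => ?_⟩
  rcases lt_trichotomy t τ with h | rfl | h
  · exact hleft t ⟨ht.1, h⟩
  · have hlim : Tendsto z (𝓝[<] t) (𝓝 (z t)) := by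
      rw [hzτ]
      refine he.congr' ?_
      filter_upwards [self_mem_nhdsWithin] with r hr using (hz1 r hr).symm
    have h1 : HasDerivWithinAt z (F (z t)) (Iic t) t := by
      refine hasDerivWithinAt_Iic_of_tendsto_deriv (s := Ioo a t)
        (fun r hr => (hleft r hr).differentiableAt.differentiableWithinAt)
        (hlim.mono_left (nhdsWithin_mono _ Ioo_subset_Iio_self)) (Ioo_mem_nhdsLT ht.1) ?_
      refine ((hF.continuous.tendsto _).comp hlim).congr' ?_
      filter_upwards [Ioo_mem_nhdsLT ht.1] with r hr using (hleft r hr).deriv.symm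
    have h2 : HasDerivWithinAt z (F (z t)) (Ici t) t := by
      have := (hα t ⟨by linarith, by linarith⟩).hasDerivWithinAt (s := Ici t)
      rw [hz2 t le_rfl]
      exact this.congr (fun r hr => hz2 r hr) (hz2 t le_rfl)
    have h3 := h1.union h2
    rw [Iic_union_Ici, hasDerivWithinAt_univ] at h3
    exact h3
  · rw [hz2 t h.le]
    refine (hα t ⟨by linarith, ht.2⟩).congr_of_eventuallyEq ?_
    filter_upwards [Ioi_mem_nhds h] with r hr using hz2 r (le_of_lt hr)

end Ode

/-! ### Estimates in terms of uniform bounds -/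

section Apriori

theorem Hs.wiener_add_le [Fact (1 / 2 < θ)] (f g : Hs θ) :
    (f + g).wiener ≤ f.wiener + g.wiener := by
  rw [Hs.wiener, Hs.wiener, Hs.wiener, ← f.summable_norm_hat.tsum_add g.summable_norm_hat]
  refine (f + g).summable_norm_hat.tsum_le_tsum (fun n => ?_)
    (f.summable_norm_hat.add g.summable_norm_hat)
  rw [Hs.hat_add]
  exact norm_add_le _ _

theorem Hs.wiener_smul (c : ℝ) (f : Hs θ) : (c • f).wiener = |c| * f.wiener := by
  rw [Hs.wiener, Hs.wiener, ← tsum_mul_left]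
  refine tsum_congr fun n => ?_
  rw [Hs.hat_smul, norm_mul, Complex.norm_real, Real.norm_eq_abs]

/-- The norm of the Wiener algebra, as a seminorm on `H^θ`. -/
def wienerSeminorm (θ : ℝ) [Fact (1 / 2 < θ)] : Seminorm ℝ (Hs θ) :=
  Seminorm.of Hs.wiener Hs.wiener_add_le fun c f => Hs.wiener_smul c f

theorem continuous_wienerSeminorm [Fact (1 / 2 < θ)] : Continuous (wienerSeminorm θ) := by
  refine Seminorm.continuous_of_continuousAt_zero ?_
  rw [ContinuousAt, map_zero]
  refine squeeze_zero (fun f => f.wiener_nonneg) (fun f => f.wiener_le) ?_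
  have h : Continuous fun f : Hs θ => √(embConst θ).toReal * ‖f‖ := by fun_prop
  simpa using h.tendsto 0

theorem abs_avg_le [Fact (1 / 2 < θ)] (f : Hs θ) : |avg f.toL2| ≤ ‖toC f‖ := by
  rw [avg_toL2, ← Real.norm_eq_abs]
  have h := norm_integral_le_of_norm_le_const (μ := haar)
    (ae_of_all _ fun x => (toC f).norm_coe_le_norm x)
  simpa using h

theorem norm_toL2_le_toC [Fact (1 / 2 < θ)] (f : Hs θ) : ‖f.toL2‖ ≤ ‖toC f‖ := by
  have h : ‖f.toL2‖ ^ 2 = ∫ x, toC (f ⊙ f) x ∂haar := by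
    rw [← real_inner_self_eq_norm_sq, ← avg_toL2, avg_toL2_mulH]
    nth_rewrite 2 [← ofC_toC f]
    rw [inner_ofC]
    refine integral_congr_ae ?_
    filter_upwards [toC_ae f] with x hx
    rw [hx]
  have h2 : |∫ x, toC (f ⊙ f) x ∂haar| ≤ ‖toC f‖ ^ 2 := by
    rw [← avg_toL2]
    refine (abs_avg_le _).trans ?_
    rw [toC_mulH, sq]
    exact norm_mul_le _ _
  rw [← h] at h2
  exact (sq_le_sq₀ (norm_nonneg _) (norm_nonneg _)).1 ((le_abs_self _).trans h2)

variable {s : ℝ} [hs : Fact (3 / 2 < s)]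

/-- The primitive is bounded in the Wiener algebra by the uniform norm. -/
theorem wiener_lowH_iH_le (f : Hs (s - 1)) :
    (lowH s (iH s f)).wiener ≤ √(embConst 1).toReal * (2 * ‖toC f‖) := by
  have h1 := wSum_sq_le 0 1 (lowH s (iH s f)).hat
  have h2 := (isSymbol_prim (a := 0) (b := 1) (by norm_num)).sobSq_le f.hat
  have e : (lowH s (iH s f)).hat = fun n => (dSym n)⁻¹ * f.hat n := funext fun n => by
    rw [hat_lowH, hat_iH]
  have hE : embConst 1 ≠ ⊤ := embConst_ne_top (by norm_num)
  rw [← e, show f.hat = coeff f.toL2 from rfl, sobSq_zero] at h2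
  rw [sub_zero, Hs.wSum_eq, ← ENNReal.ofReal_pow (Hs.wiener_nonneg _)] at h1
  have h3 := h1.trans (mul_le_mul_right h2 _)
  rw [← ENNReal.ofReal_toReal hE, ← ENNReal.ofReal_mul (by positivity),
    ← ENNReal.ofReal_mul ENNReal.toReal_nonneg, ENNReal.ofReal_le_ofReal_iff (by positivity)] at h3
  refine (sq_le_sq₀ (Hs.wiener_nonneg _) (by positivity)).1 (h3.trans ?_)
  rw [mul_pow, mul_pow, Real.sq_sqrt ENNReal.toReal_nonneg]
  gcongr
  exact norm_toL2_le_toC f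

/-- The weighted mean of the primitive `velK`. -/
def velMean (y : State s) : ℝ := avg (lowH s (velK y) ⊙ (y.2.1 ⊙ y.2.1)).toL2

theorem acc_eq (y : State s) : acc y = y.1 • (lowH s (velK y) ⊙ y.2.1)
    - (y.1 * velMean y + avg (y.2.2.1 ⊙ y.2.2.1).toL2) • y.2.1 := by
  refine toC_injective ?_
  ext x
  rw [toC_acc, map_sub, map_smul, map_smul, toC_mulH, toC_lowH]
  simp only [ContinuousMap.sub_apply, ContinuousMap.smul_apply, ContinuousMap.mul_apply,
    smul_eq_mul]
  rw [vel, map_add, ContinuousMap.add_apply, toC_kH, velMean]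
  ring

/-- Uniform bounds for a state, by a constant `M`. -/
structure Bounded (M : ℝ) (y : State s) : Prop where
  mu : |y.1| ≤ M
  rho : ‖toC y.2.1‖ ≤ M
  sigma : ‖toC y.2.2.1‖ ≤ M

/-- The bound for `velK` in the Wiener algebra that follows from uniform bounds. -/
def velBound (M : ℝ) : ℝ := √(embConst 1).toReal * (2 * (2 * (M * M)))

theorem velBound_nonneg (M : ℝ) : 0 ≤ velBound M := by
  have := mul_self_nonneg M
  unfold velBound
  positivity

namespace Bounded

variable {M : ℝ} {y : State s}

theorem nonneg (h : Bounded M y) : 0 ≤ M := (abs_nonneg _).trans h.mu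

theorem wiener_velK (h : Bounded M y) : (lowH s (velK y)).wiener ≤ velBound M := by
  refine (wiener_lowH_iH_le _).trans ?_
  unfold velBound
  gcongr
  rw [map_smul, norm_smul, Real.norm_ofNat, toC_mulH]
  gcongr
  exact (norm_mul_le _ _).trans (mul_le_mul h.rho h.sigma (norm_nonneg _) h.nonneg)

theorem norm_toC_velK (h : Bounded M y) : ‖toC (velK y)‖ ≤ velBound M := by
  rw [← toC_lowH]
  exact (norm_toC_le_wiener _).trans h.wiener_velK

theorem abs_velMean (h : Bounded M y) : |velMean y| ≤ velBound M * (M * M) := by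
  refine (abs_avg_le _).trans ?_
  rw [toC_mulH, toC_mulH, toC_lowH]
  exact (norm_mul_le _ _).trans (mul_le_mul h.norm_toC_velK ((norm_mul_le _ _).trans
    (mul_le_mul h.rho h.rho (norm_nonneg _) h.nonneg)) (norm_nonneg _) (velBound_nonneg M))

theorem abs_coefficient (h : Bounded M y) :
    |y.1 * velMean y + avg (y.2.2.1 ⊙ y.2.2.1).toL2| ≤ M * (velBound M * (M * M)) + M * M := by
  have h1 : |avg (y.2.2.1 ⊙ y.2.2.1).toL2| ≤ M * M := by
    refine (abs_avg_le _).trans ?_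
    rw [toC_mulH]
    exact (norm_mul_le _ _).trans (mul_le_mul h.sigma h.sigma (norm_nonneg _) h.nonneg)
  refine (abs_add_le _ _).trans (add_le_add ?_ h1)
  rw [abs_mul]
  exact mul_le_mul h.mu h.abs_velMean (abs_nonneg _) h.nonneg

theorem wiener_acc (h : Bounded M y) :
    (acc y).wiener ≤ (M * velBound M + (M * (velBound M * (M * M)) + M * M)) * y.2.1.wiener := by
  have hM := h.nonneg
  have hρ := y.2.1.wiener_nonneg
  rw [acc_eq, sub_eq_add_neg (y.1 • (lowH s (velK y) ⊙ y.2.1)), ← neg_smul]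
  refine (Hs.wiener_add_le _ _).trans ?_
  rw [Hs.wiener_smul, Hs.wiener_smul, abs_neg, add_mul, mul_assoc]
  refine add_le_add ?_ (mul_le_mul_of_nonneg_right h.abs_coefficient hρ)
  exact mul_le_mul h.mu ((wiener_mulH_le _ _).trans (mul_le_mul_of_nonneg_right h.wiener_velK hρ))
    (Hs.wiener_nonneg _) hM

theorem abs_toC_vel (h : Bounded M y) (x : Circ) :
    |toC (vel y) x| ≤ velBound M + (M + velBound M * (M * M)) := by
  rw [vel, map_add, ContinuousMap.add_apply, toC_kH]
  refine (abs_add_le _ _).trans (add_le_add ?_ ?_)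
  · exact ((toC (velK y)).norm_coe_le_norm x).trans h.norm_toC_velK
  · exact (abs_sub _ _).trans (add_le_add h.mu h.abs_velMean)

/-- Once the Wiener norms of `ρ` and `σ` are bounded, the vector field grows at most linearly in
the norm of `H^{s-1}`. -/
theorem exists_norm_acc_le (M W : ℝ) : ∃ C, 0 ≤ C ∧ ∀ y : State s, Bounded M y → y.2.1.wiener ≤ W →
    y.2.2.1.wiener ≤ W → ‖acc y‖ ≤ C * (‖y.2.1‖ + ‖y.2.2.1‖) := by
  obtain ⟨c, hc⟩ : ∃ c, c = √(2 * 4 ^ (s - 1)) := ⟨_, rfl⟩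
  obtain ⟨l, hl⟩ : ∃ l, l = ‖(lowH s).comp (iH s)‖ := ⟨_, rfl⟩
  have hc0 : 0 ≤ c := hc ▸ Real.sqrt_nonneg _
  have hl0 : 0 ≤ l := hl ▸ norm_nonneg _
  refine ⟨|M| * (c * (velBound M + l * (2 * (c * |W|)) * |W|))
    + (|M| * (velBound M * (M * M)) + M * M), ?_, fun y h hρ hσ => ?_⟩
  · have := velBound_nonneg M
    have := mul_self_nonneg M
    positivity
  have hM := h.nonneg
  have hW : 0 ≤ W := y.2.1.wiener_nonneg.trans hρ
  have hV := velBound_nonneg M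
  have hR := norm_nonneg y.2.1
  have hS := norm_nonneg y.2.2.1
  rw [abs_of_nonneg hM, abs_of_nonneg hW]
  have h1 : ‖y.2.1 ⊙ y.2.2.1‖ ≤ c * W * (‖y.2.1‖ + ‖y.2.2.1‖) := by
    refine (norm_mulH_le _ _).trans ?_
    rw [← hc]
    have h2 : y.2.1.wiener * ‖y.2.2.1‖ ≤ W * ‖y.2.2.1‖ := by gcongr
    have h3 : ‖y.2.1‖ * y.2.2.1.wiener ≤ ‖y.2.1‖ * W := by gcongr
    calc c * (y.2.1.wiener * ‖y.2.2.1‖ + ‖y.2.1‖ * y.2.2.1.wiener)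
        ≤ c * (W * ‖y.2.2.1‖ + ‖y.2.1‖ * W) := by gcongr
      _ = _ := by ring
  have h2 : ‖lowH s (velK y)‖ ≤ l * (2 * (c * W)) * (‖y.2.1‖ + ‖y.2.2.1‖) := by
    have h3 := ((lowH s).comp (iH s)).le_opNorm ((2 : ℝ) • (y.2.1 ⊙ y.2.2.1))
    rw [← hl, norm_smul, Real.norm_ofNat] at h3
    calc _ ≤ l * (2 * ‖y.2.1 ⊙ y.2.2.1‖) := h3
      _ ≤ l * (2 * (c * W * (‖y.2.1‖ + ‖y.2.2.1‖))) := by gcongr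
      _ = _ := by ring
  have h3 : ‖lowH s (velK y) ⊙ y.2.1‖
      ≤ c * (velBound M + l * (2 * (c * W)) * W) * (‖y.2.1‖ + ‖y.2.2.1‖) := by
    refine (norm_mulH_le _ _).trans ?_
    rw [← hc]
    calc c * ((lowH s (velK y)).wiener * ‖y.2.1‖ + ‖lowH s (velK y)‖ * y.2.1.wiener)
        ≤ c * (velBound M * (‖y.2.1‖ + ‖y.2.2.1‖)
          + l * (2 * (c * W)) * (‖y.2.1‖ + ‖y.2.2.1‖) * W) := by
          gcongr
          · exact h.wiener_velK
          · linarith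
          · exact y.2.1.wiener_nonneg
      _ = _ := by ring
  rw [acc_eq]
  refine (norm_sub_le _ _).trans ?_
  rw [norm_smul, norm_smul, Real.norm_eq_abs, Real.norm_eq_abs, add_mul]
  refine add_le_add ?_ (mul_le_mul h.abs_coefficient (by linarith) hR (by positivity))
  rw [mul_assoc]
  exact mul_le_mul h.mu h3 (norm_nonneg _) hM

end Bounded

theorem exists_bound_field {a b M : ℝ} {y : ℝ → State s}
    (hy : ∀ t ∈ Ico a b, HasDerivAt y (field (y t)) t) (hM : ∀ t ∈ Ico a b, Bounded M (y t)) :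
    ∃ C, ∀ t ∈ Ico a b, ‖field (y t)‖ ≤ C := by
  have hz : ∀ t ∈ Ico a b, HasDerivAt (fun t => ((y t).2.1, (y t).2.2.1))
      ((y t).2.2.1, acc (y t)) t := fun t ht => by
    have h1 := hasDerivAt_clm (ContinuousLinearMap.snd ℝ _ _) (hy t ht)
    have h2 := hasDerivAt_clm (ContinuousLinearMap.fst ℝ _ _) h1
    have h3 := hasDerivAt_clm (ContinuousLinearMap.fst ℝ _ _)
      (hasDerivAt_clm (ContinuousLinearMap.snd ℝ _ _) h1)
    exact h2.prodMk h3
  -- the seminorm `wiener ρ + wiener σ`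
  obtain ⟨p, hpc, hp⟩ : ∃ p : Seminorm ℝ (Hs (s - 1) × Hs (s - 1)), Continuous p ∧
      ∀ f g, p (f, g) = f.wiener + g.wiener :=
    ⟨(wienerSeminorm (s - 1)).comp (LinearMap.fst ℝ _ _)
      + (wienerSeminorm (s - 1)).comp (LinearMap.snd ℝ _ _),
      (continuous_wienerSeminorm.comp continuous_fst).add
        (continuous_wienerSeminorm.comp continuous_snd), fun _ _ => rfl⟩
  obtain ⟨k, hk⟩ : ∃ k, k = M * velBound M + (M * (velBound M * (M * M)) + M * M) := ⟨_, rfl⟩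
  obtain ⟨W, hW⟩ := exists_bound_of_seminorm_deriv_le p hpc (k := 1 + |k|) (ε := 0) hz
    fun t ht => by
      have h1 := (hM t ht).wiener_acc
      have h2 := (y t).2.1.wiener_nonneg
      have h3 := (y t).2.2.1.wiener_nonneg
      rw [← hk] at h1
      rw [hp, hp]
      have h4 : k * (y t).2.1.wiener ≤ |k| * (y t).2.1.wiener := by
        gcongr
        exact le_abs_self k
      nlinarith [mul_nonneg (abs_nonneg k) h3]
  obtain ⟨C, hC0, hC⟩ := Bounded.exists_norm_acc_le (s := s) M W
  have hacc : ∀ t ∈ Ico a b, ‖acc (y t)‖ ≤ C * (‖(y t).2.1‖ + ‖(y t).2.2.1‖) := fun t ht => by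
    have h1 := hW t ht
    rw [hp] at h1
    have h2 := (y t).2.1.wiener_nonneg
    have h3 := (y t).2.2.1.wiener_nonneg
    exact hC _ (hM t ht) (by linarith) (by linarith)
  obtain ⟨N, hN⟩ := exists_bound_of_seminorm_deriv_le (normSeminorm ℝ (Hs (s - 1) × Hs (s - 1)))
    continuous_norm (k := 1 + 2 * C) (ε := 0) hz fun t ht => by
      have h0 := hacc t ht
      have h1 : ‖(y t).2.1‖ ≤ ‖((y t).2.1, (y t).2.2.1)‖ := norm_fst_le ((y t).2.1, (y t).2.2.1)
      have h2 : ‖(y t).2.2.1‖ ≤ ‖((y t).2.1, (y t).2.2.1)‖ := norm_snd_le ((y t).2.1, (y t).2.2.1)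
      change ‖((y t).2.2.1, acc (y t))‖ ≤ (1 + 2 * C) * ‖((y t).2.1, (y t).2.2.1)‖ + 0
      have h3 := norm_nonneg ((y t).2.1, (y t).2.2.1)
      refine norm_prod_le_iff.2 ⟨?_, ?_⟩
      · change ‖(y t).2.2.1‖ ≤ _
        nlinarith
      · change ‖acc (y t)‖ ≤ _
        nlinarith
  refine ⟨max N (max (C * (N + N)) (velBound M + (M + velBound M * (M * M)))), fun t ht => ?_⟩
  have h0 : ‖((y t).2.1, (y t).2.2.1)‖ ≤ N := hN t ht
  have h1 : ‖(y t).2.1‖ ≤ N := (norm_fst_le ((y t).2.1, (y t).2.2.1)).trans h0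
  have h2 : ‖(y t).2.2.1‖ ≤ N := (norm_snd_le ((y t).2.1, (y t).2.2.1)).trans h0
  have hN0 : 0 ≤ N := (norm_nonneg _).trans h0
  refine norm_prod_le_iff.2 ⟨?_, norm_prod_le_iff.2 ⟨?_, norm_prod_le_iff.2 ⟨?_, ?_⟩⟩⟩
  · change ‖(0 : ℝ)‖ ≤ _
    rw [norm_zero]
    exact hN0.trans (le_max_left _ _)
  · exact h2.trans (le_max_left _ _)
  · refine (hacc t ht).trans (le_max_of_le_right (le_max_of_le_left ?_))
    gcongr
  · exact ((hM t ht).abs_toC_vel 0).trans (le_max_of_le_right (le_max_right _ _))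

end Apriori

/-! ### Persistence -/

section Persistence

variable {s : ℝ} [hs : Fact (3 / 2 < s)]

theorem ae_coe_of_ae_haar {p : Circ → Prop} (h : ∀ᵐ x ∂haar, p x) (a : ℝ) :
    ∀ᵐ x ∂volume.restrict (Ioc a (a + 1)), p ((x : ℝ) : Circ) := by
  have h1 := (AddCircle.measurePreserving_mk (1 : ℝ) a).quasiMeasurePreserving
  refine h1.ae ?_
  rw [AddCircle.volume_eq_smul_haarAddCircle]
  exact Measure.ae_smul_measure h _

theorem abs_toC_dH_le {u : Hs s} {K : ℝ} (h : C1NormLE u.toL2 K) (x : Circ) :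
    |toC (dH s u) x| ≤ K := by
  obtain ⟨F, hF, hae, hK⟩ := h
  have hc : Continuous fun x : ℝ => toC u (x : Circ) := IsC1.continuous_comp (toC u)
  have hFu : F = fun x : ℝ => toC u (x : Circ) := by
    funext x
    have h1 : F =ᵐ[volume.restrict (Ioo (x - 1 / 2) (x + 1 / 2))] fun x : ℝ => toC u (x : Circ) := by
      have h2 := ae_coe_of_ae_haar (toC_ae u) (x - 1 / 2)
      have h3 := ae_restrict_of_ae_restrict_of_subset (show Ioo (x - 1 / 2) (x + 1 / 2)
        ⊆ Ioc (x - 1 / 2) (x - 1 / 2 + 1) from fun y hy => ⟨hy.1, by linarith [hy.2]⟩) h2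
      filter_upwards [h3, ae_restrict_of_ae hae] with y h4 h5
      rw [h5, h4]
    exact Measure.eqOn_open_of_ae_eq h1 isOpen_Ioo hF.continuous.continuousOn hc.continuousOn
      ⟨by linarith, by linarith⟩
  induction x using QuotientAddGroup.induction_on with | H a => ?_
  have h1 : HasDerivAt F (toC (dH s u) (a : Circ)) a := hFu ▸ isC1_toC_dH u a
  have h2 := hK a
  rw [h1.deriv] at h2
  exact (le_add_of_nonneg_left (abs_nonneg _)).trans h2

theorem IsSolution.mono {I J : Set ℝ} {u₀ : Hs s} {u : ℝ → Hs s} (h : IsSolution I u₀ u)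
    (hJ : J ⊆ I) : IsSolution J u₀ u := by
  rw [isSolution_iff] at h ⊢
  exact ⟨h.1.mono hJ, fun t ht => h.2.1 t (hJ ht), h.2.2⟩

/-- Two solutions on overlapping intervals that agree on the overlap fit together. -/
theorem IsSolution.union {I J : Set ℝ} (hI : IsOpen I) (hJ : IsOpen J) {u₀ : Hs s}
    {u v w : ℝ → Hs s} (hu : IsSolution I u₀ u) (hv : IsSolution J u₀ v) (h0 : (0 : ℝ) ∈ I)
    (hwu : EqOn w u I) (hwv : EqOn w v J) : IsSolution (I ∪ J) u₀ w := by
  rw [isSolution_iff] at hu hv ⊢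
  have h1 : ∀ t ∈ I, w =ᶠ[𝓝 t] u := fun t ht => by
    filter_upwards [hI.mem_nhds ht] with r hr using hwu hr
  have h2 : ∀ t ∈ J, w =ᶠ[𝓝 t] v := fun t ht => by
    filter_upwards [hJ.mem_nhds ht] with r hr using hwv hr
  refine ⟨fun t ht => ContinuousAt.continuousWithinAt ?_, fun t ht => ?_, (hwu h0).trans hu.2.2⟩
  · rcases ht with ht | ht
    · exact (hu.1.continuousAt (hI.mem_nhds ht)).congr (h1 t ht).symm
    · exact (hv.1.continuousAt (hJ.mem_nhds ht)).congr (h2 t ht).symm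
  · rcases ht with ht | ht
    · rw [hwu ht]
      exact (hu.2.1 t ht).congr_of_eventuallyEq ((h1 t ht).fun_comp (lowH s))
    · rw [hwv ht]
      exact (hv.2.1 t ht).congr_of_eventuallyEq ((h2 t ht).fun_comp (lowH s))

/-- A solution of the equation in Lagrangian variables on `(-d, τ)` that starts from `u₀` and for
which `ρ` stays positive. -/
structure IsLagrange (u₀ : Hs s) (d τ : ℝ) (y : ℝ → State s) : Prop where
  hasDerivAt : ∀ t ∈ Ioo (-d) τ, HasDerivAt y (field (y t)) t
  initial : y 0 = initState u₀
  pos : ∀ t ∈ Ioo (-d) τ, ∀ x, 0 < toC (y t).2.1 x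

namespace IsLagrange

variable {u₀ : Hs s} {d τ : ℝ} {y : ℝ → State s}

theorem isFlow (h : IsLagrange u₀ d τ y) (hd : 0 < d) (hτ : 0 < τ) :
    IsFlow (Ioo (-d) τ) (fun t => toAdm (y t)) :=
  isFlow_toAdm isOpen_Ioo ordConnected_Ioo h.hasDerivAt ⟨by linarith, hτ⟩ h.initial h.pos

theorem isSolution (h : IsLagrange u₀ d τ y) (hd : 0 < d) (hτ : 0 < τ) :
    IsSolution (Ioo (-d) τ) u₀ (fun t => (toAdm (y t)).euler) :=
  (h.isFlow hd hτ).isSolution isOpen_Ioo ordConnected_Ioo (u₀ := u₀)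
    ((congrArg toAdm h.initial).trans (toAdm_initState u₀))

theorem val (h : IsLagrange u₀ d τ y) (hd : 0 < d) (hτ : 0 < τ) {t : ℝ} (ht : t ∈ Ioo (-d) τ) :
    (toAdm (y t)).1 = y t :=
  toAdm_val (h.pos t ht) (constraints ordConnected_Ioo h.hasDerivAt ⟨by linarith, hτ⟩
    (by rw [h.initial]; exact avg_initState u₀) (by rw [h.initial]; exact avg_initState' u₀) ht).1

/-- A bound for `u_x` bounds the logarithmic derivative of `ρ` along the flow. -/
theorem abs_sigma_le (h : IsLagrange u₀ d τ y) (hd : 0 < d) (hτ : 0 < τ) {K : ℝ} {t : ℝ}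
    (ht : t ∈ Ioo (-d) τ) (hK : ∀ x, |toC (dH s (toAdm (y t)).euler) x| ≤ K) (x : Circ) :
    |toC (y t).2.2.1 x| ≤ K / 2 * toC (y t).2.1 x := by
  have h1 := (toAdm (y t)).dH_euler ((h.isFlow hd hτ).avg_eq_zero t ht)
  have h2 := hK ((toAdm (y t)).cmap.homeo x)
  rw [h1, ← CMap.comp_apply, Adm.comp_toC_pull, Adm.toC_slope, h.val hd hτ ht] at h2
  have h3 := h.pos t ht x
  rw [abs_div, abs_mul, abs_two, abs_of_pos h3, div_le_iff₀ h3] at h2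
  linarith

theorem hasDerivAt_toC_rho (h : IsLagrange u₀ d τ y) {t : ℝ} (ht : t ∈ Ioo (-d) τ) (x : Circ) :
    HasDerivAt (fun t => toC (y t).2.1 x) (toC (y t).2.2.1 x) t :=
  hasDerivAt_clm ((evalC x).comp toC) (hasDerivAt_clm (ContinuousLinearMap.fst ℝ _ _)
    (hasDerivAt_clm (ContinuousLinearMap.snd ℝ _ _) (h.hasDerivAt t ht)))

/-- Pointwise bounds for `ρ` from below and from above. -/
theorem rho_mem_Icc (h : IsLagrange u₀ d τ y) (hd : 0 < d) {K : ℝ}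
    (hσ : ∀ t ∈ Ico 0 τ, ∀ x, |toC (y t).2.2.1 x| ≤ K * toC (y t).2.1 x) {t : ℝ}
    (ht : t ∈ Ico 0 τ) (x : Circ) :
    toC (y t).2.1 x ∈ Icc (Real.exp (-(K * t))) (Real.exp (K * t)) := by
  have hsub : Icc 0 t ⊆ Ioo (-d) τ := fun r hr => ⟨by linarith [hr.1], hr.2.trans_lt ht.2⟩
  have h0 : toC (y 0).2.1 x = 1 := by
    rw [h.initial]
    exact toC_kH 1 x
  have hd1 : ∀ c : ℝ, ∀ r ∈ Icc 0 t, HasDerivAt (fun r => Real.exp (c * r) * toC (y r).2.1 x)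
      (Real.exp (c * r) * (c * toC (y r).2.1 x + toC (y r).2.2.1 x)) r := fun c r hr => by
    have h1 : HasDerivAt (fun r => Real.exp (c * r)) (Real.exp (c * r) * c) r := by
      simpa using ((hasDerivAt_id r).const_mul c).exp
    refine (h1.mul (h.hasDerivAt_toC_rho (hsub hr) x)).congr_deriv ?_
    ring
  have hcont : ∀ c : ℝ, ContinuousOn (fun r => Real.exp (c * r) * toC (y r).2.1 x) (Icc 0 t) :=
    fun c r hr => (hd1 c r hr).continuousAt.continuousWithinAt
  have hab : ∀ r ∈ Icc 0 t, _ := fun r hr => abs_le.1 (hσ r ⟨hr.1, hr.2.trans_lt ht.2⟩ x)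
  have hm := monotoneOn_of_deriv_nonneg (convex_Icc 0 t) (hcont K)
    (fun r hr => (hd1 K r (interior_subset hr)).differentiableAt.differentiableWithinAt)
    (fun r hr => by
      rw [(hd1 K r (interior_subset hr)).deriv]
      exact mul_nonneg (Real.exp_pos _).le (by linarith [(hab r (interior_subset hr)).1]))
    ⟨le_rfl, ht.1⟩ ⟨ht.1, le_rfl⟩ ht.1
  have ha := antitoneOn_of_deriv_nonpos (convex_Icc 0 t) (hcont (-K))
    (fun r hr => (hd1 (-K) r (interior_subset hr)).differentiableAt.differentiableWithinAt)
    (fun r hr => by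
      rw [(hd1 (-K) r (interior_subset hr)).deriv]
      exact mul_nonpos_of_nonneg_of_nonpos (Real.exp_pos _).le
        (by linarith [(hab r (interior_subset hr)).2]))
    ⟨le_rfl, ht.1⟩ ⟨ht.1, le_rfl⟩ ht.1
  simp only [mul_zero, Real.exp_zero, one_mul, h0] at hm ha
  rw [neg_mul, Real.exp_neg, inv_mul_le_iff₀ (Real.exp_pos _), mul_one] at ha
  refine ⟨?_, ha⟩
  rw [Real.exp_neg, inv_le_iff_one_le_mul₀' (Real.exp_pos _)]
  exact hm

end IsLagrange

/-- As long as `u_x` is bounded, the Lagrangian solution can be continued. -/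
theorem IsLagrange.exists_extension {u₀ : Hs s} {d τ K : ℝ} {y : ℝ → State s}
    (h : IsLagrange u₀ d τ y) (hd : 0 < d) (hτ : 0 < τ)
    (hK : ∀ t ∈ Ico 0 τ, ∀ x, |toC (dH s (toAdm (y t)).euler) x| ≤ K) :
    ∃ τ' > τ, ∃ z, IsLagrange u₀ d τ' z := by
  have hsub : ∀ t ∈ Ico 0 τ, t ∈ Ioo (-d) τ := fun t ht => ⟨by linarith [ht.1], ht.2⟩
  have hK0 : 0 ≤ K := (abs_nonneg _).trans (hK 0 ⟨le_rfl, hτ⟩ 0)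
  have hσ := fun t ht => h.abs_sigma_le hd hτ (hsub t ht) (hK t ht)
  have hρ := fun t (ht : t ∈ Ico 0 τ) x => h.rho_mem_Icc hd hσ ht x
  have hmono : ∀ t ∈ Ico 0 τ, K / 2 * t ≤ K / 2 * τ := fun t ht => by
    have := ht.2.le
    gcongr
  obtain ⟨m, hm⟩ : ∃ m, m = Real.exp (-(K / 2 * τ)) := ⟨_, rfl⟩
  obtain ⟨R, hR⟩ : ∃ R, R = Real.exp (K / 2 * τ) := ⟨_, rfl⟩
  have hm0 : 0 < m := hm ▸ Real.exp_pos _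
  have hR0 : 0 < R := hR ▸ Real.exp_pos _
  have hlow : ∀ t ∈ Ico 0 τ, ∀ x, m ≤ toC (y t).2.1 x := fun t ht x => by
    rw [hm]
    exact (Real.exp_le_exp.2 (neg_le_neg (hmono t ht))).trans (hρ t ht x).1
  have hup : ∀ t ∈ Ico 0 τ, ∀ x, toC (y t).2.1 x ≤ R := fun t ht x => by
    rw [hR]
    exact (hρ t ht x).2.trans (Real.exp_le_exp.2 (hmono t ht))
  have hmu : ∀ t ∈ Ico 0 τ, (y t).1 = avg u₀.toL2 := fun t ht => by
    have h1 : ∀ r ∈ Ioo (-d) τ, HasDerivAt (fun r => (y r).1) 0 r := fun r hr =>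
      hasDerivAt_clm (ContinuousLinearMap.fst ℝ ℝ _) (h.hasDerivAt r hr)
    have h2 := isOpen_Ioo.is_const_of_deriv_eq_zero isPreconnected_Ioo
      (fun r hr => (h1 r hr).differentiableAt.differentiableWithinAt)
      (fun r hr => (h1 r hr).deriv) (hsub t ht) (hsub 0 ⟨le_rfl, hτ⟩)
    rw [h2, h.initial]
    rfl
  obtain ⟨M, hM⟩ : ∃ M, ∀ t ∈ Ico 0 τ, Bounded M (y t) := by
    refine ⟨max |avg u₀.toL2| (max R (K / 2 * R)), fun t ht => ⟨?_, ?_, ?_⟩⟩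
    · rw [hmu t ht]
      exact le_max_left _ _
    · refine le_max_of_le_right (le_max_of_le_left ?_)
      refine (ContinuousMap.norm_le _ hR0.le).2 fun x => ?_
      rw [Real.norm_of_nonneg (h.pos t (hsub t ht) x).le]
      exact hup t ht x
    · refine le_max_of_le_right (le_max_of_le_right ?_)
      refine (ContinuousMap.norm_le _ (by positivity)).2 fun x => (hσ t ht x).trans ?_
      have := hup t ht x
      gcongr
  obtain ⟨C, hC⟩ := exists_bound_field (fun t ht => h.hasDerivAt t (hsub t ht)) hM
  obtain ⟨τ₁, hτ₁, z, hzy, hlim, hz⟩ := exists_ode_extension contDiff_field (by linarith) hτ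
    h.hasDerivAt hC
  -- `ρ ≥ m > 0` at time `τ`, hence `ρ > 0` shortly after
  have hposτ : ∀ x, 0 < toC (z τ).2.1 x := fun x => by
    refine hm0.trans_le (ge_of_tendsto (((((evalC x).comp toC).continuous.comp
      contDiff_rho.continuous).tendsto (z τ)).comp hlim) ?_)
    filter_upwards [Ico_mem_nhdsLT hτ] with t ht using hlow t ht x
  have hev : ∀ᶠ t in 𝓝 τ, ∀ x, 0 < toC (z t).2.1 x :=
    (hz τ ⟨by linarith, hτ₁⟩).continuousAt (isOpen_pos.mem_nhds hposτ)
  obtain ⟨ε, hε, hεp⟩ := Metric.eventually_nhds_iff.1 hev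
  have hmin1 := min_le_left τ₁ (τ + ε)
  have hmin2 := min_le_right τ₁ (τ + ε)
  refine ⟨min τ₁ (τ + ε), lt_min hτ₁ (by linarith), z, fun t ht => hz t
    ⟨ht.1, ht.2.trans_le hmin1⟩, (hzy ⟨by linarith, hτ⟩).trans h.initial, fun t ht x => ?_⟩
  rcases lt_or_ge t τ with h1 | h1
  · rw [hzy ⟨ht.1, h1⟩]
    exact h.pos t ⟨ht.1, h1⟩ x
  · refine hεp ?_ x
    rw [Real.dist_eq, abs_of_nonneg (by linarith)]
    linarith [ht.2]

/-- Lagrangian solutions on longer and longer intervals fit together. -/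
theorem exists_isLagrange_sSup {u₀ : Hs s} {d : ℝ} (hd : 0 < d) {S : Set ℝ} (hS : S.Nonempty)
    (hS' : BddAbove S) (hSpos : ∀ τ ∈ S, 0 < τ) (h : ∀ τ ∈ S, ∃ y, IsLagrange u₀ d τ y) :
    ∃ y, IsLagrange u₀ d (sSup S) y := by
  classical
  choose! Y hY using h
  have hagree : ∀ τ₁ ∈ S, ∀ τ₂ ∈ S, τ₁ ≤ τ₂ → EqOn (Y τ₁) (Y τ₂) (Ioo (-d) τ₁) :=
    fun τ₁ h1 τ₂ h2 hle => ode_eqOn contDiff_field isOpen_Ioo ordConnected_Ioo (hY τ₁ h1).hasDerivAt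
      (fun t ht => (hY τ₂ h2).hasDerivAt t ⟨ht.1, ht.2.trans_le hle⟩)
      (t₀ := 0) ⟨by linarith, hSpos τ₁ h1⟩ ((hY τ₁ h1).initial.trans (hY τ₂ h2).initial.symm)
  have hagree' : ∀ τ₁ ∈ S, ∀ τ₂ ∈ S, ∀ t, -d < t → t < τ₁ → t < τ₂ → Y τ₁ t = Y τ₂ t :=
    fun τ₁ h1 τ₂ h2 t h3 h4 h5 => by
      rcases le_total τ₁ τ₂ with hle | hle
      · exact hagree τ₁ h1 τ₂ h2 hle ⟨h3, h4⟩
      · exact (hagree τ₂ h2 τ₁ h1 hle ⟨h3, h5⟩).symm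
  have hex : ∀ t, t < sSup S → ∃ τ ∈ S, t < τ := fun t ht => exists_lt_of_lt_csSup hS ht
  choose! T hT hT' using hex
  have hz : ∀ τ ∈ S, EqOn (fun t => Y (T t) t) (Y τ) (Ioo (-d) τ) := fun τ hτ t ht => by
    have h1 : t < sSup S := ht.2.trans_le (le_csSup hS' hτ)
    exact hagree' _ (hT t h1) τ hτ t ht.1 (hT' t h1) ht.2
  have hcov : ∀ t ∈ Ioo (-d) (sSup S), t ∈ Ioo (-d) (T t) := fun t ht => ⟨ht.1, hT' t ht.2⟩
  obtain ⟨τ₀, hτ₀⟩ := hS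
  refine ⟨fun t => Y (T t) t, fun t ht => ?_, (hz τ₀ hτ₀ ⟨by linarith, hSpos τ₀ hτ₀⟩).trans
    (hY τ₀ hτ₀).initial, fun t ht => (hY _ (hT t ht.2)).pos t (hcov t ht)⟩
  refine ((hY _ (hT t ht.2)).hasDerivAt t (hcov t ht)).congr_of_eventuallyEq ?_
  filter_upwards [isOpen_Ioo.mem_nhds (hcov t ht)] with r hr using hz _ (hT t ht.2) hr

theorem exists_isLagrange (u₀ : Hs s) : ∃ T > 0, ∃ y, IsLagrange u₀ T T y := by
  obtain ⟨T, hT, δ, hδ, α, -, hα⟩ := exists_lagrange_flow u₀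
  obtain ⟨h1, h2, h3⟩ := hα u₀ (Metric.mem_ball_self hδ)
  exact ⟨T, hT, fun t => α (u₀, t), fun t ht => h3 t (Ioo_subset_Icc_self ht), h1,
    fun t ht => h2 t (Ioo_subset_Icc_self ht)⟩

theorem IsLagrange.mono {u₀ : Hs s} {d d' τ τ' : ℝ} {y : ℝ → State s} (h : IsLagrange u₀ d τ y)
    (hd : d' ≤ d) (hτ : τ' ≤ τ) : IsLagrange u₀ d' τ' y :=
  ⟨fun t ht => h.hasDerivAt t ⟨by linarith [ht.1], by linarith [ht.2]⟩, h.initial,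
    fun t ht => h.pos t ⟨by linarith [ht.1], by linarith [ht.2]⟩⟩

theorem persistence_forward {u₀ : Hs s} {a b K : ℝ} (ha : a < 0) (hb : 0 < b) {u : ℝ → Hs s}
    (hu : IsSolution (Ioo a b) u₀ u) (hK : ∀ t ∈ Ico 0 b, ∀ x, |toC (dH s (u t)) x| ≤ K) :
    ∃ b' > b, ∃ v : ℝ → Hs s, IsSolution (Ioo a b') u₀ v ∧ EqOn v u (Ioo a b) := by
  obtain ⟨T, hT, y₀, hy₀⟩ := exists_isLagrange u₀
  obtain ⟨d, hd, hdT, hda⟩ : ∃ d > 0, d ≤ T ∧ d ≤ -a :=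
    ⟨min T (-a), lt_min hT (by linarith), min_le_left _ _, min_le_right _ _⟩
  have hagree : ∀ τ y, 0 < τ → IsLagrange u₀ d τ y →
      EqOn (fun t => (toAdm (y t)).euler) u (Ioo (-d) (min τ b)) := fun τ y hτ hy =>
    uniqueness ordConnected_Ioo ⟨by linarith, lt_min hτ hb⟩
      ((hy.isSolution hd hτ).mono (Ioo_subset_Ioo_right (min_le_left _ _)))
      (hu.mono (Ioo_subset_Ioo (by linarith) (min_le_right _ _)))
  have hext : ∀ τ y, 0 < τ → τ ≤ b → IsLagrange u₀ d τ y → ∃ τ' > τ, ∃ z, IsLagrange u₀ d τ' z :=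
    fun τ y hτ hτb hy => hy.exists_extension hd hτ (K := K) fun t ht x => by
      have h1 : (toAdm (y t)).euler = u t := hagree τ y hτ hy
        ⟨by linarith [ht.1], by rw [min_eq_left hτb]; exact ht.2⟩
      rw [h1]
      exact hK t ⟨ht.1, ht.2.trans_le hτb⟩ x
  -- the Lagrangian solution exists beyond `b`
  obtain ⟨τ, hτ, y, hy⟩ : ∃ τ > b, ∃ y, IsLagrange u₀ d τ y := by
    by_contra hcon
    push Not at hcon
    obtain ⟨S, hS⟩ : ∃ S : Set ℝ, ∀ τ, τ ∈ S ↔ 0 < τ ∧ ∃ y, IsLagrange u₀ d τ y :=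
      ⟨{τ | 0 < τ ∧ ∃ y, IsLagrange u₀ d τ y}, fun _ => Iff.rfl⟩
    have hSb : ∀ τ ∈ S, τ ≤ b := fun τ hτ => by
      by_contra h
      obtain ⟨y, hy⟩ := ((hS τ).1 hτ).2
      exact hcon τ (not_le.1 h) y hy
    have hTS : T ∈ S := (hS T).2 ⟨hT, y₀, hy₀.mono hdT le_rfl⟩
    have hbdd : BddAbove S := ⟨b, hSb⟩
    have hpos : 0 < sSup S := hT.trans_le (le_csSup hbdd hTS)
    obtain ⟨y, hy⟩ := exists_isLagrange_sSup hd ⟨T, hTS⟩ hbdd (fun τ hτ => ((hS τ).1 hτ).1)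
      fun τ hτ => ((hS τ).1 hτ).2
    obtain ⟨τ', hτ', z, hz⟩ := hext _ y hpos (csSup_le ⟨T, hTS⟩ hSb) hy
    exact (le_csSup hbdd ((hS τ').2 ⟨hpos.trans hτ', z, hz⟩)).not_gt hτ'
  have hτ0 : 0 < τ := hb.trans hτ
  obtain ⟨w, hw1, hw2⟩ : ∃ w : ℝ → Hs s, (∀ t < b, w t = u t) ∧
      ∀ t, b ≤ t → w t = (toAdm (y t)).euler :=
    ⟨fun t => if t < b then u t else (toAdm (y t)).euler, fun t ht => if_pos ht,
      fun t ht => if_neg ht.not_gt⟩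
  have hwu : EqOn w u (Ioo a b) := fun t ht => hw1 t ht.2
  have hwv : EqOn w (fun t => (toAdm (y t)).euler) (Ioo (-d) τ) := fun t ht => by
    rcases lt_or_ge t b with h | h
    · rw [hw1 t h]
      exact (hagree τ y hτ0 hy ⟨ht.1, lt_min ht.2 h⟩).symm
    · exact hw2 t h
  have hsol := hu.union isOpen_Ioo isOpen_Ioo (hy.isSolution hd hτ0) ⟨ha, hb⟩ hwu hwv
  refine ⟨τ, hτ, w, hsol.mono fun t ht => ?_, hwu⟩
  rcases lt_or_ge t b with h | h
  · exact Or.inl ⟨ht.1, h⟩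
  · exact Or.inr ⟨by linarith, ht.2⟩

theorem mulH_neg [Fact (1 / 2 < θ)] (f g : Hs θ) : (f ⊙ (-g)) = -(f ⊙ g) := map_neg (mulH f) g

theorem neg_mulH [Fact (1 / 2 < θ)] (f g : Hs θ) : ((-f) ⊙ g) = -(f ⊙ g) := by
  rw [mulH_comm, mulH_neg, mulH_comm]

theorem rhsH_neg (u : Hs s) : rhsH (-u) = rhsH u := by
  have h : fluxH (-u) = fluxH u := by
    rw [fluxH, fluxH, avg_toL2_neg, map_neg (lowH s), map_neg (dH s), mulH_neg, neg_mulH, neg_neg,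
      mul_neg, smul_neg, neg_smul, neg_neg]
  rw [rhsH, rhsH, h, map_neg (lowH s), map_neg (dH s), mulH_neg, neg_mulH, neg_neg]

/-- The equation is invariant under `u(t, x) ↦ -u(-t, x)`. -/
theorem IsSolution.reverse {a b : ℝ} {u₀ : Hs s} {u : ℝ → Hs s} (h : IsSolution (Ioo a b) u₀ u) :
    IsSolution (Ioo (-b) (-a)) (-u₀) (fun t => -u (-t)) := by
  rw [isSolution_iff] at h ⊢
  have hmaps : ∀ t ∈ Ioo (-b) (-a), -t ∈ Ioo a b := fun t ht =>
    ⟨by linarith [ht.2], by linarith [ht.1]⟩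
  refine ⟨(h.1.comp continuous_neg.continuousOn hmaps).neg, fun t ht => ?_, by
    simp only [neg_zero, h.2.2]⟩
  have h1 := ((h.2.1 (-t) (hmaps t ht)).scomp t (hasDerivAt_neg t)).neg
  rw [neg_one_smul, neg_neg, ← rhsH_neg] at h1
  refine h1.congr_of_eventuallyEq (Eventually.of_forall fun r => ?_)
  exact map_neg (lowH s) (u (-r))

theorem persistence_backward {u₀ : Hs s} {a b K : ℝ} (ha : a < 0) (hb : 0 < b) {u : ℝ → Hs s}
    (hu : IsSolution (Ioo a b) u₀ u) (hK : ∀ t ∈ Ioc a 0, ∀ x, |toC (dH s (u t)) x| ≤ K) :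
    ∃ a' < a, ∃ v : ℝ → Hs s, IsSolution (Ioo a' b) u₀ v ∧ EqOn v u (Ioo a b) := by
  obtain ⟨b', hb', v, hv, hvu⟩ := persistence_forward (K := K) (by linarith) (by linarith)
    hu.reverse fun t ht x => by
      rw [map_neg, toC_neg_apply, abs_neg]
      exact hK (-t) ⟨by linarith [ht.2], by linarith [ht.1]⟩ x
  have h := hv.reverse
  rw [neg_neg, neg_neg] at h
  refine ⟨-b', by linarith, _, h, fun t ht => ?_⟩
  have h1 : v (-t) = -u (- -t) := hvu ⟨by linarith [ht.2], by linarith [ht.1]⟩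
  change -v (-t) = u t
  rw [h1, neg_neg, neg_neg]

end Persistence

end

end MuHS

theorem mainTheorem3 (s : ℝ) (hs : 3 / 2 < s) :
    -- local existence, with continuous dependence on the initial data
    (∀ u₀ : MuHS.Hs s, ∃ T > 0, ∃ δ > 0, ∃ Φ : MuHS.Hs s → ℝ → MuHS.Hs s,
      ∀ v₀ ∈ Metric.ball u₀ δ,
        MuHS.IsSolution (Ioo (-T) T) v₀ (Φ v₀) ∧
        TendstoUniformlyOn Φ (Φ v₀) (𝓝 v₀) (Ioo (-T) T) ∧
        TendstoUniformlyOn (fun w₀ => deriv (MuHS.lower (Φ w₀))) (deriv (MuHS.lower (Φ v₀)))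
          (𝓝 v₀) (Ioo (-T) T)) ∧
    -- uniqueness, on every open interval containing 0
    (∀ (u₀ : MuHS.Hs s) (a b : ℝ), a < 0 → 0 < b → ∀ u v : ℝ → MuHS.Hs s,
      MuHS.IsSolution (Ioo a b) u₀ u → MuHS.IsSolution (Ioo a b) u₀ v → EqOn u v (Ioo a b)) ∧
    -- persistence, forward and backward in time, as long as the C¹ norm stays bounded
    (∀ (u₀ : MuHS.Hs s) (a b : ℝ), a < 0 → 0 < b → ∀ u : ℝ → MuHS.Hs s,
      MuHS.IsSolution (Ioo a b) u₀ u →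
        ((∃ K : ℝ, ∀ t ∈ Ico 0 b, MuHS.C1NormLE (u t).toL2 K) →
          ∃ b' > b, ∃ v : ℝ → MuHS.Hs s,
            MuHS.IsSolution (Ioo a b') u₀ v ∧ EqOn v u (Ioo a b)) ∧
        ((∃ K : ℝ, ∀ t ∈ Ioc a 0, MuHS.C1NormLE (u t).toL2 K) →
          ∃ a' < a, ∃ v : ℝ → MuHS.Hs s,
            MuHS.IsSolution (Ioo a' b) u₀ v ∧ EqOn v u (Ioo a b))) := by
  have : Fact (3 / 2 < s) := ⟨hs⟩
  refine ⟨MuHS.local_existence, fun u₀ a b ha hb u v hu hv =>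
    MuHS.uniqueness ordConnected_Ioo ⟨ha, hb⟩ hu hv, fun u₀ a b ha hb u hu => ⟨?_, ?_⟩⟩
  · rintro ⟨K, hK⟩
    exact MuHS.persistence_forward ha hb hu fun t ht x => MuHS.abs_toC_dH_le (hK t ht) x
  · rintro ⟨K, hK⟩
    exact MuHS.persistence_backward ha hb hu fun t ht x => MuHS.abs_toC_dH_le (hK t ht) x
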